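/- Let $G$ be a homogeneous group, i.e. a simply connected nilpotent Lie group with a one-parameter group of automorphisms $(\delta_t)_{t>0}$ (dilations) whose differential at the neutral element $e$ is $\exp(A\log t)$, where $A$ is a diagonalizable linear operator on the Lie algebra with positive eigenvalues; let $Q=\operatorname{tr}A$. Let $r:G\to[0,\infty)$ be a homogeneous norm: $r$ is continuous, smooth on $G\setminus\{e\}$, $r(x^{-1})=r(x)$, $r(\delta_t x)=t\,r(x)$, $r(x)=0$ if and only if $x=e$, and $r(xy)\le c_0(r(x)+r(y))$ for some constant $c_0>0$. Put $B(a,t)=\{y\in G: r(ay^{-1})<t\}$ and let $dx$ be the Haar measure on $G$ normalized by $|B(e,1)|=1$. Let $0<\alpha<Q$ and, for $f\ge 0$, let $(I_\alpha f)(x)=\int_G f(y)\,r(xy^{-1})^{\alpha-Q}\,dy$ be the Riesz potential. A weight is an everywhere positive measurable function on $G$; for a weight $\rho$ put $\|f\|_{L^s(\rho,G)}=\big(\int_G|f|^s\rho\,dx\big)^{1/s}$. A function $f:G\to[0,\infty)$ is radially decreasing if $f(x)=\varphi(r(x))$ with $\varphi$ non-increasing on $(0,\infty)$ (the value of $f$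 at $e$ is immaterial); $L^p_{dec,r}(w,G)$ is the cone of radially decreasing functions in $L^p(w,G)$. The operator $I_\alpha$ is bounded from $L^p_{dec,r}(w,G)$ to $L^q(v,G)$ if there is a finite constant $C$ with $\|I_\alpha f\|_{L^q(v,G)}\le C\|f\|_{L^p(w,G)}$ for all $f\in L^p_{dec,r}(w,G)$. Let $1<p\le q<\infty$, $p'=p/(p-1)$, and let $v$ and $w$ be weights on $G$ such that $w$ is locally integrable and $\int_G w\,dx=\infty$. Put $W(t)=\int_{B(e,t)}w\,dx$. Suppose that at least one of the following holds: * $w\in DC^{\alpha,p}(G)$, i.e. $0<\alpha<Q/p$ and there is a constant $b>0$ such that for all $t>0$ $$\int_{G\setminus B(e,t)} r^{\alpha p'}(x)W^{-p'}(r(x))w(x)\,dx\le b\int_{G\setminus B(e,2t)} r^{\alpha p'}(x)W^{-p'}(r(x))w(x)\,dx;$$ * $v\in DC(G)$, i.e. $v$ is locally integrable and there is a constant $b>1$ such that $\int_{B(e,2t)}v\,dx\le b\int_{B(e,t)}v\,dx$ for all $t>0$. Then $I_\alpha$ is bounded from $L^p_{dec,r}(w,G)$ to $L^q(v,G)$ if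 and only if the following three conditions all hold: (i) $\displaystyle \sup_{t>0}\Big(\int_{B(e,t)}w(x)\,dx\Big)^{-1/p}\Big(\int_{B(e,t)}r^{\alpha q}(x)v(x)\,dx\Big)^{1/q}<\infty$; (ii) $\displaystyle \sup_{t>0}\Big(\int_{B(e,t)}r^{p'Q}(x)W^{-p'}(r(x))w(x)\,dx\Big)^{1/p'}\Big(\int_{G\setminus B(e,t)}r^{(\alpha-Q)q}(x)v(x)\,dx\Big)^{1/q}<\infty$; (iii) $\displaystyle \sup_{t>0}\Big(\int_{B(e,t)}v(x)\,dx\Big)^{1/q}\Big(\int_{G\setminus B(e,t)}r^{\alpha p'}(x)W^{-p'}(r(x))w(x)\,dx\Big)^{1/p'}<\infty$. -/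

import Mathlib

open MeasureTheory Set
open scoped Manifold ContDiff ENNReal NNReal

noncomputable section

/-- The structure of a homogeneous group on a Lie group `G` modelled on the finite-dimensional
real vector space `E`: `G` is simply connected and nilpotent, and it carries a one-parameter group
of automorphisms `δ t`, `t > 0` (the dilations), which on the Lie algebra, i.e. the tangent space
at the identity, is `exp (A log t)` with `A` diagonalizable with positive eigenvalues. -/
structure HomogeneousGroup (E G : Type*) [NormedAddCommGroup E] [NormedSpace ℝ E]
    [FiniteDimensional ℝ E] [TopologicalSpace G] [ChartedSpace E G] [Group G]
    [LieGroup 𝓘(ℝ, E) ∞ G] where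
  simplyConnected : SimplyConnectedSpace G
  nilpotent : Group.IsNilpotent G
  /-- the generator of the dilations, acting on the Lie algebra of `G`, i.e. on the tangent space
  at `1`, which in Mathlib is the model space `E` -/
  A : E →L[ℝ] E
  diagonalizable :
    ∃ (b : Module.Basis (Fin (Module.finrank ℝ E)) ℝ E)
      (ev : Fin (Module.finrank ℝ E) → ℝ), ∀ i, 0 < ev i ∧ A (b i) = ev i • b i
  /-- the dilations; the product in `MulAut G` is composition -/
  δ : {t : ℝ // 0 < t} →* MulAut G
  continuous_δ : Continuous fun z : {t : ℝ // 0 < t} × G => δ z.1 z.2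
  contMDiff_δ : ∀ t, ContMDiff 𝓘(ℝ, E) 𝓘(ℝ, E) ∞ (δ t)
  hasMFDerivAt_δ : ∀ t, HasMFDerivAt 𝓘(ℝ, E) 𝓘(ℝ, E) (δ t) (1 : G)
    (NormedSpace.exp (Real.log (t : ℝ) • A) : E →L[ℝ] E)

namespace HomogeneousGroup

/-- The homogeneous dimension `Q = tr A`. -/
def Q {E G : Type*} [NormedAddCommGroup E] [NormedSpace ℝ E]
    [FiniteDimensional ℝ E] [TopologicalSpace G] [ChartedSpace E G] [Group G]
    [LieGroup 𝓘(ℝ, E) ∞ G] (H : HomogeneousGroup E G) : ℝ :=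
  LinearMap.trace ℝ E (H.A : E →ₗ[ℝ] E)

end HomogeneousGroup

/-- A homogeneous norm on a homogeneous group. -/
structure HomogeneousNorm {E G : Type*} [NormedAddCommGroup E] [NormedSpace ℝ E]
    [FiniteDimensional ℝ E] [TopologicalSpace G] [ChartedSpace E G] [Group G]
    [LieGroup 𝓘(ℝ, E) ∞ G] (H : HomogeneousGroup E G) where
  /-- the norm itself -/
  r : G → ℝ
  nonneg : ∀ x, 0 ≤ r x
  continuous_r : Continuous r
  contMDiffOn_r : ContMDiffOn 𝓘(ℝ, E) 𝓘(ℝ, ℝ) ∞ r {1}ᶜ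
  inv : ∀ x, r x = r x⁻¹
  dilate : ∀ (t : {t : ℝ // 0 < t}) (x : G), r (H.δ t x) = t * r x
  eq_zero_iff : ∀ x, r x = 0 ↔ x = 1
  quasi_triangle : ∃ c₀ : ℝ, 0 < c₀ ∧ ∀ x y, r (x * y) ≤ c₀ * (r x + r y)

/-- A weight: an everywhere positive measurable function. -/
def IsWeight {G : Type*} [MeasurableSpace G] (μ : Measure G) (ρ : G → ℝ) : Prop :=
  AEMeasurable ρ μ ∧ ∀ x, 0 < ρ x

namespace HomogeneousNorm

section

variable {E G : Type*} [NormedAddCommGroup E] [NormedSpace ℝ E]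
  [FiniteDimensional ℝ E] [TopologicalSpace G] [ChartedSpace E G] [Group G]
  [LieGroup 𝓘(ℝ, E) ∞ G] {H : HomogeneousGroup E G} (N : HomogeneousNorm H)

/-- The open ball `B(a, t) = {y : r(a y⁻¹) < t}`. -/
def ball (a : G) (t : ℝ) : Set G := {y | N.r (a * y⁻¹) < t}

/-- `x ↦ r(x) ^ s` as a function with values in `[0, ∞]`. -/
def rpow (s : ℝ) (x : G) : ℝ≥0∞ := ENNReal.ofReal (N.r x) ^ s

/-- The class `DR(G)` of radially decreasing functions with values in `[0, ∞)`: `f = φ ∘ r`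
with `φ` (weakly) decreasing on `(0, ∞)`. The profile may be unbounded at `0`; its value at `0`
matters only at the identity. -/
def IsRadiallyDecreasing (f : G → ℝ≥0) : Prop :=
  ∃ φ : ℝ → ℝ≥0, AntitoneOn φ (Ioi 0) ∧ ∀ x, f x = φ (N.r x)

variable [MeasurableSpace G] (μ : Measure G)

/-- The Riesz potential `(I_α f)(x) = ∫ f(y) r(x y⁻¹) ^ (α - Q) dy` of a non-negative `f`. -/
def rieszPotential (α : ℝ) (f : G → ℝ≥0) (x : G) : ℝ≥0∞ :=
  ∫⁻ y, f y * N.rpow (α - H.Q) (x * y⁻¹) ∂μ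

/-- The weighted norm `(∫ f ^ p ρ) ^ (1/p)` of a `[0, ∞]`-valued function. -/
def weightedNorm (p : ℝ) (ρ : G → ℝ) (f : G → ℝ≥0∞) : ℝ≥0∞ :=
  (∫⁻ x, f x ^ p * ENNReal.ofReal (ρ x) ∂μ) ^ (1 / p)

/-- Boundedness of `I_α` from `L^p_{dec,r}(w, G)`, the radially decreasing functions in
`L^p(w, G)`, to `L^q(v, G)`. -/
def RieszBounded (α p q : ℝ) (w v : G → ℝ) : Prop :=
  ∃ C : ℝ≥0, ∀ f : G → ℝ≥0, N.IsRadiallyDecreasing f →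
    weightedNorm μ p w (fun x => f x) < ⊤ →
      weightedNorm μ q v (N.rieszPotential μ α f) ≤ C * weightedNorm μ p w (fun x => f x)

/-- `W(t) = ∫_{B(e, t)} w`. -/
def W (w : G → ℝ) (t : ℝ) : ℝ≥0∞ := ∫⁻ x in N.ball 1 t, ENNReal.ofReal (w x) ∂μ

/-- The integrand `r(x) ^ s · W(r(x)) ^ (-p') · w(x)`, where `p' = p / (p - 1)`. -/
def dualDensity (p s : ℝ) (w : G → ℝ) (x : G) : ℝ≥0∞ :=
  N.rpow s x * N.W μ w (N.r x) ^ (-(p / (p - 1))) * ENNReal.ofReal (w x)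

/-- The doubling condition at the identity, `ρ ∈ DC(G)`. -/
def DC (ρ : G → ℝ) : Prop :=
  LocallyIntegrable ρ μ ∧ (∀ᵐ x ∂μ, 0 < ρ x) ∧
    ∃ b : ℝ≥0, 1 < b ∧ ∀ t : ℝ, 0 < t →
      ∫⁻ x in N.ball 1 (2 * t), ENNReal.ofReal (ρ x) ∂μ ≤
        b * ∫⁻ x in N.ball 1 t, ENNReal.ofReal (ρ x) ∂μ

/-- The condition `w ∈ DC^{γ,p}(G)`, where `1 < p` and `0 < γ < Q / p`. -/
def DCDual (γ p : ℝ) (w : G → ℝ) : Prop :=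
  1 < p ∧ 0 < γ ∧ γ < H.Q / p ∧
    ∃ b : ℝ≥0, 0 < b ∧ ∀ t : ℝ, 0 < t →
      ∫⁻ x in (N.ball 1 t)ᶜ, N.dualDensity μ p (γ * (p / (p - 1))) w x ∂μ ≤
        b * ∫⁻ x in (N.ball 1 (2 * t))ᶜ, N.dualDensity μ p (γ * (p / (p - 1))) w x ∂μ

end

end HomogeneousNorm

end

/-! Write `ν = w dx` and `p' = p / (p - 1)`. The group enters only through `r` and the volume
`|B(e,t)| = t ^ Q`; what remains is a pair of Hardy operators on a space ordered by `r`.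

Geometry. A dilation multiplies Haar measure by a constant `c(t)`, multiplicative in `t`. Comparing
Haar measure with the chart at the identity gives `c(t) ≤ C t ^ Q`, and powers and inverses of `t`
remove `C` (`measure_image_δ`). Hence balls have the expected volume, spheres are null and the
modular character, being bounded, is trivial. Sublevel sets of `r` are compact, so `W` is finite.

Sufficiency. Splitting the potential according to the size of `r(x y⁻¹)` bounds `I_α f` by `r ^ (α -
Q) ∫_{r(y) < r(x)} f` plus the tail integral of `f r ^ (α - Q)` (`exists_rieszPotential_le`). A
decreasing `f` is at most four times the tail integral `∫_{r(z) > r(x)} (g / W) dν`, where `g(z)` is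
the `ν`-average of `f` over `{r < r(z)}` (`decreasing_le_conj_average`; this needs `ν(G) = ∞`).
Inserting this and exchanging integrals leaves Hardy operators that act on an arbitrary `g`, with
kernels `r ^ Q / W` and `r ^ α / W`. Muckenhoupt's criterion for `p ≤ q` (`lintegral_hardy` and its
conjugate) applies exactly under (ii) and (iii), and `‖g‖_p ≤ C ‖f‖_p` is Hardy's inequality for
averages.

Necessity. For (i) the indicator of a ball is tested. For (ii) and (iii) the test functions are
conjugate averages `f(x) = ∫_{r(z) > r(x)} (g / W) dν` of the extremal `g` in Hölder's inequality.
They are decreasing, and `‖f‖_p ≤ C ‖g‖_p` by the conjugate Hardy inequality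
(`exists_test_functions`). -/

open MeasureTheory Set
open scoped Manifold ContDiff ENNReal NNReal

noncomputable section

/-! ### Haar measure compared with Hausdorff measure in the chart at the identity -/

section ChartMeasure

open Topology

variable {E G : Type*} [NormedAddCommGroup E] [NormedSpace ℝ E]
  [TopologicalSpace G] [ChartedSpace E G] [Group G]

/-- Order one suffices: a jointly `C¹` multiplication is locally Lipschitz, so the left translations
near `1` share one Lipschitz constant in the chart. -/
theorem contDiffAt_chart_mul [LieGroup 𝓘(ℝ, E) ∞ G] :
    ContDiffAt ℝ 1 (fun p : E × E => chartAt E (1 : G)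
      ((chartAt E (1 : G)).symm p.1 * (chartAt E (1 : G)).symm p.2))
      (chartAt E (1 : G) 1, chartAt E (1 : G) 1) := by
  have : IsManifold 𝓘(ℝ, E) ∞ G := inferInstance
  set e := chartAt E (1 : G) with he
  have h1 : (1 : G) ∈ e.source := mem_chart_source E 1
  have hsymm : ContMDiffAt 𝓘(ℝ, E) 𝓘(ℝ, E) ∞ e.symm (e 1) :=
    (contMDiffOn_chart_symm (I := 𝓘(ℝ, E)) (x := (1 : G))).contMDiffAt
      (e.open_target.mem_nhds (e.map_source h1))
  have hf : ContMDiffAt 𝓘(ℝ, E × E) 𝓘(ℝ, E) ∞ (fun p : E × E => e.symm p.1) (e 1, e 1) :=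
    ContMDiffAt.comp (I' := 𝓘(ℝ, E)) (e 1, e 1) hsymm contDiff_fst.contMDiff.contMDiffAt
  have hs : ContMDiffAt 𝓘(ℝ, E × E) 𝓘(ℝ, E) ∞ (fun p : E × E => e.symm p.2) (e 1, e 1) :=
    ContMDiffAt.comp (I' := 𝓘(ℝ, E)) (e 1, e 1) hsymm contDiff_snd.contMDiff.contMDiffAt
  have hm := hf.mul hs
  have hv : e.symm (e 1) * e.symm (e 1) = 1 := by simp [e.left_inv h1]
  have hc : ContMDiffAt 𝓘(ℝ, E) 𝓘(ℝ, E) ∞ e (e.symm (e 1) * e.symm (e 1)) := by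
    rw [hv]
    exact (contMDiffOn_chart (I := 𝓘(ℝ, E)) (x := (1 : G))).contMDiffAt
      (e.open_source.mem_nhds h1)
  have := ContMDiffAt.comp (I' := 𝓘(ℝ, E)) (e 1, e 1) hc hm
  exact (contMDiffAt_iff_contDiffAt.1 this).of_le (by simp)

variable [MeasurableSpace E] [BorelSpace E]

variable (E G) in
/-- The measure on `G` carried by the domain of the chart at `1` that corresponds to the
Hausdorff measure of full dimension on the model space. -/
def chartMeasure [MeasurableSpace G] : Measure G :=
  ((Measure.hausdorffMeasure (Module.finrank ℝ E) : Measure E).restrict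
    (chartAt E (1 : G)).target).map (chartAt E (1 : G)).symm

instance [FiniteDimensional ℝ E] [MeasurableSpace G] : SFinite (chartMeasure E G) := by
  unfold chartMeasure; infer_instance

theorem chartMeasure_apply [MeasurableSpace G] [BorelSpace G] {S : Set G} (hS : MeasurableSet S) :
    chartMeasure E G S = (Measure.hausdorffMeasure (Module.finrank ℝ E) : Measure E)
      (chartAt E (1 : G) '' ((chartAt E (1 : G)).source ∩ S)) := by
  have hm : AEMeasurable (chartAt E (1 : G)).symm
      ((Measure.hausdorffMeasure (Module.finrank ℝ E) : Measure E).restrict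
        (chartAt E (1 : G)).target) :=
    ContinuousOn.aemeasurable (chartAt E (1 : G)).continuousOn_symm
      (chartAt E (1 : G)).open_target.measurableSet
  rw [chartMeasure, Measure.map_apply_of_aemeasurable hm hS,
    Measure.restrict_apply₀' (chartAt E (1 : G)).open_target.measurableSet.nullMeasurableSet,
    (chartAt E (1 : G)).image_source_inter_eq', inter_comm]

variable [LieGroup 𝓘(ℝ, E) ∞ G]

/-- Left translations by elements near `1` increase the chart measure of small sets at most by
a constant factor. -/
theorem exists_chartMeasure_translate_le [MeasurableSpace G] [BorelSpace G] :
    ∃ K : ℝ≥0, ∃ V ∈ 𝓝 (1 : G), V ⊆ (chartAt E (1 : G)).source ∧ 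
      ∀ x ∈ V, ∀ S ⊆ V, MeasurableSet S →
        chartMeasure E G ((fun y => x⁻¹ * y) ⁻¹' S) ≤ K * chartMeasure E G S := by
  have : IsManifold 𝓘(ℝ, E) ∞ G := inferInstance
  have : IsTopologicalGroup G := topologicalGroup_of_lieGroup 𝓘(ℝ, E) ∞
  obtain ⟨K, t, ht, hL⟩ := (contDiffAt_chart_mul (E := E) (G := G)).exists_lipschitzOnWith
  set e := chartAt E (1 : G) with he
  have h1 : (1 : G) ∈ e.source := mem_chart_source E 1
  rw [nhds_prod_eq, Filter.mem_prod_self_iff] at ht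
  obtain ⟨T, hT, hTt⟩ := ht
  have hmul : (fun p : G × G => p.1 * p.2) ⁻¹' e.source ∈ 𝓝 ((1 : G), (1 : G)) :=
    (continuous_mul.tendsto _) (by simpa using e.open_source.mem_nhds h1)
  rw [nhds_prod_eq, Filter.mem_prod_self_iff] at hmul
  obtain ⟨V', hV', hVm⟩ := hmul
  -- A `K`-Lipschitz map increases `d`-dimensional Hausdorff measure by at most `K ^ d`.
  refine ⟨K ^ (Module.finrank ℝ E : ℝ), (e.source ∩ e ⁻¹' T) ∩ V', ?_, fun x hx => hx.1.1, ?_⟩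
  · refine Filter.inter_mem (Filter.inter_mem (e.open_source.mem_nhds h1) ?_) hV'
    exact (e.continuousAt h1) hT
  intro x hx S hSV hS
  have hmS : MeasurableSet ((fun y => x⁻¹ * y) ⁻¹' S) :=
    (continuous_const_mul x⁻¹).measurable hS
  rw [chartMeasure_apply hmS, chartMeasure_apply hS]
  have hsub : e '' (e.source ∩ (fun y => x⁻¹ * y) ⁻¹' S) ⊆
      (fun b => e (e.symm (e x) * e.symm b)) '' (e '' (e.source ∩ S)) := by
    rintro _ ⟨y, ⟨hy, hyS⟩, rfl⟩
    refine ⟨e (x⁻¹ * y), ⟨x⁻¹ * y, ⟨(hSV hyS).1.1, hyS⟩, rfl⟩, ?_⟩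
    simp only
    rw [e.left_inv hx.1.1, e.left_inv (hSV hyS).1.1]
    simp
  refine (measure_mono hsub).trans ?_
  have hLx : LipschitzOnWith K (fun b => e (e.symm (e x) * e.symm b)) (e '' (e.source ∩ S)) := by
    have h2 : LipschitzOnWith 1 (fun b : E => (e x, b)) (e '' (e.source ∩ S)) :=
      (LipschitzWith.prodMk_left (e x)).lipschitzOnWith
    have := hL.comp h2 (by
      rintro _ ⟨y, ⟨hy, hyS⟩, rfl⟩
      exact hTt ⟨hx.1.2, (hSV hyS).1.2⟩)
    simpa [Function.comp_def] using this
  have := hLx.hausdorffMeasure_image_le (d := Module.finrank ℝ E) (by positivity)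
  refine this.trans (le_of_eq ?_)
  rw [ENNReal.coe_rpow_of_nonneg _ (by positivity)]

/-- Near the identity, the inverse of a Haar measure is comparable to the chart measure. -/
theorem exists_haar_inv_comparable_chartMeasure [FiniteDimensional ℝ E] [SecondCountableTopology G]
    [MeasurableSpace G] [BorelSpace G] (μ : Measure G) [μ.IsHaarMeasure] :
    ∃ C : ℝ≥0∞, C ≠ ⊤ ∧ ∃ V ∈ 𝓝 (1 : G), ∀ S ⊆ V, MeasurableSet S →
      μ S⁻¹ ≤ C * chartMeasure E G S ∧ chartMeasure E G S ≤ C * μ S⁻¹ := by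
  have : IsTopologicalGroup G := topologicalGroup_of_lieGroup 𝓘(ℝ, E) ∞
  have : LocallyCompactSpace G := ChartedSpace.locallyCompactSpace E G
  obtain ⟨K, V₁, hV₁, hV₁s, hK⟩ := exists_chartMeasure_translate_le (E := E) (G := G)
  set e := chartAt E (1 : G) with he
  have h1 : (1 : G) ∈ e.source := mem_chart_source E 1
  obtain ⟨V₂, hV₂, hV₂μ⟩ := μ.finiteAt_nhds (1 : G)
  have hV₃ : e ⁻¹' Metric.ball (e 1) 1 ∈ 𝓝 (1 : G) :=
    (e.continuousAt h1) (Metric.ball_mem_nhds _ one_pos)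
  obtain ⟨V, hVsub, hVo, hV1⟩ := mem_nhds_iff.1 (Filter.inter_mem (Filter.inter_mem hV₁ hV₂) hV₃)
  obtain ⟨U, hUo, hU1, hUV⟩ := exists_open_nhds_one_mul_subset (hVo.mem_nhds hV1)
  set V₀ := U ∩ U⁻¹ with hV₀
  have hV₀o : IsOpen V₀ := hUo.inter hUo.inv
  have hV₀1 : (1 : G) ∈ V₀ := ⟨hU1, by simpa using hU1⟩
  have hV₀inv : ∀ x ∈ V₀, x⁻¹ ∈ V₀ := fun x hx => ⟨hx.2, by simpa using hx.1⟩
  have hV₀mul : ∀ x ∈ V₀, ∀ y ∈ V₀, x * y ∈ V := fun x hx y hy => hUV ⟨x, hx.1, y, hy.1, rfl⟩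
  have hV₀V : V₀ ⊆ V := fun x hx => by simpa using hV₀mul x hx 1 hV₀1
  have hμV : μ V ≠ ⊤ := ((measure_mono fun x hx => (hVsub hx).1.2).trans_lt hV₂μ).ne
  have hμV₀ : μ V₀ ≠ 0 := (hV₀o.measure_pos μ ⟨1, hV₀1⟩).ne'
  have hcmV : chartMeasure E G V ≠ ⊤ := by
    rw [chartMeasure_apply hVo.measurableSet]
    refine ((measure_mono ?_).trans_lt (Metric.isBounded_ball (x := e 1) (r := 1)).measure_lt_top).ne
    rintro _ ⟨x, hx, rfl⟩
    exact (hVsub hx.2).2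
  have hcmV₀ : chartMeasure E G V₀ ≠ 0 := by
    rw [chartMeasure_apply hV₀o.measurableSet]
    exact ((e.isOpen_image_source_inter hV₀o).measure_pos _ ⟨e 1, 1, ⟨h1, hV₀1⟩, rfl⟩).ne'
  -- Tonelli on `{(x, y) | x⁻¹ y ∈ S}`: for fixed `x` this says `y ∈ x S`, for fixed `y` it says `x
  -- ∈ y S⁻¹`. Left invariance of `μ` then produces `μ S⁻¹`, which is why the comparison concerns
  -- inverses.
  have hfub : ∀ A : Set G, MeasurableSet A → ∀ S : Set G, MeasurableSet S →
      ∫⁻ x in A, chartMeasure E G ((fun y => x⁻¹ * y) ⁻¹' S) ∂μ =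
        ∫⁻ y, μ (A ∩ (fun x => y⁻¹ * x) ⁻¹' S⁻¹) ∂(chartMeasure E G) := by
    intro A hA S hS
    have hT : MeasurableSet {p : G × G | p.1⁻¹ * p.2 ∈ S} :=
      (measurable_fst.inv.mul measurable_snd) hS
    have e1 := Measure.prod_apply (μ := μ.restrict A) (ν := chartMeasure E G) hT
    rw [Measure.prod_apply_symm hT] at e1
    refine e1.symm.trans (lintegral_congr fun y => ?_)
    rw [Measure.restrict_apply (measurable_prodMk_right hT), inter_comm]
    congr 1
    ext x
    simp
  have hleft : ∀ (S : Set G) (y : G), μ ((fun x => y⁻¹ * x) ⁻¹' S⁻¹) = μ S⁻¹ := fun S y =>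
    measure_preimage_mul μ y⁻¹ S⁻¹
  refine ⟨(chartMeasure E G V₀)⁻¹ * (K * μ V) + K * (μ V₀)⁻¹ * chartMeasure E G V, ?_, V₀,
    hV₀o.mem_nhds hV₀1, ?_⟩
  · finiteness
  intro S hSV₀ hS
  -- For `y ∈ V₀` the whole translate `y S⁻¹` lies in `V`, so nothing is lost by intersecting with
  -- `V`.
  have hub : chartMeasure E G V₀ * μ S⁻¹ ≤ K * μ V * chartMeasure E G S := by
    calc chartMeasure E G V₀ * μ S⁻¹ = ∫⁻ y in V₀, μ S⁻¹ ∂(chartMeasure E G) := by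
          rw [setLIntegral_const, mul_comm]
      _ ≤ ∫⁻ y in V₀, μ (V ∩ (fun x => y⁻¹ * x) ⁻¹' S⁻¹) ∂(chartMeasure E G) := by
          refine setLIntegral_mono' hV₀o.measurableSet fun y hy => ?_
          rw [← hleft S y]
          refine measure_mono fun x hx => ⟨?_, hx⟩
          have hx' : y⁻¹ * x ∈ S⁻¹ := hx
          have := hV₀mul y hy _ (hV₀inv _ (hSV₀ hx'))
          simpa using this
      _ ≤ ∫⁻ y, μ (V ∩ (fun x => y⁻¹ * x) ⁻¹' S⁻¹) ∂(chartMeasure E G) :=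
          setLIntegral_le_lintegral _ _
      _ = ∫⁻ x in V, chartMeasure E G ((fun y => x⁻¹ * y) ⁻¹' S) ∂μ :=
          (hfub V hVo.measurableSet S hS).symm
      _ ≤ ∫⁻ x in V, K * chartMeasure E G S ∂μ :=
          setLIntegral_mono' hVo.measurableSet fun x hx =>
            hK x (hVsub hx).1.1 S (fun s hs => (hVsub (hV₀V (hSV₀ hs))).1.1) hS
      _ = K * μ V * chartMeasure E G S := by rw [setLIntegral_const]; ring
  -- The translation bound for `x⁻¹`, applied to `x S`, gives the reverse inequality; `y S⁻¹` meets
  -- `V₀` only for `y ∈ V`.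
  have hlb : μ V₀ * chartMeasure E G S ≤ K * chartMeasure E G V * μ S⁻¹ := by
    calc μ V₀ * chartMeasure E G S = ∫⁻ x in V₀, chartMeasure E G S ∂μ := by
          rw [setLIntegral_const, mul_comm]
      _ ≤ ∫⁻ x in V₀, K * chartMeasure E G ((fun y => x⁻¹ * y) ⁻¹' S) ∂μ := by
          refine setLIntegral_mono' hV₀o.measurableSet fun x hx => ?_
          have h := hK x⁻¹ (hVsub (hV₀V (hV₀inv x hx))).1.1 ((fun y => x⁻¹ * y) ⁻¹' S)
            (fun y hy => by
              have := hV₀mul x hx _ (hSV₀ hy)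
              exact (hVsub (by simpa using this)).1.1)
            ((continuous_const_mul x⁻¹).measurable hS)
          simpa [preimage_preimage] using h
      _ = K * ∫⁻ x in V₀, chartMeasure E G ((fun y => x⁻¹ * y) ⁻¹' S) ∂μ :=
          lintegral_const_mul' _ _ ENNReal.coe_ne_top
      _ = K * ∫⁻ y, μ (V₀ ∩ (fun x => y⁻¹ * x) ⁻¹' S⁻¹) ∂(chartMeasure E G) := by
          rw [hfub V₀ hV₀o.measurableSet S hS]
      _ ≤ K * ∫⁻ y in V, μ S⁻¹ ∂(chartMeasure E G) := by
          refine mul_le_mul' le_rfl ?_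
          rw [← lintegral_indicator hVo.measurableSet]
          refine lintegral_mono fun y => ?_
          by_cases hy : y ∈ V
          · rw [indicator_of_mem hy, ← hleft S y]
            exact measure_mono inter_subset_right
          · rw [indicator_of_notMem hy, nonpos_iff_eq_zero]
            refine measure_mono_null (fun x hx => hy ?_) measure_empty
            have hx2 : y⁻¹ * x ∈ S⁻¹ := hx.2
            have := hV₀mul x hx.1 _ (hSV₀ hx2)
            simpa using this
      _ = K * chartMeasure E G V * μ S⁻¹ := by rw [setLIntegral_const]; ring
  have hμV₀t : μ V₀ ≠ ⊤ := ne_top_of_le_ne_top hμV (measure_mono hV₀V)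
  have hcmV₀t : chartMeasure E G V₀ ≠ ⊤ := ne_top_of_le_ne_top hcmV (measure_mono hV₀V)
  constructor
  · calc μ S⁻¹ = (chartMeasure E G V₀)⁻¹ * (chartMeasure E G V₀ * μ S⁻¹) := by
          rw [← mul_assoc, ENNReal.inv_mul_cancel hcmV₀ hcmV₀t, one_mul]
      _ ≤ (chartMeasure E G V₀)⁻¹ * (K * μ V * chartMeasure E G S) := by gcongr
      _ = (chartMeasure E G V₀)⁻¹ * (K * μ V) * chartMeasure E G S := by ring
      _ ≤ _ := by gcongr; exact le_self_add
  · calc chartMeasure E G S = (μ V₀)⁻¹ * (μ V₀ * chartMeasure E G S) := by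
          rw [← mul_assoc, ENNReal.inv_mul_cancel hμV₀ hμV₀t, one_mul]
      _ ≤ (μ V₀)⁻¹ * (K * chartMeasure E G V * μ S⁻¹) := by gcongr
      _ = K * (μ V₀)⁻¹ * chartMeasure E G V * μ S⁻¹ := by ring
      _ ≤ _ := by gcongr; exact le_add_self

end ChartMeasure

/-! ### Exponential, trace and determinant of a diagonalizable operator -/

section Diagonalizable

variable {E : Type*} [NormedAddCommGroup E] [NormedSpace ℝ E]

theorem exp_smul_apply_of_apply_eq_smul [FiniteDimensional ℝ E] {A : E →L[ℝ] E} {x : E} {a : ℝ} (h : A x = a • x) (s : ℝ) :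
    (NormedSpace.exp (s • A) : E →L[ℝ] E) x = Real.exp (s * a) • x := by
  have h1 := (NormedSpace.exp_series_hasSum_exp' (𝕂 := ℝ) (s • A)).mapL
    (ContinuousLinearMap.apply ℝ E x)
  have h2 := (NormedSpace.exp_series_hasSum_exp' (𝕂 := ℝ) (s * a)).smul_const x
  rw [← Real.exp_eq_exp_ℝ] at h2
  have hpow : ∀ n : ℕ, ((s • A) ^ n) x = (s * a) ^ n • x := by
    intro n
    induction n with
    | zero => simp
    | succ n ih =>
      rw [pow_succ', mul_apply_eq_comp, ih, map_smul, smul_apply, h,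
        smul_smul, smul_smul]
      ring_nf
  refine HasSum.unique ?_ h2
  convert h1 using 2 with n
  · simp [hpow, smul_smul]
  · rfl

theorem trace_eq_sum_of_basis {A : E →L[ℝ] E} {ι : Type*} [Fintype ι] (b : Module.Basis ι ℝ E) {ev : ι → ℝ}
    (h : ∀ i, A (b i) = ev i • b i) : LinearMap.trace ℝ E (A : E →ₗ[ℝ] E) = ∑ i, ev i := by
  classical
  rw [LinearMap.trace_eq_matrix_trace ℝ b, Matrix.trace]
  refine Finset.sum_congr rfl fun i _ => ?_
  simp [LinearMap.toMatrix_apply, h]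

theorem det_eq_prod_of_basis {A : E →L[ℝ] E} {ι : Type*} [Fintype ι] (b : Module.Basis ι ℝ E) {ev : ι → ℝ}
    (h : ∀ i, A (b i) = ev i • b i) : A.det = ∏ i, ev i := by
  classical
  have hm : LinearMap.toMatrix b b (A : E →ₗ[ℝ] E) = Matrix.diagonal ev := by
    ext i j
    rcases eq_or_ne i j with rfl | hij
    · simp [LinearMap.toMatrix_apply, h]
    · simp [LinearMap.toMatrix_apply, h, hij]
  rw [ContinuousLinearMap.det, ← LinearMap.det_toMatrix b, hm, Matrix.det_diagonal]

end Diagonalizable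

/-! ### The scaling factor of an automorphism and its Jacobian -/

section Jacobian

open Topology

variable {E G : Type*} [NormedAddCommGroup E] [NormedSpace ℝ E] [FiniteDimensional ℝ E]
  [TopologicalSpace G] [SecondCountableTopology G] [ChartedSpace E G] [Group G]
  [LieGroup 𝓘(ℝ, E) ∞ G] [MeasurableSpace G] [BorelSpace G]

/-- The factor by which a smooth automorphism scales Haar measure is bounded by a constant multiple
of the determinant of its differential at `1`. -/
theorem exists_haar_image_le_det (μ : Measure G) [μ.IsHaarMeasure] :
    ∃ C : ℝ≥0∞, C ≠ ⊤ ∧ ∀ (φ : G ≃* G) (D : E →L[ℝ] E) (c : ℝ≥0∞),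
      ContMDiff 𝓘(ℝ, E) 𝓘(ℝ, E) ∞ φ → Continuous φ.symm →
      HasMFDerivAt 𝓘(ℝ, E) 𝓘(ℝ, E) φ (1 : G) D →
      (∀ S, MeasurableSet S → μ (φ '' S) = c * μ S) → c ≤ C * ENNReal.ofReal |D.det| := by
  borelize E
  have : IsTopologicalGroup G := topologicalGroup_of_lieGroup 𝓘(ℝ, E) ∞
  have : LocallyCompactSpace G := ChartedSpace.locallyCompactSpace E G
  obtain ⟨C, hC, V, hV, hcomp⟩ := exists_haar_inv_comparable_chartMeasure (E := E) μ
  refine ⟨C * C, ENNReal.mul_ne_top hC hC, ?_⟩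
  intro φ D c hφ hφs hD hc
  set e := chartAt E (1 : G) with he
  have h1 : (1 : G) ∈ e.source := mem_chart_source E 1
  set ψ : E → E := fun b => e (φ (e.symm b)) with hψ
  have hφ1 : φ 1 = 1 := map_one φ
  have hψd : HasFDerivAt ψ D (e 1) := by
    have h := hD.2
    rw [writtenInExtChartAt, hφ1] at h
    simp only [extChartAt, mfld_simps] at h
    exact hasFDerivWithinAt_univ.1 h
  have hψc : ContDiffAt ℝ ∞ ψ (e 1) := by
    have hsymm : ContMDiffAt 𝓘(ℝ, E) 𝓘(ℝ, E) ∞ e.symm (e 1) :=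
      (contMDiffOn_chart_symm (I := 𝓘(ℝ, E)) (x := (1 : G))).contMDiffAt
        (e.open_target.mem_nhds (e.map_source h1))
    have h2 : ContMDiffAt 𝓘(ℝ, E) 𝓘(ℝ, E) ∞ (fun b => φ (e.symm b)) (e 1) :=
      hφ.contMDiffAt.comp (e 1) hsymm
    have hv : φ (e.symm (e 1)) = 1 := by rw [e.left_inv h1, hφ1]
    have h3 : ContMDiffAt 𝓘(ℝ, E) 𝓘(ℝ, E) ∞ e (φ (e.symm (e 1))) := by
      rw [hv]
      exact (contMDiffOn_chart (I := 𝓘(ℝ, E)) (x := (1 : G))).contMDiffAt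
        (e.open_source.mem_nhds h1)
    exact contMDiffAt_iff_contDiffAt.1 (ContMDiffAt.comp (I' := 𝓘(ℝ, E)) (e 1) h3 h2)
  have hstrict : HasStrictFDerivAt ψ D (e 1) := hψc.hasStrictFDerivAt' hψd (by simp)
  -- Near the identity the automorphism read in the chart is a small Lipschitz perturbation of `D`,
  -- so it scales volume by at most any `m > |det D|`. The neighbourhood depends on `φ` and `m`, but
  -- the comparison constant, used once in each direction, does not.
  have key : ∀ m : ℝ≥0, ENNReal.ofReal |D.det| < m → c ≤ C * C * m := by
    intro m hm
    obtain ⟨δ, hδ, hδ0⟩ := ((addHaar_image_le_mul_of_det_lt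
      (Measure.hausdorffMeasure (Module.finrank ℝ E) : Measure E) D hm).and
      self_mem_nhdsWithin).exists
    obtain ⟨s, hs, hsD⟩ := hstrict.approximates_deriv_on_nhds (c := δ) (Or.inr hδ0)
    obtain ⟨Z, hZ, hZμ⟩ := μ.finiteAt_nhds (1 : G)
    have hφc : Filter.Tendsto φ (𝓝 1) (𝓝 1) := by
      simpa [hφ1] using hφ.continuous.tendsto (1 : G)
    have hZi : Z⁻¹ ∈ 𝓝 (1 : G) := inv_mem_nhds_one G hZ
    obtain ⟨S, hSsub, hSo, hS1⟩ := mem_nhds_iff.1 (Filter.inter_mem (Filter.inter_mem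
      (Filter.inter_mem (Filter.inter_mem hV (hφc hV)) (e.open_source.mem_nhds h1)) hZi)
      ((e.continuousAt h1) hs))
    have hφopen : IsOpen (φ '' S) := by
      rw [show φ '' S = φ.symm ⁻¹' S from φ.toEquiv.image_eq_preimage_symm S]
      exact hSo.preimage hφs
    have hSi0 : μ S⁻¹ ≠ 0 := (hSo.inv.measure_pos μ ⟨1, by simpa using hS1⟩).ne'
    have hSit : μ S⁻¹ ≠ ⊤ := ((measure_mono (fun x hx => by
      have := (hSsub hx).1.2
      simpa using this)).trans_lt hZμ).ne
    have hinv : (φ '' S)⁻¹ = φ '' S⁻¹ := by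
      ext x
      constructor
      · rintro ⟨y, hy, hyx⟩
        exact ⟨y⁻¹, by simpa using hy, by rw [map_inv, hyx, inv_inv]⟩
      · rintro ⟨y, hy, rfl⟩
        exact ⟨y⁻¹, hy, by rw [map_inv]⟩
    have hcm1 : chartMeasure E G (φ '' S) ≤ m * chartMeasure E G S := by
      rw [chartMeasure_apply hφopen.measurableSet, chartMeasure_apply hSo.measurableSet]
      refine (measure_mono ?_).trans (hδ (e '' (e.source ∩ S)) ψ (hsD.mono_set ?_))
      · rintro _ ⟨_, ⟨_, ⟨y, hy, rfl⟩⟩, rfl⟩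
        have hys : y ∈ e.source := (hSsub hy).1.1.2
        exact ⟨e y, ⟨y, ⟨hys, hy⟩, rfl⟩, by simp only [hψ]; rw [e.left_inv hys]⟩
      · rintro _ ⟨y, ⟨_, hy⟩, rfl⟩
        exact (hSsub hy).2
    have h5 : c * μ S⁻¹ ≤ C * C * m * μ S⁻¹ := by
      calc c * μ S⁻¹ = μ (φ '' S)⁻¹ := by rw [hinv, hc _ hSo.inv.measurableSet]
        _ ≤ C * chartMeasure E G (φ '' S) := (hcomp _ (by
            rintro _ ⟨y, hy, rfl⟩
            exact (hSsub hy).1.1.1.2) hφopen.measurableSet).1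
        _ ≤ C * (m * (C * μ S⁻¹)) := by
            gcongr
            refine hcm1.trans ?_
            gcongr
            exact (hcomp _ (fun y hy => (hSsub hy).1.1.1.1) hSo.measurableSet).2
        _ = C * C * m * μ S⁻¹ := by ring
    exact (ENNReal.mul_le_mul_iff_left hSi0 hSit).1 h5
  have hdt : ENNReal.ofReal |D.det| ≠ ⊤ := ENNReal.ofReal_ne_top
  rcases eq_or_ne (C * C) 0 with h0 | h0
  · obtain ⟨m, hm, -⟩ := ENNReal.lt_iff_exists_nnreal_btwn.1 hdt.lt_top
    simpa [h0] using key m hm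
  · have hCt : C * C ≠ ⊤ := ENNReal.mul_ne_top hC hC
    rw [← ENNReal.div_le_iff' h0 hCt]
    refine le_of_forall_gt_imp_ge_of_dense fun b hb => ?_
    obtain ⟨m, hm, hmb⟩ := ENNReal.lt_iff_exists_nnreal_btwn.1 hb
    exact ((ENNReal.div_le_iff' h0 hCt).2 (key m hm)).trans hmb.le

end Jacobian

/-! ### Dilations scale Haar measure by `t ^ Q` -/

namespace HomogeneousGroup

variable {E G : Type*} [NormedAddCommGroup E] [NormedSpace ℝ E]
  [FiniteDimensional ℝ E] [TopologicalSpace G] [ChartedSpace E G] [Group G]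
  [LieGroup 𝓘(ℝ, E) ∞ G]

variable (H : HomogeneousGroup E G)

/-- On an eigenbasis of `A` the exponential has eigenvalues `t ^ λᵢ`, whose product is `t` to the
trace. -/
theorem det_exp_log_smul (t : {t : ℝ // 0 < t}) :
    (NormedSpace.exp (Real.log (t : ℝ) • H.A) : E →L[ℝ] E).det = (t : ℝ) ^ H.Q := by
  obtain ⟨b, ev, h⟩ := H.diagonalizable
  rw [det_eq_prod_of_basis b fun i => exp_smul_apply_of_apply_eq_smul (h i).2 _, Q,
    trace_eq_sum_of_basis b fun i => (h i).2, ← Real.exp_sum, ← Finset.mul_sum, Real.rpow_def_of_pos t.2]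

theorem δ_symm_apply (t : {t : ℝ // 0 < t}) (x : G) : (H.δ t).symm x = H.δ t⁻¹ x := by
  rw [map_inv]; rfl

theorem continuous_δ_apply (t : {t : ℝ // 0 < t}) : Continuous (H.δ t) :=
  (H.contMDiff_δ t).continuous

theorem continuous_δ_symm (t : {t : ℝ // 0 < t}) : Continuous (H.δ t).symm := by
  have : ⇑(H.δ t).symm = H.δ t⁻¹ := funext (H.δ_symm_apply t)
  rw [this]
  exact H.continuous_δ_apply _

/-- A dilation as an isomorphism of topological groups. -/
def dilation (t : {t : ℝ // 0 < t}) : G ≃ₜ* G :=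
  { H.δ t with
    continuous_toFun := H.continuous_δ_apply t
    continuous_invFun := H.continuous_δ_symm t }

variable [T2Space G] [SecondCountableTopology G] [MeasurableSpace G] [BorelSpace G]
  (μ : Measure G) [μ.IsHaarMeasure]

/-- Uniqueness of Haar measure: a topological automorphism carries it to a multiple of itself. -/
theorem exists_measure_image_δ (t : {t : ℝ // 0 < t}) : ∃ c : ℝ≥0, 0 < c ∧
    ∀ S, MeasurableSet S → μ (H.δ t '' S) = c * μ S := by
  have : IsTopologicalGroup G := topologicalGroup_of_lieGroup 𝓘(ℝ, E) ∞
  have : LocallyCompactSpace G := ChartedSpace.locallyCompactSpace E G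
  refine ⟨mulEquivHaarChar (H.dilation t), mulEquivHaarChar_pos _, fun S hS => ?_⟩
  have hmeas : MeasurableSet (H.δ t '' S) := by
    rw [show H.δ t '' S = (H.δ t).symm ⁻¹' S from (H.δ t).toEquiv.image_eq_preimage_symm S]
    exact (H.continuous_δ_symm t).measurable hS
  have hcont : Continuous ⇑(H.dilation t) := H.continuous_δ_apply t
  have h := mulEquivHaarChar_smul_map μ (H.dilation t)
  conv_lhs => rw [← h]
  rw [Measure.smul_apply, Measure.map_apply hcont.measurable hmeas]
  have : (H.dilation t) ⁻¹' (H.δ t '' S) = S := preimage_image_eq S (H.δ t).injective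
  rw [this, ENNReal.smul_def, smul_eq_mul]

/-- Dilations scale Haar measure by `t ^ Q`. -/
theorem measure_image_δ (t : {t : ℝ // 0 < t}) {S : Set G} (hS : MeasurableSet S) :
    μ (H.δ t '' S) = ENNReal.ofReal ((t : ℝ) ^ H.Q) * μ S := by
  have : IsTopologicalGroup G := topologicalGroup_of_lieGroup 𝓘(ℝ, E) ∞
  have : LocallyCompactSpace G := ChartedSpace.locallyCompactSpace E G
  choose c hc0 hc using H.exists_measure_image_δ μ
  obtain ⟨C, hC, hle⟩ := exists_haar_image_le_det (E := E) μ
  have hbound : ∀ t, (c t : ℝ) ≤ C.toReal * (t : ℝ) ^ H.Q := by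
    intro t
    have h := hle (H.δ t) _ (c t) (H.contMDiff_δ t) (H.continuous_δ_symm t) (H.hasMFDerivAt_δ t)
      (hc t)
    have hpos : (0 : ℝ) < (t : ℝ) ^ H.Q := Real.rpow_pos_of_pos t.2 _
    have h' := ENNReal.toReal_mono (by finiteness) h
    rw [ENNReal.toReal_mul, ENNReal.toReal_ofReal (abs_nonneg _)] at h'
    rw [H.det_exp_log_smul t, abs_of_pos hpos] at h'
    exact h'
  obtain ⟨Z, hZ, hZμ⟩ := μ.finiteAt_nhds (1 : G)
  obtain ⟨U, hUZ, hUo, hU1⟩ := mem_nhds_iff.1 hZ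
  have hU0 : μ U ≠ 0 := (hUo.measure_pos μ ⟨1, hU1⟩).ne'
  have hUt : μ U ≠ ⊤ := ((measure_mono hUZ).trans_lt hZμ).ne
  have hmul : ∀ s t, c (s * t) = c s * c t := by
    intro s t
    have h1 := hc (s * t) U hUo.measurableSet
    have hmeas : MeasurableSet (H.δ t '' U) := by
      rw [show H.δ t '' U = (H.δ t).symm ⁻¹' U from (H.δ t).toEquiv.image_eq_preimage_symm U]
      exact (H.continuous_δ_symm t).measurable hUo.measurableSet
    have h2 : H.δ (s * t) '' U = H.δ s '' (H.δ t '' U) := by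
      rw [map_mul, image_image]; rfl
    rw [h2, hc s _ hmeas, hc t _ hUo.measurableSet, ← mul_assoc] at h1
    have := (ENNReal.mul_left_inj hU0 hUt).1 h1
    exact_mod_cast this.symm
  have hone : c 1 = 1 := by
    have := hmul 1 1
    rw [mul_one] at this
    exact (mul_eq_left₀ (hc0 1).ne').1 this.symm
  have hpow : ∀ t (n : ℕ), c (t ^ n) = c t ^ n := by
    intro t n
    induction n with
    | zero => simpa using hone
    | succ n ih => rw [pow_succ, hmul, ih, pow_succ]
  -- If `c(t) / t ^ Q > 1`, its `n`-th powers would be unbounded, while `hbound` at `t ^ n` bounds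
  -- them all by `C`.
  have hle1 : ∀ t, (c t : ℝ) ≤ (t : ℝ) ^ H.Q := by
    intro t
    have hpos : (0 : ℝ) < (t : ℝ) ^ H.Q := Real.rpow_pos_of_pos t.2 _
    rw [← div_le_one hpos]
    by_contra! hlt
    obtain ⟨n, hn⟩ := pow_unbounded_of_one_lt C.toReal hlt
    have h := hbound (t ^ n)
    rw [hpow, NNReal.coe_pow] at h
    have h3 : (((t ^ n : {t : ℝ // 0 < t}) : ℝ)) ^ H.Q = ((t : ℝ) ^ H.Q) ^ n := by
      have : ((t ^ n : {t : ℝ // 0 < t}) : ℝ) = (t : ℝ) ^ n := rfl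
      rw [this, ← Real.rpow_natCast, ← Real.rpow_natCast, ← Real.rpow_mul t.2.le,
        ← Real.rpow_mul t.2.le, mul_comm]
    rw [h3, ← div_le_iff₀ (by positivity), ← div_pow] at h
    exact absurd h (not_le.2 hn)
  -- The upper bound at `t⁻¹`, together with `c(t) c(t⁻¹) = 1`, is the lower bound at `t`.
  have heq : (c t : ℝ) = (t : ℝ) ^ H.Q := by
    refine le_antisymm (hle1 t) ?_
    have h1 := hle1 t⁻¹
    have h2 := hmul t t⁻¹
    rw [mul_inv_cancel, hone] at h2
    have h3 : (1 : ℝ) = c t * c t⁻¹ := by exact_mod_cast h2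
    have hct : (0 : ℝ) < c t := hc0 t
    have h4 : ((t⁻¹ : {t : ℝ // 0 < t}) : ℝ) = (t : ℝ)⁻¹ := rfl
    rw [h4, Real.inv_rpow t.2.le] at h1
    have hpos : (0 : ℝ) < (t : ℝ) ^ H.Q := Real.rpow_pos_of_pos t.2 _
    have h5 : 1 ≤ c t * ((t : ℝ) ^ H.Q)⁻¹ := h3.le.trans (by gcongr)
    rwa [← div_eq_mul_inv, one_le_div hpos] at h5
  rw [hc t S hS, ← heq, ENNReal.ofReal_coe_nnreal]

end HomogeneousGroup

/-! ### Compactness and volume of balls, unimodularity, null spheres -/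

namespace HomogeneousNorm

open Topology Filter

variable {E G : Type*} [NormedAddCommGroup E] [NormedSpace ℝ E]
  [FiniteDimensional ℝ E] [TopologicalSpace G] [ChartedSpace E G] [Group G]
  [LieGroup 𝓘(ℝ, E) ∞ G] {H : HomogeneousGroup E G} (N : HomogeneousNorm H)

theorem mem_ball_one {t : ℝ} {x : G} : x ∈ N.ball 1 t ↔ N.r x < t := by
  rw [ball, mem_ofPred_eq, one_mul, ← N.inv]

theorem ball_one_eq (t : ℝ) : N.ball 1 t = {x | N.r x < t} := by
  ext x; exact N.mem_ball_one

theorem r_one : N.r 1 = 0 := (N.eq_zero_iff 1).2 rfl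

theorem r_pos {x : G} (hx : x ≠ 1) : 0 < N.r x :=
  lt_of_le_of_ne (N.nonneg x) fun h => hx ((N.eq_zero_iff x).1 h.symm)

theorem _root_.HomogeneousGroup.continuous_δ_left (H : HomogeneousGroup E G) (x : G) :
    Continuous fun t => H.δ t x :=
  H.continuous_δ.comp (by fun_prop : Continuous fun t : {t : ℝ // 0 < t} => (t, x))

/-- If `r` is at least `m` on the frontier of `K` then the part of the orbit of `x` on which
`r < m` does not leave `K`. -/
theorem δ_mem_of_δ_mem {K : Set G} (hKc : IsClosed K) {m : ℝ} (hm : ∀ x ∈ frontier K, m ≤ N.r x) {x : G}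
    {s t : {t : ℝ // 0 < t}} (hs : s * N.r x < m) (ht : t * N.r x < m) (hK : H.δ s x ∈ K) :
    H.δ t x ∈ K := by
  by_contra hcon
  -- The orbit segment between the two parameters is connected and has `r < m`, so it avoids the
  -- frontier of `K`. It cannot meet both the interior and the complement.
  have hc : IsPreconnected ((fun u => H.δ u x) '' uIcc s t) := by
    refine IsPreconnected.image ?_ _ (H.continuous_δ_left x).continuousOn
    refine (IsInducing.isPreconnected_image
      (f := fun u : {t : ℝ // 0 < t} => (u : ℝ)) IsInducing.subtypeVal).1 ?_
    have : (fun u : {t : ℝ // 0 < t} => (u : ℝ)) '' uIcc s t = uIcc (s : ℝ) t := by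
      ext u
      constructor
      · rintro ⟨u, hu, rfl⟩
        exact ⟨by simpa using hu.1, by simpa using hu.2⟩
      · intro hu
        refine ⟨⟨u, (lt_min s.2 t.2).trans_le hu.1⟩, ⟨?_, ?_⟩, rfl⟩
        · simpa [← Subtype.coe_le_coe] using hu.1
        · simpa [← Subtype.coe_le_coe] using hu.2
    rw [this]
    exact isPreconnected_uIcc
  have hfr : ∀ u ∈ uIcc s t, H.δ u x ∉ frontier K := by
    intro u hu hfr
    have h1 := hm _ hfr
    rw [N.dilate] at h1
    have hu2 : (u : ℝ) ≤ max (s : ℝ) t := by simpa [← Subtype.coe_le_coe] using hu.2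
    rcases le_total (s : ℝ) t with h | h
    · rw [max_eq_right h] at hu2
      nlinarith [mul_le_mul_of_nonneg_right hu2 (N.nonneg x)]
    · rw [max_eq_left h] at hu2
      nlinarith [mul_le_mul_of_nonneg_right hu2 (N.nonneg x)]
  have hint : ∀ u ∈ uIcc s t, H.δ u x ∈ K → H.δ u x ∈ interior K := by
    intro u hu hK
    by_contra h
    exact hfr u hu ⟨subset_closure hK, h⟩
  obtain ⟨_, -, h1, h2⟩ := hc (interior K) Kᶜ isOpen_interior hKc.isOpen_compl
    (by
      rintro _ ⟨u, hu, rfl⟩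
      by_cases hK : H.δ u x ∈ K
      · exact Or.inl (hint u hu hK)
      · exact Or.inr hK)
    ⟨_, ⟨s, left_mem_uIcc, rfl⟩, hint s left_mem_uIcc hK⟩ ⟨_, ⟨t, right_mem_uIcc, rfl⟩, hcon⟩
  exact h2 (interior_subset h1)

theorem exists_pos_forall_le_r {K : Set G} (hK : IsCompact K) (h1 : (1 : G) ∉ K) :
    ∃ m : ℝ, 0 < m ∧ ∀ x ∈ K, m ≤ N.r x := by
  rcases K.eq_empty_or_nonempty with rfl | hne
  · exact ⟨1, one_pos, by simp⟩
  · obtain ⟨x, hx, hmin⟩ := hK.exists_isMinOn hne N.continuous_r.continuousOn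
    exact ⟨N.r x, N.r_pos fun h => h1 (h ▸ hx), fun y hy => hmin hy⟩

/-- The closed sublevel sets of a homogeneous norm are compact. -/
theorem isCompact_sublevel [T2Space G] (R : ℝ) : IsCompact {x | N.r x ≤ R} := by
  have : IsTopologicalGroup G := topologicalGroup_of_lieGroup 𝓘(ℝ, E) ∞
  have : LocallyCompactSpace G := ChartedSpace.locallyCompactSpace E G
  have := H.simplyConnected
  obtain ⟨K, hK, hK1⟩ := exists_compact_mem_nhds (1 : G)
  obtain ⟨m, hm0, hm⟩ := N.exists_pos_forall_le_r (K := frontier K)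
    (hK.of_isClosed_subset isClosed_frontier hK.isClosed.frontier_subset)
    (fun h => h.2 (mem_interior_iff_mem_nhds.2 hK1))
  set l : Filter {t : ℝ // 0 < t} := comap Subtype.val (𝓝 0) with hl
  have hlne : l.NeBot := by
    rw [hl, comap_neBot_iff]
    intro s hs
    have h0 : s ∩ Ioi 0 ∈ 𝓝[>] (0 : ℝ) :=
      inter_mem (nhdsWithin_le_nhds hs) self_mem_nhdsWithin
    obtain ⟨t, ht, ht0⟩ := Filter.nonempty_of_mem h0
    exact ⟨⟨t, ht0⟩, ht⟩
  have hlval : Tendsto (fun t : {t : ℝ // 0 < t} => (t : ℝ)) l (𝓝 0) := tendsto_comap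
  have hsmall : ∀ (x : G) (b : ℝ), 0 < b → ∀ᶠ t : {t : ℝ // 0 < t} in l, t * N.r x < b := by
    intro x b hb
    have : Tendsto (fun t : {t : ℝ // 0 < t} => (t : ℝ) * N.r x) l (𝓝 (0 * N.r x)) :=
      hlval.mul_const _
    rw [zero_mul] at this
    exact this.eventually_lt_const hb
  -- The orbit stays in `K` as `t → 0`. Off a neighbourhood `O` of `1`, `r` is bounded below on `K`,
  -- while `r(δ_t x) = t r(x)` tends to `0`; so the orbit enters `O`.
  have hcontr : ∀ x ∈ K, N.r x < m → Tendsto (fun t => H.δ t x) l (𝓝 1) := by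
    intro x hx hxm
    refine tendsto_nhds.2 fun O hO h1O => ?_
    obtain ⟨m', hm'0, hm'⟩ := N.exists_pos_forall_le_r (K := K \ O) (hK.diff hO)
      (fun h => h.2 h1O)
    filter_upwards [hsmall x m hm0, hsmall x m' hm'0] with t ht ht'
    have htK : H.δ t x ∈ K := N.δ_mem_of_δ_mem hK.isClosed hm (s := 1) (by simpa using hxm) ht (by simpa using hx)
    by_contra hO'
    have := hm' _ ⟨htK, hO'⟩
    rw [N.dilate] at this
    exact absurd ht' (not_lt.2 this)
  -- The points contracted to `1` form a subgroup containing a neighbourhood of `1`, hence an open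
  -- and closed one, hence all of the connected group.
  let Γ : Subgroup G :=
    { carrier := {x | Tendsto (fun t => H.δ t x) l (𝓝 1)}
      mul_mem' := by
        intro a b ha hb
        have := Tendsto.mul (show Tendsto (fun t => H.δ t a) l (𝓝 1) from ha) hb
        simpa using this
      one_mem' := by simp
      inv_mem' := by
        intro a ha
        have := (show Tendsto (fun t => H.δ t a) l (𝓝 1) from ha).inv
        simpa using this }
  have hΓo : IsOpen (Γ : Set G) := by
    refine Γ.isOpen_of_mem_nhds (g := 1) ?_
    have : {x | N.r x < m} ∈ 𝓝 (1 : G) :=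
      (isOpen_lt N.continuous_r continuous_const).mem_nhds (by simpa [r_one] using hm0)
    filter_upwards [hK1, this] with x hx hx'
    exact hcontr x hx hx'
  have hΓ : (Γ : Set G) = univ :=
    IsClopen.eq_univ ⟨Γ.isClosed_of_isOpen hΓo, hΓo⟩ ⟨1, Γ.one_mem⟩
  -- A contracted point has some orbit point in `K` with `r < m`; following the orbit back to `t =
  -- 1` never leaves `K`.
  have hsub : ∀ x, N.r x < m → x ∈ K := by
    intro x hx
    have hxΓ : Tendsto (fun t => H.δ t x) l (𝓝 1) := by
      have : x ∈ (Γ : Set G) := hΓ ▸ mem_univ x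
      exact this
    obtain ⟨t, htm, htK⟩ := ((hsmall x m hm0).and (hxΓ hK1)).exists
    simpa using N.δ_mem_of_δ_mem hK.isClosed hm (t := 1) htm (by simpa using hx) htK
  have hclosed : ∀ R, IsClosed {x | N.r x ≤ R} := fun R =>
    isClosed_le N.continuous_r continuous_const
  have hcm : IsCompact {x | N.r x ≤ m / 2} :=
    hK.of_isClosed_subset (hclosed _) fun x hx => hsub x (lt_of_le_of_lt hx (by linarith))
  have hpos : ∀ R, 0 < R → IsCompact {x | N.r x ≤ R} := by
    intro R hR
    let t : {t : ℝ // 0 < t} := ⟨R / (m / 2), by positivity⟩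
    refine (hcm.image (H.continuous_δ_apply t)).of_isClosed_subset (hclosed R) fun x hx => ?_
    refine ⟨H.δ t⁻¹ x, ?_, ?_⟩
    · rw [mem_ofPred_eq, N.dilate]
      have : ((t⁻¹ : {t : ℝ // 0 < t}) : ℝ) = (m / 2) / R := by
        change (R / (m / 2))⁻¹ = _
        rw [inv_div]
      rw [this, div_mul_eq_mul_div, div_le_iff₀ hR]
      exact mul_le_mul_of_nonneg_left hx (by positivity)
    · rw [map_inv]; exact (H.δ t).apply_symm_apply x
  exact (hpos (max R 1) (by positivity)).of_isClosed_subset (hclosed R)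
    fun x hx => le_trans (show N.r x ≤ R from hx) (le_max_left _ _)

theorem image_δ_ball (t : {t : ℝ // 0 < t}) : H.δ t '' N.ball 1 1 = N.ball 1 t := by
  ext x
  constructor
  · rintro ⟨y, hy, rfl⟩
    rw [mem_ball_one] at hy ⊢
    rw [N.dilate]
    have := t.2
    nlinarith
  · intro hx
    refine ⟨H.δ t⁻¹ x, ?_, by rw [map_inv]; exact (H.δ t).apply_symm_apply x⟩
    rw [mem_ball_one] at hx ⊢
    rw [N.dilate]
    change (t : ℝ)⁻¹ * _ < 1
    rw [inv_mul_lt_one₀ t.2]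
    exact hx

theorem isOpen_ball_one (t : ℝ) : IsOpen (N.ball 1 t) := by
  rw [ball_one_eq]; exact isOpen_lt N.continuous_r continuous_const

variable [MeasurableSpace G] [BorelSpace G]

theorem measurable_r : Measurable N.r := N.continuous_r.measurable

theorem measurableSet_ball_one (t : ℝ) : MeasurableSet (N.ball 1 t) :=
  (N.isOpen_ball_one t).measurableSet

variable [T2Space G] [SecondCountableTopology G] {μ : Measure G} [μ.IsHaarMeasure] (hμ : μ (N.ball 1 1) = 1)

include hμ

theorem measure_ball {t : ℝ} (ht : 0 < t) : μ (N.ball 1 t) = ENNReal.ofReal (t ^ H.Q) := by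
  rw [← N.image_δ_ball ⟨t, ht⟩, H.measure_image_δ μ _ (N.measurableSet_ball_one 1), hμ, mul_one]

/-- Haar measure on a homogeneous group is right invariant. -/
theorem isMulRightInvariant : μ.IsMulRightInvariant := by
  have : IsTopologicalGroup G := topologicalGroup_of_lieGroup 𝓘(ℝ, E) ∞
  have : LocallyCompactSpace G := ChartedSpace.locallyCompactSpace E G
  obtain ⟨c, hc0, hc⟩ := N.quasi_triangle
  -- Right translation moves a ball of radius `t ≥ r(g)` into one of radius `2 c t`, so volumes
  -- bound the modular character independently of `g`.
  have hb : ∀ g : G, (Measure.modularCharacter g : ℝ) ≤ (c * 2) ^ H.Q := by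
    intro g
    set t : ℝ := max 1 (N.r g) with ht
    have ht0 : 0 < t := by positivity
    have h1 := Measure.map_right_mul_eq_modularCharacterFun_smul μ g
    have h2 : μ.map (· * g) (N.ball 1 t) = Measure.modularCharacterFun g * μ (N.ball 1 t) := by
      rw [h1]; rfl
    rw [Measure.map_apply (continuous_mul_const g).measurable (N.measurableSet_ball_one t)] at h2
    have hsub : (· * g) ⁻¹' N.ball 1 t ⊆ N.ball 1 (c * 2 * t) := by
      intro x hx
      rw [mem_preimage, mem_ball_one] at hx
      rw [mem_ball_one]
      have h3 := hc (x * g) g⁻¹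
      rw [mul_inv_cancel_right, ← N.inv] at h3
      have h4 : N.r g ≤ t := le_max_right _ _
      nlinarith
    have h3 := h2.symm.le.trans (measure_mono hsub)
    rw [N.measure_ball hμ ht0, N.measure_ball hμ (by positivity),
      ← ENNReal.ofReal_coe_nnreal, ← ENNReal.ofReal_mul (by positivity),
      ENNReal.ofReal_le_ofReal_iff (by positivity), Real.mul_rpow (by positivity) ht0.le] at h3
    exact le_of_mul_le_mul_right h3 (by positivity)
  -- A bounded character with positive values never exceeds `1`, as its powers stay bounded; at
  -- `g⁻¹` this forces equality.
  have hle : ∀ g : G, (Measure.modularCharacter g : ℝ) ≤ 1 := by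
    intro g
    by_contra! hlt
    obtain ⟨n, hn⟩ := pow_unbounded_of_one_lt ((c * 2) ^ H.Q) hlt
    have := hb (g ^ n)
    rw [map_pow, NNReal.coe_pow] at this
    exact absurd hn (not_lt.2 this)
  have hone : ∀ g : G, Measure.modularCharacter g = 1 := by
    intro g
    have h1 : Measure.modularCharacter g ≤ 1 := by exact_mod_cast hle g
    have h2 : Measure.modularCharacter g⁻¹ ≤ 1 := by exact_mod_cast hle g⁻¹
    refine le_antisymm h1 ?_
    have h3 : Measure.modularCharacter g * Measure.modularCharacter g⁻¹ = 1 := by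
      rw [← map_mul, mul_inv_cancel, map_one]
    calc (1 : ℝ≥0) = Measure.modularCharacter g * Measure.modularCharacter g⁻¹ := h3.symm
      _ ≤ Measure.modularCharacter g * 1 := by gcongr
      _ = _ := mul_one _
  refine ⟨fun g => ?_⟩
  rw [Measure.map_right_mul_eq_modularCharacterFun_smul μ g]
  have := hone g
  change Measure.modularCharacterFun g = 1 at this
  rw [this, one_smul]

/-- The spheres of a homogeneous norm are null sets. -/
theorem measure_sphere (hQ : 0 < H.Q) (t : ℝ) : μ {x | N.r x = t} = 0 := by
  rcases lt_or_ge t 0 with ht | ht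
  · convert measure_empty (μ := μ)
    ext x
    simpa using (ht.trans_le (N.nonneg x)).ne'
  -- The sphere lies in every shell `t ≤ r < s`, whose volume `s ^ Q - t ^ Q` tends to `0` as `s →
  -- t`.
  have hb : ∀ s, t < s → μ {x | N.r x = t} ≤ ENNReal.ofReal (s ^ H.Q - t ^ H.Q) := by
    intro s hs
    have hs0 : 0 < s := ht.trans_lt hs
    have h1 : {x | N.r x = t} ⊆ N.ball 1 s \ N.ball 1 t := fun x hx =>
      ⟨by rw [mem_ball_one]; exact (hx : N.r x = t).trans_lt hs,
        by rw [mem_ball_one]; exact (hx : N.r x = t).not_lt⟩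
    have hbt : μ (N.ball 1 t) = ENNReal.ofReal (t ^ H.Q) := by
      rcases ht.eq_or_lt with rfl | ht
      · rw [Real.zero_rpow hQ.ne', ENNReal.ofReal_zero]
        convert measure_empty (μ := μ)
        ext x
        simpa [mem_ball_one] using N.nonneg x
      · exact N.measure_ball hμ ht
    refine (measure_mono h1).trans ?_
    rw [measure_sdiff (fun x hx => by rw [mem_ball_one] at hx ⊢; exact hx.trans hs)
      (N.measurableSet_ball_one t).nullMeasurableSet (by rw [hbt]; exact ENNReal.ofReal_ne_top),
      hbt, N.measure_ball hμ hs0, ENNReal.ofReal_sub _ (by positivity)]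
  have hlim : Tendsto (fun s => ENNReal.ofReal (s ^ H.Q - t ^ H.Q)) (𝓝[>] t) (𝓝 0) := by
    have h1 : ContinuousAt (fun s : ℝ => ENNReal.ofReal (s ^ H.Q - t ^ H.Q)) t :=
      ENNReal.continuous_ofReal.continuousAt.comp
        (((Real.continuousAt_rpow_const t _ (Or.inr hQ.le))).sub continuousAt_const)
    have h2 := h1.tendsto
    simp only [sub_self, ENNReal.ofReal_zero] at h2
    exact h2.mono_left nhdsWithin_le_nhds
  refine le_antisymm (ge_of_tendsto hlim ?_) zero_le
  filter_upwards [self_mem_nhdsWithin] with s hs using hb s hs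

end HomogeneousNorm

/-! ### Hardy inequalities on a space ordered by a function -/

section Hardy

variable {X : Type*} [MeasurableSpace X]

/-- If `U` has no least element, `{r ∈ U}` is covered by the directed union of the sets `{a ≤ r}`
with `a` rational and above some point of `U`. Rationals make the union countable. The lemma turns
threshold estimates into estimates on level sets without locating the infimum of `U`. -/
theorem measure_setOf_mem_le_of_forall_Ici (ρ : Measure X) (r : X → ℝ) {U : Set ℝ} {c : ℝ≥0∞}
    (h : ∀ t ∈ U, ρ {x | t ≤ r x} ≤ c) : ρ {x | r x ∈ U} ≤ c := by
  by_cases hmin : ∃ t ∈ U, ∀ s ∈ U, t ≤ s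
  · obtain ⟨t, ht, hts⟩ := hmin
    exact (measure_mono fun x (hx : r x ∈ U) => show t ≤ r x from hts _ hx).trans (h t ht)
  · push Not at hmin
    have hsub : {x | r x ∈ U} ⊆ ⋃ a : {a : ℚ // ∃ s ∈ U, s ≤ a}, {x | (a.1 : ℝ) ≤ r x} := by
      intro x hx
      obtain ⟨s, hs, hsx⟩ := hmin _ hx
      obtain ⟨a, hsa, hax⟩ := exists_rat_btwn hsx
      exact mem_iUnion.2 ⟨⟨a, s, hs, hsa.le⟩, hax.le⟩
    have hdir : Directed (· ⊆ ·)
        (fun a : {a : ℚ // ∃ s ∈ U, s ≤ a} => {x | (a.1 : ℝ) ≤ r x}) := by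
      intro a b
      have hmono : ∀ c d : {a : ℚ // ∃ s ∈ U, s ≤ (a : ℝ)}, c ≤ d →
          {x | (d.1 : ℝ) ≤ r x} ⊆ {x | (c.1 : ℝ) ≤ r x} := fun c d hcd x (hx : (d.1 : ℝ) ≤ r x) =>
        le_trans (by exact_mod_cast hcd) hx
      rcases le_total a b with hab | hab
      · exact ⟨a, subset_rfl, hmono _ _ hab⟩
      · exact ⟨b, hmono _ _ hab, subset_rfl⟩
    refine (measure_mono hsub).trans ?_
    rw [hdir.measure_iUnion]
    refine iSup_le fun a => ?_
    obtain ⟨s, hs, hsa⟩ := a.2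
    exact (measure_mono fun x (hx : (a.1 : ℝ) ≤ r x) => hsa.trans hx).trans (h s hs)

theorem measure_setOf_mem_le_of_forall_Iic (ρ : Measure X) (r : X → ℝ) {U : Set ℝ} {c : ℝ≥0∞}
    (h : ∀ t ∈ U, ρ {x | r x ≤ t} ≤ c) : ρ {x | r x ∈ U} ≤ c := by
  have := measure_setOf_mem_le_of_forall_Ici ρ (fun x => - r x) (U := -U) (c := c)
    (fun t ht => by simpa [le_neg] using h (-t) ht)
  simpa using this

theorem measure_le_eq_measure_lt {ρ : Measure X} {r : X → ℝ} {t : ℝ}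
    (h : ρ {x | r x = t} = 0) : ρ {x | r x ≤ t} = ρ {x | r x < t} := by
  refine le_antisymm ?_ (measure_mono fun x (hx : r x < t) => hx.le)
  calc ρ {x | r x ≤ t} ≤ ρ ({x | r x < t} ∪ {x | r x = t}) :=
        measure_mono fun x (hx : r x ≤ t) => hx.lt_or_eq
    _ ≤ ρ {x | r x < t} + ρ {x | r x = t} := measure_union_le _ _
    _ = ρ {x | r x < t} := by rw [h, add_zero]

/-- The distribution function `x ↦ ρ {r < r x}` of a measure without atoms is at most uniformly
distributed. -/
theorem measure_distribution_le {ρ : Measure X} {r : X → ℝ} (h : ∀ t, ρ {x | r x = t} = 0)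
    (c : ℝ≥0∞) : ρ {x | ρ {y | r y < r x} ≤ c} ≤ c :=
  measure_setOf_mem_le_of_forall_Iic ρ r (U := {t | ρ {y | r y < t} ≤ c}) fun t ht => by
    rw [measure_le_eq_measure_lt (h t)]; exact ht

/-- Each term is at most `a i` times the total to the power `s - 1`. With `s = q / p` this is where
`p ≤ q` enters Hardy's inequality. -/
theorem ENNReal.tsum_rpow_le_rpow_tsum {ι : Type*} (a : ι → ℝ≥0∞) {s : ℝ} (hs : 1 ≤ s) :
    ∑' i, a i ^ s ≤ (∑' i, a i) ^ s := by
  have hsplit : ∀ b : ℝ≥0∞, b ^ s = b * b ^ (s - 1) := fun b => by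
    conv_lhs => rw [← add_sub_cancel 1 s, ENNReal.rpow_add_of_nonneg _ _ zero_le_one (by linarith),
      ENNReal.rpow_one]
  calc ∑' i, a i ^ s ≤ ∑' i, a i * (∑' i, a i) ^ (s - 1) := by
        refine ENNReal.tsum_le_tsum fun i => ?_
        rw [hsplit]
        exact mul_le_mul' le_rfl (ENNReal.rpow_le_rpow (ENNReal.le_tsum i) (by linarith))
    _ = (∑' i, a i) ^ s := by rw [ENNReal.tsum_mul_right, hsplit]

/-- The weighted Hardy inequality for `p ≤ q` in Muckenhoupt's form, for measures on a space that
is ordered by a real function `r`. -/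
theorem lintegral_hardy {ν σ : Measure X} {r : X → ℝ} (hr : Measurable r)
    (hν : ∀ t, ν {x | r x = t} = 0) {p q : ℝ} (hp : 1 < p) (hpq : p ≤ q) {k g : X → ℝ≥0∞}
    (hk : AEMeasurable k ν) (hg : AEMeasurable g ν) {B : ℝ≥0∞} (hB : B ≠ ⊤)
    (hgp : ∫⁻ x, g x ^ p ∂ν ≠ ⊤)
    (h : ∀ t, σ {x | t ≤ r x} ^ (1 / q) *
      (∫⁻ x in {x | r x < t}, k x ^ (p / (p - 1)) ∂ν) ^ (1 / (p / (p - 1))) ≤ B) :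
    (∫⁻ x, (∫⁻ y in {y | r y < r x}, g y * k y ∂ν) ^ q ∂σ) ^ (1 / q) ≤
      8 * B * (∫⁻ x, g x ^ p ∂ν) ^ (1 / p) := by
  have hp0 : 0 < p := by linarith
  have hq0 : 0 < q := by linarith
  have hpc : p.HolderConjugate (p / (p - 1)) := Real.HolderConjugate.conjExponent hp
  have hp'0 : 0 < p / (p - 1) := hpc.symm.pos
  set p' := p / (p - 1) with hp'
  set τ : Measure X := ν.withDensity (fun y => g y * k y) with hτ
  set F : ℝ → ℝ≥0∞ := fun t => τ {y | r y < t} with hF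
  have hlt : ∀ t, MeasurableSet {y | r y < t} := fun t => measurableSet_lt hr measurable_const
  have hFeq : ∀ t, ∫⁻ y in {y | r y < t}, g y * k y ∂ν = F t := fun t =>
    (withDensity_apply _ (hlt t)).symm
  have hFmono : Monotone F := fun s t hst =>
    measure_mono fun y (hy : r y < s) => hy.trans_le hst
  have hFr : Measurable fun x => F (r x) := hFmono.measurable.comp hr
  have hτ0 : ∀ t, τ {x | r x = t} = 0 := fun t => withDensity_absolutelyContinuous _ _ (hν t)
  set κ : ℝ → ℝ≥0∞ := fun t => ∫⁻ x in {x | r x < t}, k x ^ p' ∂ν with hκ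
  have hholder : ∀ t (D : Set X), MeasurableSet D →
      τ ({y | r y < t} ∩ D) ≤ (∫⁻ y in D, g y ^ p ∂ν) ^ (1 / p) * κ t ^ (1 / p') := by
    intro t D hD
    rw [hτ, withDensity_apply _ ((hlt t).inter hD)]
    refine (ENNReal.lintegral_mul_le_Lp_mul_Lq _ hpc hg.restrict hk.restrict).trans ?_
    refine mul_le_mul' (ENNReal.rpow_le_rpow (lintegral_mono_set inter_subset_right) (by positivity))
      (ENNReal.rpow_le_rpow (lintegral_mono_set inter_subset_left) (by positivity))
  set a := ∫⁻ x, g x ^ p ∂ν with ha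
  -- If `F t = ∞`, Hölder forces the kernel integral up to `t` to be infinite, and then the finite
  -- constant `B` forces `σ {t ≤ r} = 0`.
  have hFtop : σ {x | F (r x) = ⊤} = 0 := by
    refine le_antisymm ?_ zero_le
    refine measure_setOf_mem_le_of_forall_Ici σ r (U := {t | F t = ⊤}) fun t ht => ?_
    have h1 := hholder t univ MeasurableSet.univ
    rw [inter_univ, Measure.restrict_univ, show τ {y | r y < t} = ⊤ from ht, top_le_iff] at h1
    have hκt : κ t ^ (1 / p') = ⊤ := by
      by_contra hcon
      exact ENNReal.mul_ne_top (ENNReal.rpow_ne_top_of_nonneg (by positivity) hgp) hcon h1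
    have h2 := h t
    rw [hκt] at h2
    have h3 : σ {x | t ≤ r x} ^ (1 / q) = 0 := by
      by_contra hcon
      rw [ENNReal.mul_top hcon] at h2
      exact hB (top_le_iff.1 h2)
    rw [ENNReal.rpow_eq_zero_iff_of_pos (by positivity)] at h3
    exact h3.le
  -- Dyadic levels of the increasing function `F`.
  set S : ℤ → Set X := fun m => {x | (2 : ℝ≥0∞) ^ m < F (r x) ∧ F (r x) ≤ 2 ^ (m + 1)} with hS
  have hSm : ∀ m, MeasurableSet (S m) := fun m =>
    (measurableSet_lt measurable_const hFr).inter (measurableSet_le hFr measurable_const)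
  set D : ℤ → Set X := fun m => S (m - 1) ∪ S m with hD
  have hDm : ∀ m, MeasurableSet (D m) := fun m => (hSm _).union (hSm _)
  set b : ℤ → ℝ≥0∞ := fun m => ∫⁻ y in D m, g y ^ p ∂ν with hb
  have h2 : ∀ m : ℤ, (2 : ℝ≥0∞) ^ (m + 1) = 2 ^ m * 2 := fun m => by
    rw [ENNReal.zpow_add two_ne_zero (by simp), zpow_one]
  have h2pos : ∀ m : ℤ, (2 : ℝ≥0∞) ^ m ≠ 0 := fun m => (ENNReal.zpow_pos two_ne_zero (by simp) m).ne'
  have h2top : ∀ m : ℤ, (2 : ℝ≥0∞) ^ m ≠ ⊤ := fun m => (ENNReal.zpow_lt_top two_ne_zero (by simp) m).ne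
  have hσS : ∀ m, (2 : ℝ≥0∞) ^ (m + 1) * σ (S m) ^ (1 / q) ≤ 4 * B * b m ^ (1 / p) := by
    intro m
    have e1 : (2 : ℝ≥0∞) ^ m = 2 ^ (m - 1) * 2 := by rw [← h2, sub_add_cancel]
    -- On level `m` one has `F t > 2 ^ m`. The points where `F ≤ 2 ^ (m - 1)` contribute at most `2
    -- ^ (m - 1)` to `F t`, so at least as much comes from the two levels in `D m`. Hölder there
    -- localizes the norm of `g` to `b m`.
    have key : σ (S m) ≤ (B * b m ^ (1 / p) / 2 ^ (m - 1)) ^ q := by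
      refine measure_setOf_mem_le_of_forall_Ici σ r
        (U := {t | (2 : ℝ≥0∞) ^ m < F t ∧ F t ≤ 2 ^ (m + 1)}) fun t ht => ?_
      have h3 : F t ≤ 2 ^ (m - 1) + b m ^ (1 / p) * κ t ^ (1 / p') := by
        calc F t ≤ τ ({x | F (r x) ≤ 2 ^ (m - 1)} ∪ ({y | r y < t} ∩ D m)) := by
              refine measure_mono fun y (hy : r y < t) => ?_
              have hy2 : F (r y) ≤ 2 ^ (m + 1) := (hFmono hy.le).trans ht.2
              by_cases h4 : F (r y) ≤ 2 ^ (m - 1)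
              · exact Or.inl h4
              · refine Or.inr ⟨hy, ?_⟩
                push Not at h4
                by_cases h5 : F (r y) ≤ 2 ^ m
                · exact Or.inl ⟨h4, by rw [sub_add_cancel]; exact h5⟩
                · exact Or.inr ⟨not_le.1 h5, hy2⟩
          _ ≤ τ {x | F (r x) ≤ 2 ^ (m - 1)} + τ ({y | r y < t} ∩ D m) := measure_union_le _ _
          _ ≤ _ := add_le_add (measure_distribution_le hτ0 _) (hholder t _ (hDm m))
      have h4 : (2 : ℝ≥0∞) ^ (m - 1) ≤ b m ^ (1 / p) * κ t ^ (1 / p') := by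
        have h5 : (2 : ℝ≥0∞) ^ (m - 1) + 2 ^ (m - 1) ≤ 2 ^ (m - 1) + b m ^ (1 / p) * κ t ^ (1 / p') := by
          rw [← mul_two, ← e1]
          exact ht.1.le.trans h3
        exact (ENNReal.add_le_add_iff_left (h2top _)).1 h5
      have h5 : σ {x | t ≤ r x} ^ (1 / q) ≤ B * b m ^ (1 / p) / 2 ^ (m - 1) := by
        rw [ENNReal.le_div_iff_mul_le (Or.inl (h2pos _)) (Or.inl (h2top _))]
        calc σ {x | t ≤ r x} ^ (1 / q) * 2 ^ (m - 1)
            ≤ σ {x | t ≤ r x} ^ (1 / q) * (b m ^ (1 / p) * κ t ^ (1 / p')) := by gcongr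
          _ = σ {x | t ≤ r x} ^ (1 / q) * κ t ^ (1 / p') * b m ^ (1 / p) := by ring
          _ ≤ B * b m ^ (1 / p) := by gcongr; exact h t
      rw [one_div] at h5
      exact (ENNReal.rpow_inv_le_iff hq0).1 h5
    have key2 : σ (S m) ^ (1 / q) ≤ B * b m ^ (1 / p) / 2 ^ (m - 1) := by
      rw [one_div]
      exact (ENNReal.rpow_inv_le_iff hq0).2 key
    rw [ENNReal.le_div_iff_mul_le (Or.inl (h2pos _)) (Or.inl (h2top _))] at key2
    calc (2 : ℝ≥0∞) ^ (m + 1) * σ (S m) ^ (1 / q) = 4 * (σ (S m) ^ (1 / q) * 2 ^ (m - 1)) := by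
          rw [h2, e1]; ring
      _ ≤ 4 * (B * b m ^ (1 / p)) := by gcongr
      _ = _ := by ring
  have hdisj : Pairwise (Function.onFun Disjoint S) := by
    have aux : ∀ m n : ℤ, m < n → ∀ x ∈ S m, x ∉ S n := by
      intro m n hmn x hx hx'
      have h6 : (2 : ℝ≥0∞) ^ (m + 1) ≤ 2 ^ n := ENNReal.zpow_le_of_le (by norm_num) hmn
      exact absurd (hx.2.trans h6) (not_le.2 hx'.1)
    intro m n hmn
    refine Set.disjoint_left.2 fun x hx hx' => ?_
    rcases lt_or_gt_of_ne hmn with hlt | hlt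
    · exact aux _ _ hlt x hx hx'
    · exact aux _ _ hlt x hx' hx
  have hsumS : ∑' m, ∫⁻ y in S m, g y ^ p ∂ν ≤ a := by
    rw [← lintegral_iUnion hSm hdisj]
    exact setLIntegral_le_lintegral _ _
  -- Each level belongs to exactly two of the sets `D m`.
  have hsumb : ∑' m, b m ≤ 2 * a := by
    calc ∑' m, b m ≤ ∑' m, ((∫⁻ y in S (m - 1), g y ^ p ∂ν) + ∫⁻ y in S m, g y ^ p ∂ν) :=
          ENNReal.tsum_le_tsum fun m => lintegral_union_le _ _ _
      _ = (∑' m, ∫⁻ y in S (m - 1), g y ^ p ∂ν) + ∑' m, ∫⁻ y in S m, g y ^ p ∂ν :=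
          ENNReal.tsum_add
      _ ≤ a + a := by
          refine add_le_add ?_ hsumS
          have h8 := (Equiv.subRight (1 : ℤ)).tsum_eq (fun m => ∫⁻ y in S m, g y ^ p ∂ν)
          exact h8.le.trans hsumS
      _ = 2 * a := (two_mul a).symm
  have hmain : ∫⁻ x, F (r x) ^ q ∂σ ≤ (4 * B) ^ q * (2 * a) ^ (q / p) := by
    calc ∫⁻ x, F (r x) ^ q ∂σ
        ≤ ∫⁻ x, ∑' m, (S m).indicator (fun _ => ((2 : ℝ≥0∞) ^ (m + 1)) ^ q) x ∂σ := by
          refine lintegral_mono_ae ?_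
          have hae : ∀ᵐ x ∂σ, F (r x) ≠ ⊤ := by
            rw [ae_iff]; simpa using hFtop
          filter_upwards [hae] with x hx
          rcases eq_or_ne (F (r x)) 0 with h0 | h0
          · rw [h0, ENNReal.zero_rpow_of_pos hq0]; exact zero_le
          · obtain ⟨m, hm⟩ := ENNReal.exists_mem_Ioc_zpow h0 hx (y := 2) (by norm_num) (by simp)
            refine le_trans ?_ (ENNReal.le_tsum m)
            rw [indicator_of_mem (show x ∈ S m from hm)]
            gcongr
            exact hm.2
      _ = ∑' m, ((2 : ℝ≥0∞) ^ (m + 1)) ^ q * σ (S m) := by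
          rw [lintegral_tsum fun m => (measurable_const.indicator (hSm m)).aemeasurable]
          refine tsum_congr fun m => ?_
          rw [lintegral_indicator_const (hSm m)]
      _ ≤ ∑' m, (4 * B) ^ q * b m ^ (q / p) := by
          refine ENNReal.tsum_le_tsum fun m => ?_
          have h7 := ENNReal.rpow_le_rpow (hσS m) hq0.le
          rw [ENNReal.mul_rpow_of_nonneg _ _ hq0.le, ENNReal.mul_rpow_of_nonneg _ _ hq0.le,
            ← ENNReal.rpow_mul, ← ENNReal.rpow_mul, one_div_mul_cancel hq0.ne', ENNReal.rpow_one,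
            one_div_mul_eq_div] at h7
          exact h7
      _ = (4 * B) ^ q * ∑' m, b m ^ (q / p) := ENNReal.tsum_mul_left
      _ ≤ (4 * B) ^ q * (2 * a) ^ (q / p) := by
          gcongr
          refine (ENNReal.tsum_rpow_le_rpow_tsum b ((one_le_div hp0).2 hpq)).trans ?_
          gcongr
  calc (∫⁻ x, (∫⁻ y in {y | r y < r x}, g y * k y ∂ν) ^ q ∂σ) ^ (1 / q)
      = (∫⁻ x, F (r x) ^ q ∂σ) ^ (1 / q) := by simp_rw [hFeq]
    _ ≤ ((4 * B) ^ q * (2 * a) ^ (q / p)) ^ (1 / q) := by gcongr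
    _ = 4 * B * (2 * a) ^ (1 / p) := by
        rw [ENNReal.mul_rpow_of_nonneg _ _ (by positivity), ← ENNReal.rpow_mul, ← ENNReal.rpow_mul,
          mul_one_div_cancel hq0.ne', ENNReal.rpow_one]
        congr 2
        field_simp
    -- Since `p ≥ 1`, the overlap factor `2 ^ (1 / p)` is at most `2`, whence the constant `8`.
    _ ≤ 4 * B * (2 * a ^ (1 / p)) := by
        rw [ENNReal.mul_rpow_of_nonneg _ _ (by positivity)]
        gcongr
        calc (2 : ℝ≥0∞) ^ (1 / p) ≤ 2 ^ (1 : ℝ) :=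
              ENNReal.rpow_le_rpow_of_exponent_le (by norm_num) ((div_le_one hp0).2 hp.le)
          _ = 2 := ENNReal.rpow_one _
    _ = 8 * B * a ^ (1 / p) := by ring

/-- The conjugate form of the weighted Hardy inequality. -/
theorem lintegral_hardy_conj {ν σ : Measure X} {r : X → ℝ} (hr : Measurable r)
    (hν : ∀ t, ν {x | r x = t} = 0) {p q : ℝ} (hp : 1 < p) (hpq : p ≤ q) {k g : X → ℝ≥0∞}
    (hk : AEMeasurable k ν) (hg : AEMeasurable g ν) {B : ℝ≥0∞} (hB : B ≠ ⊤)
    (hgp : ∫⁻ x, g x ^ p ∂ν ≠ ⊤)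
    (h : ∀ t, σ {x | r x ≤ t} ^ (1 / q) *
      (∫⁻ x in {x | t < r x}, k x ^ (p / (p - 1)) ∂ν) ^ (1 / (p / (p - 1))) ≤ B) :
    (∫⁻ x, (∫⁻ y in {y | r x < r y}, g y * k y ∂ν) ^ q ∂σ) ^ (1 / q) ≤
      8 * B * (∫⁻ x, g x ^ p ∂ν) ^ (1 / p) := by
  -- Reversing the order by `r ↦ -r` exchanges the two Hardy operators.
  have := lintegral_hardy (r := fun x => - r x) hr.neg (fun t => by simpa [neg_eq_iff_eq_neg] using hν (-t)) hp
    hpq hk hg hB hgp (σ := σ) (fun t => by simpa [le_neg, neg_lt] using h (-t))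
  simpa using this

section Dyadic

variable {τ : Measure X} {u : X → ℝ≥0∞} (hu : Measurable u) (hτ : ∀ c, τ {x | u x ≤ c} ≤ c)
include hu hτ

/-- The layer where `u` is between `a 2 ^ n` and `a 2 ^ (n + 1)` has measure at most its upper
value, so it contributes a constant times `a ^ (1 - s) 2 ^ (n (1 - s))`: a geometric series for `s >
1`. -/
theorem exists_setLIntegral_rpow_neg_ge_le {s : ℝ} (hs : 1 < s) : ∃ C : ℝ≥0∞, C ≠ ⊤ ∧
    ∀ a : ℝ≥0∞, a ≠ 0 → a ≠ ⊤ → ∫⁻ x in {x | a ≤ u x}, u x ^ (-s) ∂τ ≤ C * a ^ (1 - s) := by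
  refine ⟨2 * (1 - 2 ^ (1 - s))⁻¹, ?_, fun a ha0 ha => ?_⟩
  · have : (2 : ℝ≥0∞) ^ (1 - s) < 1 :=
      ENNReal.rpow_lt_one_of_one_lt_of_neg (by norm_num) (by linarith)
    have h2 : 1 - (2 : ℝ≥0∞) ^ (1 - s) ≠ 0 := (tsub_pos_of_lt this).ne'
    finiteness
  set S : ℕ → Set X := fun n => {x | a * 2 ^ n ≤ u x ∧ u x ≤ a * 2 ^ (n + 1)} with hS
  have hSm : ∀ n, MeasurableSet (S n) := fun n =>
    (measurableSet_le measurable_const hu).inter (measurableSet_le hu measurable_const)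
  rw [← lintegral_indicator (measurableSet_le measurable_const hu)]
  calc ∫⁻ x, {x | a ≤ u x}.indicator (fun x => u x ^ (-s)) x ∂τ
      ≤ ∫⁻ x, ∑' n, (S n).indicator (fun _ => (a * 2 ^ n) ^ (-s)) x ∂τ := by
        refine lintegral_mono fun x => ?_
        by_cases hx : x ∈ {x | a ≤ u x}
        · rw [indicator_of_mem hx]
          rcases eq_or_ne (u x) ⊤ with ht | ht
          · rw [ht, ENNReal.top_rpow_of_neg (by linarith)]; exact zero_le
          · obtain ⟨m, hm⟩ := ENNReal.exists_mem_Ico_zpow (x := u x / a) (y := 2)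
              (ENNReal.div_ne_zero.2 ⟨((pos_iff_ne_zero.2 ha0).trans_le hx).ne', ha⟩)
              (ENNReal.div_ne_top ht ha0) (by norm_num) (by simp)
            have h1 : 1 ≤ u x / a := by
              rwa [ENNReal.le_div_iff_mul_le (Or.inl ha0) (Or.inl ha), one_mul]
            have hm0 : 0 ≤ m := by
              by_contra! hneg
              have : (2 : ℝ≥0∞) ^ (m + 1) ≤ 2 ^ (0 : ℤ) :=
                ENNReal.zpow_le_of_le (by norm_num) (by omega)
              rw [zpow_zero] at this
              exact absurd (h1.trans_lt hm.2) (not_lt.2 this)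
            obtain ⟨n, rfl⟩ := Int.eq_ofNat_of_zero_le hm0
            have hn1 : a * 2 ^ n ≤ u x := by
              have := hm.1
              rwa [ENNReal.le_div_iff_mul_le (Or.inl ha0) (Or.inl ha), zpow_natCast, mul_comm] at this
            have hn2 : u x ≤ a * 2 ^ (n + 1) := by
              have := hm.2.le
              rw [ENNReal.div_le_iff ha0 ha, mul_comm] at this
              exact_mod_cast this
            refine le_trans ?_ (ENNReal.le_tsum n)
            rw [indicator_of_mem (show x ∈ S n from ⟨hn1, hn2⟩), ENNReal.rpow_neg, ENNReal.rpow_neg]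
            gcongr
        · rw [indicator_of_notMem hx]; exact zero_le
    _ = ∑' n, (a * 2 ^ n) ^ (-s) * τ (S n) := by
        rw [lintegral_tsum fun m => (measurable_const.indicator (hSm m)).aemeasurable]
        refine tsum_congr fun m => ?_
        rw [lintegral_indicator_const (hSm m)]
    _ ≤ ∑' n, (2 * a ^ (1 - s)) * ((2 : ℝ≥0∞) ^ (1 - s)) ^ n := by
        refine ENNReal.tsum_le_tsum fun n => ?_
        have hne : a * 2 ^ n ≠ 0 := mul_ne_zero ha0 (by simp)
        calc (a * 2 ^ n) ^ (-s) * τ (S n) ≤ (a * 2 ^ n) ^ (-s) * (a * 2 ^ (n + 1)) := by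
              gcongr
              exact (measure_mono fun x hx => hx.2).trans (hτ _)
          _ = 2 * ((a * 2 ^ n) ^ (-s) * (a * 2 ^ n) ^ (1 : ℝ)) := by
              rw [ENNReal.rpow_one, pow_succ]; ring
          _ = (2 * a ^ (1 - s)) * ((2 : ℝ≥0∞) ^ (1 - s)) ^ n := by
              rw [← ENNReal.rpow_add _ _ hne (by finiteness), neg_add_eq_sub,
                ENNReal.mul_rpow_of_ne_top ha (by finiteness), ← ENNReal.rpow_natCast,
                ← ENNReal.rpow_natCast, ← ENNReal.rpow_mul, ← ENNReal.rpow_mul, mul_comm (n : ℝ),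
                mul_assoc]
    _ = _ := by rw [ENNReal.tsum_mul_left, ENNReal.tsum_geometric]; ring

/-- The same layers taken downwards from `a`; their contributions decay geometrically because `s <
1`. -/
theorem exists_setLIntegral_rpow_neg_le_le {s : ℝ} (hs0 : 0 < s) (hs : s < 1) :
    ∃ C : ℝ≥0∞, C ≠ ⊤ ∧
    ∀ a : ℝ≥0∞, a ≠ 0 → a ≠ ⊤ → ∫⁻ x in {x | u x ≤ a}, u x ^ (-s) ∂τ ≤ C * a ^ (1 - s) := by
  refine ⟨2 ^ s * (1 - (2⁻¹ : ℝ≥0∞) ^ (1 - s))⁻¹, ?_, fun a ha0 ha => ?_⟩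
  · have : (2⁻¹ : ℝ≥0∞) ^ (1 - s) < 1 :=
      ENNReal.rpow_lt_one (by norm_num) (by linarith)
    have h2 : 1 - (2⁻¹ : ℝ≥0∞) ^ (1 - s) ≠ 0 := (tsub_pos_of_lt this).ne'
    finiteness
  set S : ℕ → Set X := fun n => {x | a * 2⁻¹ ^ (n + 1) ≤ u x ∧ u x ≤ a * 2⁻¹ ^ n} with hS
  have hSm : ∀ n, MeasurableSet (S n) := fun n =>
    (measurableSet_le measurable_const hu).inter (measurableSet_le hu measurable_const)
  rw [← lintegral_indicator (measurableSet_le hu measurable_const)]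
  calc ∫⁻ x, {x | u x ≤ a}.indicator (fun x => u x ^ (-s)) x ∂τ
      ≤ ∫⁻ x, ∑' n, (S n).indicator (fun _ => (a * 2⁻¹ ^ (n + 1)) ^ (-s)) x ∂τ := by
        refine lintegral_mono_ae ?_
        -- The hypothesis at `c = 0` removes the points that lie in no dyadic layer.
        have hae : ∀ᵐ x ∂τ, u x ≠ 0 := by
          rw [ae_iff]
          simpa using hτ 0
        filter_upwards [hae] with x hx0
        by_cases hx : x ∈ {x | u x ≤ a}
        · rw [indicator_of_mem hx]
          have hxa : u x ≤ a := hx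
          obtain ⟨m, hm⟩ := ENNReal.exists_mem_Ioc_zpow (x := u x / a) (y := 2)
            (ENNReal.div_ne_zero.2 ⟨hx0, ha⟩)
            (ENNReal.div_ne_top (hxa.trans_lt ha.lt_top).ne ha0) (by norm_num) (by simp)
          have h1 : u x / a ≤ 1 := by
            rwa [ENNReal.div_le_iff ha0 ha, one_mul]
          have hm0 : m < 0 := by
            by_contra! hneg
            have : (2 : ℝ≥0∞) ^ (0 : ℤ) ≤ 2 ^ m := ENNReal.zpow_le_of_le (by norm_num) hneg
            rw [zpow_zero] at this
            exact absurd (hm.1.trans_le h1) (not_lt.2 this)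
          obtain ⟨n, rfl⟩ : ∃ n : ℕ, m = -((n + 1 : ℕ) : ℤ) := ⟨(-m - 1).toNat, by omega⟩
          have hn1 : a * 2⁻¹ ^ (n + 1) ≤ u x := by
            have := hm.1.le
            rwa [ENNReal.le_div_iff_mul_le (Or.inl ha0) (Or.inl ha), ENNReal.zpow_neg, zpow_natCast,
              ENNReal.inv_pow, mul_comm] at this
          have hn2 : u x ≤ a * 2⁻¹ ^ n := by
            have := hm.2
            rwa [ENNReal.div_le_iff ha0 ha, Nat.cast_add, Nat.cast_one, neg_add, neg_add_cancel_right,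
              ENNReal.zpow_neg, zpow_natCast, ENNReal.inv_pow, mul_comm] at this
          refine le_trans ?_ (ENNReal.le_tsum n)
          rw [indicator_of_mem (show x ∈ S n from ⟨hn1, hn2⟩), ENNReal.rpow_neg, ENNReal.rpow_neg]
          gcongr
        · rw [indicator_of_notMem hx]; exact zero_le
    _ = ∑' n, (a * 2⁻¹ ^ (n + 1)) ^ (-s) * τ (S n) := by
        rw [lintegral_tsum fun m => (measurable_const.indicator (hSm m)).aemeasurable]
        refine tsum_congr fun m => ?_
        rw [lintegral_indicator_const (hSm m)]
    _ ≤ ∑' n, (2 ^ s * a ^ (1 - s)) * ((2⁻¹ : ℝ≥0∞) ^ (1 - s)) ^ n := by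
        refine ENNReal.tsum_le_tsum fun n => ?_
        have hne : a * 2⁻¹ ^ n ≠ 0 := mul_ne_zero ha0 (by simp)
        calc (a * 2⁻¹ ^ (n + 1)) ^ (-s) * τ (S n)
            ≤ (a * 2⁻¹ ^ (n + 1)) ^ (-s) * (a * 2⁻¹ ^ n) := by
              gcongr
              exact (measure_mono fun x hx => hx.2).trans (hτ _)
          _ = 2 ^ s * ((a * 2⁻¹ ^ n) ^ (-s) * (a * 2⁻¹ ^ n) ^ (1 : ℝ)) := by
              rw [ENNReal.rpow_one, pow_succ, ← mul_assoc a,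
                ENNReal.mul_rpow_of_ne_top (x := a * 2⁻¹ ^ n) (by finiteness) (by finiteness),
                ENNReal.inv_rpow, ENNReal.rpow_neg 2, inv_inv]
              ring
          _ = (2 ^ s * a ^ (1 - s)) * ((2⁻¹ : ℝ≥0∞) ^ (1 - s)) ^ n := by
              rw [← ENNReal.rpow_add _ _ hne (by finiteness), neg_add_eq_sub,
                ENNReal.mul_rpow_of_ne_top ha (by finiteness), ← ENNReal.rpow_natCast,
                ← ENNReal.rpow_natCast, ← ENNReal.rpow_mul, ← ENNReal.rpow_mul, mul_comm (n : ℝ),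
                mul_assoc]
    _ = _ := by rw [ENNReal.tsum_mul_left, ENNReal.tsum_geometric]; ring

end Dyadic

end Hardy

/-! ### Averages and conjugate averages with respect to `ν` -/

section Averages

open Filter Topology

variable {X : Type*} [MeasurableSpace X] {ν : Measure X} {r : X → ℝ} (hr : Measurable r)
  (hν : ∀ t, ν {x | r x = t} = 0) {W : ℝ → ℝ≥0∞} (hW : ∀ t, W t = ν {x | r x < t})
  (hWt : ∀ t, W t ≠ ⊤)

include hW in
theorem monotone_of_eq_measure_lt : Monotone W := fun s t hst => by
  rw [hW, hW]
  exact measure_mono fun x (hx : r x < s) => hx.trans_le hst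

include hν hW in
theorem measure_setOf_le_le (c : ℝ≥0∞) : ν {x | W (r x) ≤ c} ≤ c := by
  simp_rw [hW]
  exact measure_distribution_le hν c

include hr hW in
theorem measurable_comp_of_eq_measure_lt : Measurable fun x => W (r x) :=
  (monotone_of_eq_measure_lt hW).measurable.comp hr

include hr hν hW hWt

theorem exists_setLIntegral_W_rpow_le {s : ℝ} (hs : 1 < s) : ∃ C : ℝ≥0∞, C ≠ ⊤ ∧
    ∀ t, W t ≠ 0 → ∫⁻ x in {x | t ≤ r x}, W (r x) ^ (-s) ∂ν ≤ C * W t ^ (1 - s) := by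
  obtain ⟨C, hC, h⟩ := exists_setLIntegral_rpow_neg_ge_le
    (measurable_comp_of_eq_measure_lt hr hW) (measure_setOf_le_le hν hW) hs
  refine ⟨C, hC, fun t ht => (lintegral_mono_set ?_).trans (h (W t) ht (hWt t))⟩
  exact fun x (hx : t ≤ r x) => monotone_of_eq_measure_lt hW hx

/-- This is Muckenhoupt's condition for the averaging operator: the tail is at most a constant times
`W t ^ (1 - p)`, and the exponents cancel since `(1 - p) / p + 1 / p' = 0`. -/
theorem exists_tail_mul_le {p : ℝ} (hp : 1 < p) : ∃ B : ℝ≥0∞, B ≠ ⊤ ∧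
    ∀ t, (∫⁻ x in {x | t ≤ r x}, W (r x) ^ (-p) ∂ν) ^ (1 / p) * W t ^ (1 / (p / (p - 1))) ≤ B := by
  have hp0 : 0 < p := by linarith
  obtain ⟨C, hC, h⟩ := exists_setLIntegral_W_rpow_le hr hν hW hWt hp
  refine ⟨C ^ (1 / p), by finiteness, fun t => ?_⟩
  have hpp : 0 < 1 / (p / (p - 1)) := by
    have : 0 < p - 1 := by linarith
    positivity
  rcases eq_or_ne (W t) 0 with h0 | h0
  · rw [h0, ENNReal.zero_rpow_of_pos hpp, mul_zero]; exact zero_le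
  · calc (∫⁻ x in {x | t ≤ r x}, W (r x) ^ (-p) ∂ν) ^ (1 / p) * W t ^ (1 / (p / (p - 1)))
        ≤ (C * W t ^ (1 - p)) ^ (1 / p) * W t ^ (1 / (p / (p - 1))) := by
          gcongr
          exact h t h0
      _ = C ^ (1 / p) * (W t ^ ((1 - p) * (1 / p)) * W t ^ (1 / (p / (p - 1)))) := by
          rw [ENNReal.mul_rpow_of_nonneg _ _ (by positivity), ← ENNReal.rpow_mul, mul_assoc]
      _ = C ^ (1 / p) := by
          rw [← ENNReal.rpow_add _ _ h0 (hWt t)]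
          have : (1 - p) * (1 / p) + 1 / (p / (p - 1)) = 0 := by field_simp; ring
          rw [this, ENNReal.rpow_zero, mul_one]

/-- Hardy's inequality for the averages over the sets `{r < t}`. -/
theorem exists_lintegral_average_le {p : ℝ} (hp : 1 < p) : ∃ C : ℝ≥0∞, C ≠ ⊤ ∧
    ∀ f : X → ℝ≥0∞, AEMeasurable f ν → ∫⁻ x, f x ^ p ∂ν ≠ ⊤ →
      (∫⁻ x, (W (r x) ^ (-1 : ℝ) * ∫⁻ y in {y | r y < r x}, f y ∂ν) ^ p ∂ν) ^ (1 / p) ≤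
        C * (∫⁻ x, f x ^ p ∂ν) ^ (1 / p) := by
  have hp0 : 0 < p := by linarith
  obtain ⟨B, hB, h⟩ := exists_tail_mul_le hr hν hW hWt hp
  refine ⟨8 * B, by finiteness, fun f hf hfp => ?_⟩
  have hWm : Measurable fun x => W (r x) ^ (-p) :=
    (measurable_comp_of_eq_measure_lt hr hW).pow_const _
  have hle : ∀ t, MeasurableSet {x | t ≤ r x} := fun t => measurableSet_le measurable_const hr
  -- The factor `1 / W` outside the integral is moved into the target measure; the kernel is `1`.
  have key := lintegral_hardy (σ := ν.withDensity fun x => W (r x) ^ (-p)) (k := fun _ => 1) hr hν hp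
    le_rfl aemeasurable_const hf hB hfp (fun t => by
      rw [withDensity_apply _ (hle t)]
      simp only [ENNReal.one_rpow, lintegral_const, Measure.restrict_apply, MeasurableSet.univ,
        univ_inter, one_mul, ← hW]
      exact h t)
  refine le_trans (le_of_eq ?_) key
  have hIm : Measurable fun x => ∫⁻ y in {y | r y < r x}, f y ∂ν := by
    have hmono : Monotone fun t : ℝ => ∫⁻ y in {y | r y < t}, f y ∂ν := fun s t hst =>
      lintegral_mono_set fun y (hy : r y < s) => hy.trans_le hst
    exact hmono.measurable.comp hr
  simp only [mul_one]
  rw [lintegral_withDensity_eq_lintegral_mul _ hWm (hIm.pow_const p)]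
  congr 1
  refine lintegral_congr fun x => ?_
  rw [ENNReal.mul_rpow_of_nonneg _ _ hp0.le, ← ENNReal.rpow_mul, neg_one_mul]
  rfl

/-- The conjugate of Hardy's inequality for averages. -/
theorem exists_lintegral_conj_average_le {p : ℝ} (hp : 1 < p) : ∃ C : ℝ≥0∞, C ≠ ⊤ ∧
    ∀ g : X → ℝ≥0∞, AEMeasurable g ν → ∫⁻ x, g x ^ p ∂ν ≠ ⊤ →
      (∫⁻ x, (∫⁻ y in {y | r x < r y}, g y * W (r y) ^ (-1 : ℝ) ∂ν) ^ p ∂ν) ^ (1 / p) ≤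
        C * (∫⁻ x, g x ^ p ∂ν) ^ (1 / p) := by
  have hp0 : 0 < p := by linarith
  have hpc : p.HolderConjugate (p / (p - 1)) := Real.HolderConjugate.conjExponent hp
  -- The conjugate operator requires the same tail condition with `p'` in place of `p`; the exponent
  -- conjugate to `p'` is `p` again.
  obtain ⟨B, hB, h⟩ := exists_tail_mul_le hr hν hW hWt hpc.symm.lt
  refine ⟨8 * B, by finiteness, fun g hg hgp => ?_⟩
  have hWm : Measurable fun x => W (r x) ^ (-1 : ℝ) :=
    (measurable_comp_of_eq_measure_lt hr hW).pow_const _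
  refine lintegral_hardy_conj hr hν hp le_rfl hWm.aemeasurable hg hB hgp fun t => ?_
  rw [measure_le_eq_measure_lt (hν t), ← hW, mul_comm]
  have hcc : p / (p - 1) / (p / (p - 1) - 1) = p := by
    have : p - 1 ≠ 0 := by linarith
    field_simp
    ring
  have h' := h t
  rw [hcc] at h'
  refine le_trans ?_ h'
  refine mul_le_mul' (ENNReal.rpow_le_rpow ?_ (by have := hpc.symm.pos; positivity)) le_rfl
  simp_rw [← ENNReal.rpow_mul, neg_one_mul]
  exact lintegral_mono_set fun x (hx : t < r x) => hx.le

/-- An intermediate value property of `W`. At the supremum of the `t` with `W t ≤ c`, continuity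
from above makes the closed sublevel set have measure at least `c`, and its sphere is null. Infinite
total mass keeps the supremum finite. -/
theorem le_measure_setOf_le (htop : ν univ = ⊤) {c : ℝ≥0∞} (hc0 : c ≠ ⊤)
    (hc : ∃ t, W t ≤ c) : c ≤ ν {x | W (r x) ≤ c} := by
  have hmono := monotone_of_eq_measure_lt hW
  obtain ⟨b, hb⟩ : ∃ b, c < W b := by
    have hU : (⋃ n : ℕ, {x | r x < n}) = univ := by
      refine eq_univ_of_forall fun x => mem_iUnion.2 ?_
      obtain ⟨n, hn⟩ := exists_nat_gt (r x)
      exact ⟨n, hn⟩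
    have hmon : Monotone fun n : ℕ => {x | r x < n} := fun m n hmn x (hx : r x < m) =>
      hx.trans_le (by exact_mod_cast hmn)
    have h1 := hmon.measure_iUnion (μ := ν)
    rw [hU, htop] at h1
    have h2 : c < ⨆ n : ℕ, ν {x | r x < n} := h1 ▸ hc0.lt_top
    obtain ⟨n, hn⟩ := lt_iSup_iff.1 h2
    exact ⟨n, by rw [hW]; exact hn⟩
  set T := {t | W t ≤ c} with hT
  have hbdd : BddAbove T := ⟨b, fun t ht => by
    by_contra! hlt
    exact absurd (hb.trans_le (hmono hlt.le)) (not_lt.2 ht)⟩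
  have hge : c ≤ ν {x | r x ≤ sSup T} := by
    have hI : {x | r x ≤ sSup T} = ⋂ n : ℕ, {x | r x < sSup T + 1 / (n + 1)} := by
      ext x
      simp only [mem_ofPred_eq, mem_iInter]
      constructor
      · intro hx n
        have : (0 : ℝ) < 1 / (n + 1) := by positivity
        linarith
      · intro hx
        refine le_of_forall_pos_lt_add fun ε hε => ?_
        obtain ⟨n, hn⟩ := exists_nat_one_div_lt hε
        exact (hx n).trans (by linarith)
    have hanti : Antitone fun n : ℕ => {x | r x < sSup T + 1 / ((n : ℝ) + 1)} := by
      intro m n hmn x (hx : r x < _)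
      refine hx.trans_le ?_
      have : 1 / ((n : ℝ) + 1) ≤ 1 / ((m : ℝ) + 1) := Nat.one_div_le_one_div hmn
      linarith
    rw [hI, hanti.measure_iInter (fun n => (measurableSet_lt hr measurable_const).nullMeasurableSet)
      ⟨0, by rw [← hW]; exact hWt _⟩]
    refine le_iInf fun n => ?_
    rw [← hW]
    by_contra! hlt
    have h1 : sSup T + 1 / ((n : ℝ) + 1) ≤ sSup T := le_csSup hbdd hlt.le
    have : (0 : ℝ) < 1 / ((n : ℝ) + 1) := by positivity
    linarith
  refine hge.trans ?_
  rw [measure_le_eq_measure_lt (hν _)]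
  refine measure_mono fun x (hx : r x < sSup T) => ?_
  obtain ⟨t, ht, hxt⟩ := exists_lt_of_lt_csSup hc hx
  exact (hmono hxt.le).trans ht

/-- A decreasing function of `r` is dominated by the conjugate average of its averages. -/
theorem decreasing_le_conj_average (htop : ν univ = ⊤) (h0 : ν {x | r x ≤ 0} = 0) {φ : ℝ → ℝ≥0∞}
    (hφ : AntitoneOn φ (Ioi 0)) {x : X} (hx : 0 < r x) (hWx : W (r x) ≠ 0) :
    φ (r x) ≤ 4 * ∫⁻ y in {y | r x < r y},
      (W (r y) ^ (-1 : ℝ) * ∫⁻ z in {z | r z < r y}, φ (r z) ∂ν) * W (r y) ^ (-1 : ℝ) ∂ν := by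
  set s := r x with hs
  have hmono := monotone_of_eq_measure_lt hW
  have hle : ∀ t, MeasurableSet {x | r x < t} := fun t => measurableSet_lt hr measurable_const
  have hpos : ∀ᵐ z ∂ν, 0 < r z := by
    rw [ae_iff]; simpa using h0
  have h1 : φ s * W s ≤ ∫⁻ z in {z | r z < s}, φ (r z) ∂ν := by
    rw [hW, ← setLIntegral_const]
    refine setLIntegral_mono_ae' (hle s) ?_
    filter_upwards [hpos] with z hz hzs
    exact hφ hz hx (show r z < s from hzs).le
  -- On `A` the value `W` has at most doubled, and `ν A ≥ W s`. There the integral of `φ` is at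
  -- least `φ s * W s` and both factors `1 / W` are at least `1 / (2 W s)`, which gives `φ s / 4` in
  -- total.
  set c := 2 * W s with hc
  have hct : c ≠ ⊤ := by have := hWt s; finiteness
  set A := {y | s < r y} ∩ {y | W (r y) ≤ c} with hA
  have hAm : MeasurableSet A := (measurableSet_lt measurable_const hr).inter
    (measurableSet_le (measurable_comp_of_eq_measure_lt hr hW) measurable_const)
  have hνA : W s ≤ ν A := by
    have h2 : c ≤ ν {x | W (r x) ≤ c} := le_measure_setOf_le hr hν hW hWt htop hct
      ⟨s, le_mul_of_one_le_left zero_le (by norm_num)⟩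
    have h3 : ν {x | W (r x) ≤ c} ≤ ν A + W s := by
      rw [hW s, ← measure_le_eq_measure_lt (hν s)]
      refine (measure_mono fun y (hy : W (r y) ≤ c) => ?_).trans (measure_union_le _ _)
      rcases le_or_gt (r y) s with h | h
      · exact Or.inr h
      · exact Or.inl ⟨h, hy⟩
    have h4 : W s + W s ≤ ν A + W s := by
      rw [← two_mul]; exact h2.trans h3
    exact (ENNReal.add_le_add_iff_right (hWt s)).1 h4
  calc φ s = 4 * (φ s * W s * c ^ (-1 : ℝ) * c ^ (-1 : ℝ) * W s) := by
        rw [hc, ENNReal.rpow_neg_one, ENNReal.mul_inv (Or.inl (by norm_num)) (Or.inl (by norm_num))]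
        have h5 : W s * (W s)⁻¹ = 1 := ENNReal.mul_inv_cancel hWx (hWt s)
        have h6 : (4 : ℝ≥0∞) * (2⁻¹ * 2⁻¹) = 1 := by
          rw [← ENNReal.mul_inv (Or.inl (by norm_num)) (Or.inl (by norm_num))]
          norm_num
          exact ENNReal.mul_inv_cancel (by norm_num) (by norm_num)
        calc φ s = φ s * (W s * (W s)⁻¹) * (W s * (W s)⁻¹) * (4 * (2⁻¹ * 2⁻¹)) := by
              rw [h5, h6]; simp
          _ = _ := by ring
    _ ≤ 4 * (φ s * W s * c ^ (-1 : ℝ) * c ^ (-1 : ℝ) * ν A) := by gcongr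
    _ = 4 * ∫⁻ y in A, φ s * W s * c ^ (-1 : ℝ) * c ^ (-1 : ℝ) ∂ν := by rw [setLIntegral_const]
    _ ≤ 4 * ∫⁻ y in A, (W (r y) ^ (-1 : ℝ) * ∫⁻ z in {z | r z < r y}, φ (r z) ∂ν) *
          W (r y) ^ (-1 : ℝ) ∂ν := by
        refine mul_le_mul' le_rfl (setLIntegral_mono' hAm fun y hy => ?_)
        have h7 : c ^ (-1 : ℝ) ≤ W (r y) ^ (-1 : ℝ) := by
          rw [ENNReal.rpow_neg_one, ENNReal.rpow_neg_one]
          exact ENNReal.inv_le_inv.2 hy.2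
        have h8 : φ s * W s ≤ ∫⁻ z in {z | r z < r y}, φ (r z) ∂ν :=
          h1.trans (lintegral_mono_set fun z (hz : r z < s) => hz.trans hy.1)
        rw [mul_comm (W (r y) ^ (-1 : ℝ))]
        gcongr
    _ ≤ _ := mul_le_mul' le_rfl (lintegral_mono_set inter_subset_left)

end Averages

/-! ### Kernel estimates and the pointwise bound of the potential -/

theorem ENNReal.rpow_neg_le_mul_rpow_neg {a b m : ℝ≥0∞} {s : ℝ} (hs : 0 ≤ s) (hm0 : m ≠ 0)
    (hm : m ≠ ⊤) (h : a ≤ m * b) : b ^ (-s) ≤ m ^ s * a ^ (-s) := by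
  have h1 : m⁻¹ * a ≤ b := by
    rw [mul_comm, ← div_eq_mul_inv, ENNReal.div_le_iff hm0 hm, mul_comm]
    exact h
  calc b ^ (-s) ≤ (m⁻¹ * a) ^ (-s) := by
        rw [ENNReal.rpow_neg, ENNReal.rpow_neg]
        gcongr
    _ = m ^ s * a ^ (-s) := by
        have hmi : m⁻¹ ≠ 0 := ENNReal.inv_ne_zero.2 hm
        have hmt : m⁻¹ ≠ ⊤ := ENNReal.inv_ne_top.2 hm0
        rw [ENNReal.rpow_neg, ENNReal.rpow_neg, ENNReal.mul_rpow_of_nonneg _ _ hs, ENNReal.inv_rpow,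
          ENNReal.mul_inv (Or.inl (by simpa using ENNReal.rpow_ne_top_of_nonneg hs hm))
            (Or.inl (by simpa using (ENNReal.rpow_pos (pos_iff_ne_zero.2 hm0) hm).ne')), inv_inv]

namespace HomogeneousNorm

open Topology Filter

variable {E G : Type*} [NormedAddCommGroup E] [NormedSpace ℝ E]
  [FiniteDimensional ℝ E] [TopologicalSpace G] [ChartedSpace E G] [Group G]
  [LieGroup 𝓘(ℝ, E) ∞ G] {H : HomogeneousGroup E G} (N : HomogeneousNorm H)

theorem exists_one_le_quasi_triangle : ∃ c : ℝ, 1 ≤ c ∧ ∀ x y, N.r (x * y) ≤ c * (N.r x + N.r y) := by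
  obtain ⟨c, hc, h⟩ := N.quasi_triangle
  refine ⟨max 1 c, le_max_left _ _, fun x y => (h x y).trans ?_⟩
  have := N.nonneg x
  have := N.nonneg y
  gcongr
  exact le_max_right _ _

/-- A lower bound for the kernel of the Riesz potential. -/
theorem exists_le_kernel {s : ℝ} (hs : 0 ≤ s) : ∃ C : ℝ≥0∞, C ≠ ⊤ ∧
    ∀ x y, ENNReal.ofReal (N.r x + N.r y) ^ (-s) ≤ C * N.rpow (-s) (x * y⁻¹) := by
  obtain ⟨c, hc, h⟩ := N.exists_one_le_quasi_triangle
  refine ⟨ENNReal.ofReal c ^ s, by finiteness, fun x y => ?_⟩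
  refine ENNReal.rpow_neg_le_mul_rpow_neg hs (by simp; linarith) ENNReal.ofReal_ne_top ?_
  rw [← ENNReal.ofReal_mul (by linarith)]
  refine ENNReal.ofReal_le_ofReal ?_
  have := h x y⁻¹
  rwa [← N.inv y] at this

variable [MeasurableSpace G] [BorelSpace G]

theorem measurable_rpow (s : ℝ) : Measurable (N.rpow s) :=
  N.measurable_r.ennreal_ofReal.pow_const s

variable [T2Space G] [SecondCountableTopology G] {μ : Measure G} [μ.IsHaarMeasure]
  (hμ : μ (N.ball 1 1) = 1)

include hμ

theorem measure_lt (hQ : 0 < H.Q) (t : ℝ) : μ {x | N.r x < t} = ENNReal.ofReal t ^ H.Q := by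
  rcases le_or_gt t 0 with ht | ht
  · rw [ENNReal.ofReal_of_nonpos ht, ENNReal.zero_rpow_of_pos hQ]
    convert measure_empty (μ := μ)
    ext x
    simpa using ht.trans (N.nonneg x)
  · rw [← N.ball_one_eq, N.measure_ball hμ ht, ENNReal.ofReal_rpow_of_pos ht]

theorem ae_r_pos (hQ : 0 < H.Q) : ∀ᵐ x ∂μ, 0 < N.r x := by
  rw [ae_iff]
  refine measure_mono_null (fun x hx => ?_) (N.measure_sphere hμ hQ 0)
  exact le_antisymm (not_lt.1 hx) (N.nonneg x)

/-- The Riesz kernel is integrable near the identity. -/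
theorem exists_setLIntegral_rpow_le {α : ℝ} (hα : 0 < α) (hαQ : α < H.Q) : ∃ C : ℝ≥0∞, C ≠ ⊤ ∧
    ∀ t, 0 < t → ∫⁻ x in {x | N.r x < t}, N.rpow (α - H.Q) x ∂μ ≤ C * ENNReal.ofReal t ^ α := by
  have hQ : 0 < H.Q := hα.trans hαQ
  have hu : ∀ c, μ {x | N.rpow H.Q x ≤ c} ≤ c := by
    intro c
    have := measure_distribution_le (N.measure_sphere hμ hQ) c
    simp_rw [N.measure_lt hμ hQ] at this
    exact this
  -- With `u = r ^ Q`, the volume formula is the distribution hypothesis and the kernel is `u ^ (-(Q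
  -- - α) / Q)`.
  obtain ⟨C, hC, h⟩ := exists_setLIntegral_rpow_neg_le_le (N.measurable_rpow H.Q) hu
    (s := (H.Q - α) / H.Q) (div_pos (by linarith) hQ) ((div_lt_one hQ).2 (by linarith))
  refine ⟨C, hC, fun t ht => ?_⟩
  have ht0 : ENNReal.ofReal t ≠ 0 := by simpa using ht
  have h1 := h (ENNReal.ofReal t ^ H.Q)
    (ENNReal.rpow_pos (pos_iff_ne_zero.2 ht0) ENNReal.ofReal_ne_top).ne' (by finiteness)
  have e1 : H.Q * (1 - (H.Q - α) / H.Q) = α := by field_simp; ring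
  have e2 : ∀ x, N.rpow H.Q x ^ (-((H.Q - α) / H.Q)) = N.rpow (α - H.Q) x := fun x => by
    rw [rpow, rpow, ← ENNReal.rpow_mul]
    congr 1
    field_simp
    ring
  rw [← ENNReal.rpow_mul, e1] at h1
  simp_rw [e2] at h1
  refine (lintegral_mono_set fun x (hx : N.r x < t) => ?_).trans h1
  exact ENNReal.rpow_le_rpow (ENNReal.ofReal_le_ofReal hx.le) hQ.le

/-- The Riesz potential of a radially decreasing function is bounded by the sum of a Hardy operator
and a conjugate Hardy operator. -/
theorem exists_rieszPotential_le {α : ℝ} (hα : 0 < α) (hαQ : α < H.Q) : ∃ C : ℝ≥0∞, C ≠ ⊤ ∧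
    ∀ (f : G → ℝ≥0) (φ : ℝ → ℝ≥0), AntitoneOn φ (Ioi 0) → (∀ x, f x = φ (N.r x)) → ∀ x,
      0 < N.r x → N.rieszPotential μ α f x ≤
        C * (N.rpow (α - H.Q) x * (∫⁻ y in {y | N.r y < N.r x}, f y ∂μ) +
          ∫⁻ y in {y | N.r x ≤ N.r y}, f y * N.rpow (α - H.Q) y ∂μ) := by
  have hQ : 0 < H.Q := hα.trans hαQ
  have : IsTopologicalGroup G := topologicalGroup_of_lieGroup 𝓘(ℝ, E) ∞
  have := N.isMulRightInvariant hμ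
  obtain ⟨c, hc, htri⟩ := N.exists_one_le_quasi_triangle
  obtain ⟨C₁, hC₁, hint⟩ := N.exists_setLIntegral_rpow_le hμ hα hαQ
  set s := H.Q - α with hs
  have hs0 : 0 ≤ s := by linarith
  have hns : α - H.Q = -s := by rw [hs]; ring
  rw [hns] at hint ⊢
  set K := ENNReal.ofReal (2 * c) ^ s with hK
  set K' := ENNReal.ofReal (c * (1 + 2 * c)) ^ s with hK'
  have hKt : K ≠ ⊤ := by finiteness
  have hKt' : K' ≠ ⊤ := by finiteness
  refine ⟨C₁ * K + K + K', by finiteness, fun f φ hφ hf x hx => ?_⟩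
  rw [rieszPotential, hns]
  set ρ := N.r x with hρ
  -- With this radius, `r(x y⁻¹) < η` forces `r(y) ≥ η` by the quasi-triangle inequality.
  set η := ρ / (2 * c) with hη
  have hη0 : 0 < η := by positivity
  have hcη : 2 * c * η = ρ := by rw [hη]; field_simp
  have hηρ : η ≤ ρ := by nlinarith
  have hρt : N.rpow (-s) x ≠ ⊤ := by
    rw [rpow]
    exact ENNReal.rpow_ne_top_of_ne_zero (by simpa using hx) ENNReal.ofReal_ne_top
  have hηK : ENNReal.ofReal η ^ (-s) ≤ K * N.rpow (-s) x := by
    refine ENNReal.rpow_neg_le_mul_rpow_neg hs0 (by simp; linarith) ENNReal.ofReal_ne_top ?_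
    rw [← ENNReal.ofReal_mul (by positivity), hcη]
  set A := {y | N.r (x * y⁻¹) < η} with hA
  have hAm : MeasurableSet A :=
    (isOpen_lt (N.continuous_r.comp (by fun_prop)) continuous_const).measurableSet
  have hlt : MeasurableSet {y | N.r y < ρ} := measurableSet_lt N.measurable_r measurable_const
  set I₁ := ∫⁻ y in {y | N.r y < ρ}, f y ∂μ with hI₁
  set I₂ := ∫⁻ y in {y | ρ ≤ N.r y}, f y * N.rpow (-s) y ∂μ with hI₂
  have hφI : φ η * ENNReal.ofReal η ^ H.Q ≤ I₁ := by
    rw [← N.measure_lt hμ hQ, ← setLIntegral_const]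
    have h1 : ∫⁻ y in {y | N.r y < η}, (φ η : ℝ≥0∞) ∂μ ≤ ∫⁻ y in {y | N.r y < η}, f y ∂μ := by
      refine setLIntegral_mono_ae' (measurableSet_lt N.measurable_r measurable_const) ?_
      filter_upwards [N.ae_r_pos hμ hQ] with y hy hyη
      rw [hf y]
      exact_mod_cast hφ hy hη0 (show N.r y < η from hyη).le
    exact h1.trans (lintegral_mono_set fun y (hy : N.r y < η) => hy.trans_le hηρ)
  -- Near `x`, `f ≤ φ η` and the kernel integrates to at most `C₁ η ^ α`. Monotonicity gives `φ η *
  -- η ^ Q ≤ ∫_{r < ρ} f`, so this part is absorbed by the first Hardy operator.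
  have hnear : ∫⁻ y in A, f y * N.rpow (-s) (x * y⁻¹) ∂μ ≤ C₁ * K * (N.rpow (-s) x * I₁) := by
    calc ∫⁻ y in A, f y * N.rpow (-s) (x * y⁻¹) ∂μ
        ≤ ∫⁻ y in A, φ η * N.rpow (-s) (x * y⁻¹) ∂μ := by
          refine setLIntegral_mono' hAm fun y (hy : N.r (x * y⁻¹) < η) => ?_
          have h1 : ρ ≤ c * (N.r (x * y⁻¹) + N.r y) := by
            have := htri (x * y⁻¹) y
            rwa [inv_mul_cancel_right] at this
          have h2 : η ≤ N.r y := by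
            have h3 : c * (2 * η) ≤ c * (N.r (x * y⁻¹) + N.r y) := by linarith
            have := le_of_mul_le_mul_left h3 (by linarith)
            linarith
          rw [hf y]
          gcongr
          exact hφ hη0 (hη0.trans_le h2) h2
      _ = φ η * ∫⁻ y in A, N.rpow (-s) (x * y⁻¹) ∂μ :=
          lintegral_const_mul' _ _ ENNReal.coe_ne_top
      _ = φ η * ∫⁻ y in {y | N.r y < η}, N.rpow (-s) y ∂μ := by
          congr 1
          rw [← lintegral_indicator hAm,
            ← lintegral_indicator (measurableSet_lt N.measurable_r measurable_const),
            -- Right invariance, together with the symmetry of `r`, recentres the kernel at the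
            -- identity.
            ← lintegral_mul_right_eq_self ({y | N.r y < η}.indicator (N.rpow (-s))) x⁻¹]
          refine lintegral_congr fun y => ?_
          have h1 : N.r (x * y⁻¹) = N.r (y * x⁻¹) := by rw [N.inv]; simp
          have h2 : N.rpow (-s) (x * y⁻¹) = N.rpow (-s) (y * x⁻¹) := by rw [rpow, rpow, h1]
          by_cases h : N.r (y * x⁻¹) < η
          · rw [indicator_of_mem (show y ∈ A from h1.trans_lt h), h2,
              indicator_of_mem (show y * x⁻¹ ∈ {y | N.r y < η} from h)]
          · rw [indicator_of_notMem (show y ∉ A from fun h' => h (h1.symm.trans_lt h')),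
              indicator_of_notMem (show y * x⁻¹ ∉ {y | N.r y < η} from h)]
      _ ≤ φ η * (C₁ * ENNReal.ofReal η ^ α) := by gcongr; exact hint η hη0
      _ = C₁ * ((φ η * ENNReal.ofReal η ^ H.Q) * ENNReal.ofReal η ^ (-s)) := by
          have : ENNReal.ofReal η ^ α = ENNReal.ofReal η ^ H.Q * ENNReal.ofReal η ^ (-s) := by
            rw [← ENNReal.rpow_add _ _ (by simpa using hη0) ENNReal.ofReal_ne_top, hs]
            congr 1; ring
          rw [this]; ring
      _ ≤ C₁ * (I₁ * (K * N.rpow (-s) x)) := by gcongr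
      _ = _ := by ring
  have hfarx : ∀ y ∈ Aᶜ, N.rpow (-s) (x * y⁻¹) ≤ K * N.rpow (-s) x := by
    intro y hy
    have hy' : η ≤ N.r (x * y⁻¹) := not_lt.1 hy
    refine ENNReal.rpow_neg_le_mul_rpow_neg hs0 (by simp; linarith) ENNReal.ofReal_ne_top ?_
    rw [← ENNReal.ofReal_mul (by positivity)]
    refine ENNReal.ofReal_le_ofReal ?_
    rw [← hρ, ← hcη]
    gcongr
  -- Away from `x`, `ρ = 2 c η ≤ 2 c r(x y⁻¹)`, hence `r(y) ≤ c (1 + 2 c) r(x y⁻¹)`.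
  have hfary : ∀ y ∈ Aᶜ, N.rpow (-s) (x * y⁻¹) ≤ K' * N.rpow (-s) y := by
    intro y hy
    have hy' : η ≤ N.r (x * y⁻¹) := not_lt.1 hy
    refine ENNReal.rpow_neg_le_mul_rpow_neg hs0 (by simp; positivity) ENNReal.ofReal_ne_top ?_
    rw [← ENNReal.ofReal_mul (by positivity)]
    refine ENNReal.ofReal_le_ofReal ?_
    have h1 := htri (x * y⁻¹)⁻¹ x
    rw [← N.inv, mul_inv_rev, inv_inv, inv_mul_cancel_right, ← hρ, ← hcη] at h1
    have : c * (N.r (x * y⁻¹) + 2 * c * η) ≤ c * (N.r (x * y⁻¹) + 2 * c * N.r (x * y⁻¹)) := by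
      gcongr
    linarith
  have hfar : ∫⁻ y in Aᶜ, f y * N.rpow (-s) (x * y⁻¹) ∂μ ≤
      K * (N.rpow (-s) x * I₁) + K' * I₂ := by
    calc ∫⁻ y in Aᶜ, f y * N.rpow (-s) (x * y⁻¹) ∂μ
        ≤ (∫⁻ y in {y | N.r y < ρ} ∩ Aᶜ, f y * N.rpow (-s) (x * y⁻¹) ∂μ) +
          ∫⁻ y in {y | ρ ≤ N.r y} ∩ Aᶜ, f y * N.rpow (-s) (x * y⁻¹) ∂μ := by
          refine (lintegral_mono_set ?_).trans (lintegral_union_le _ _ _)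
          intro y hy
          rcases lt_or_ge (N.r y) ρ with h | h
          · exact Or.inl ⟨h, hy⟩
          · exact Or.inr ⟨h, hy⟩
      _ ≤ (∫⁻ y in {y | N.r y < ρ} ∩ Aᶜ, (K * N.rpow (-s) x) * f y ∂μ) +
          ∫⁻ y in {y | ρ ≤ N.r y} ∩ Aᶜ, K' * (f y * N.rpow (-s) y) ∂μ := by
          refine add_le_add (setLIntegral_mono' (hlt.inter hAm.compl) fun y hy => ?_)
            (setLIntegral_mono' ((measurableSet_le measurable_const N.measurable_r).inter hAm.compl)
              fun y hy => ?_)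
          · rw [mul_comm]
            gcongr
            exact hfarx y hy.2
          · rw [mul_left_comm]
            gcongr
            exact hfary y hy.2
      _ ≤ (∫⁻ y in {y | N.r y < ρ}, (K * N.rpow (-s) x) * f y ∂μ) +
          ∫⁻ y in {y | ρ ≤ N.r y}, K' * (f y * N.rpow (-s) y) ∂μ :=
          add_le_add (lintegral_mono_set inter_subset_left) (lintegral_mono_set inter_subset_left)
      _ = K * (N.rpow (-s) x * I₁) + K' * I₂ := by
          rw [lintegral_const_mul' _ _ (ENNReal.mul_ne_top hKt hρt), lintegral_const_mul' _ _ hKt',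
            mul_assoc]
  calc ∫⁻ y, f y * N.rpow (-s) (x * y⁻¹) ∂μ
      = (∫⁻ y in A, f y * N.rpow (-s) (x * y⁻¹) ∂μ) +
        ∫⁻ y in Aᶜ, f y * N.rpow (-s) (x * y⁻¹) ∂μ := (lintegral_add_compl _ hAm).symm
    _ ≤ C₁ * K * (N.rpow (-s) x * I₁) + (K * (N.rpow (-s) x * I₁) + K' * I₂) :=
        add_le_add hnear hfar
    _ = (C₁ * K + K) * (N.rpow (-s) x * I₁) + K' * I₂ := by ring
    _ ≤ (C₁ * K + K + K') * (N.rpow (-s) x * I₁) + (C₁ * K + K + K') * I₂ := by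
        exact add_le_add (mul_le_mul' le_self_add le_rfl) (mul_le_mul' le_add_self le_rfl)
    _ = _ := by ring

end HomogeneousNorm

/-- The measure with density the weight `w`. -/
def weightMeasure {G : Type*} [MeasurableSpace G] (μ : Measure G) (w : G → ℝ) : Measure G :=
  μ.withDensity fun x => ENNReal.ofReal (w x)

/-! ### Integration against a weight -/

section WeightMeasure

variable {G : Type*} [MeasurableSpace G] {μ : Measure G} {w : G → ℝ}

instance [SFinite μ] : SFinite (weightMeasure μ w) := by
  unfold weightMeasure; infer_instance

theorem weightMeasure_absolutelyContinuous : weightMeasure μ w ≪ μ :=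
  withDensity_absolutelyContinuous _ _

theorem lintegral_weightMeasure (hw : IsWeight μ w) {f : G → ℝ≥0∞} (hf : AEMeasurable f μ) :
    ∫⁻ x, f x ∂(weightMeasure μ w) = ∫⁻ x, f x * ENNReal.ofReal (w x) ∂μ := by
  rw [weightMeasure, lintegral_withDensity_eq_lintegral_mul₀ hw.1.ennreal_ofReal hf]
  simp only [Pi.mul_apply, mul_comm]

theorem setLIntegral_weightMeasure (hw : IsWeight μ w) {f : G → ℝ≥0∞} (hf : AEMeasurable f μ)
    {s : Set G} (hs : MeasurableSet s) :
    ∫⁻ x in s, f x ∂(weightMeasure μ w) = ∫⁻ x in s, f x * ENNReal.ofReal (w x) ∂μ := by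
  rw [weightMeasure, restrict_withDensity hs,
    lintegral_withDensity_eq_lintegral_mul₀ hw.1.ennreal_ofReal.restrict hf.restrict]
  simp only [Pi.mul_apply, mul_comm]

theorem weightMeasure_apply {s : Set G} (hs : MeasurableSet s) :
    weightMeasure μ w s = ∫⁻ x in s, ENNReal.ofReal (w x) ∂μ :=
  withDensity_apply _ hs

end WeightMeasure

/-- Tonelli on the region `r y < r z`. -/
theorem setLIntegral_lintegral_lt_swap {X : Type*} [MeasurableSpace X] {μ ν : Measure X}
    [SFinite μ] [SFinite ν] {r : X → ℝ} (hr : Measurable r) {h k : X → ℝ≥0∞} (hh : Measurable h)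
    (hk : Measurable k) (A : Set X) :
    ∫⁻ y in A, k y * (∫⁻ z in {z | r y < r z}, h z ∂ν) ∂μ =
      ∫⁻ z, h z * (∫⁻ y in {y | r y < r z}, k y ∂(μ.restrict A)) ∂ν := by
  have hS : MeasurableSet {p : X × X | r p.1 < r p.2} :=
    measurableSet_lt (hr.comp measurable_fst) (hr.comp measurable_snd)
  have hm : Measurable ({p : X × X | r p.1 < r p.2}.indicator fun p => k p.1 * h p.2) :=
    ((hk.comp measurable_fst).mul (hh.comp measurable_snd)).indicator hS
  have e1 : ∀ y, k y * (∫⁻ z in {z | r y < r z}, h z ∂ν) =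
      ∫⁻ z, {p : X × X | r p.1 < r p.2}.indicator (fun p => k p.1 * h p.2) (y, z) ∂ν := by
    intro y
    rw [← lintegral_const_mul _ hh, ← lintegral_indicator (measurableSet_lt measurable_const hr)]
    rfl
  have e2 : ∀ z, h z * (∫⁻ y in {y | r y < r z}, k y ∂(μ.restrict A)) =
      ∫⁻ y, {p : X × X | r p.1 < r p.2}.indicator (fun p => k p.1 * h p.2) (y, z)
        ∂(μ.restrict A) := by
    intro z
    rw [← lintegral_const_mul _ hk, ← lintegral_indicator (measurableSet_lt hr measurable_const)]
    refine lintegral_congr fun y => ?_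
    simp only [indicator, mem_ofPred_eq, mul_comm]
  simp_rw [e1, e2]
  exact lintegral_lintegral_swap hm.aemeasurable

/-! ### Weighted balls and the reduction to Hardy operators -/

namespace HomogeneousNorm

open Topology Filter

variable {E G : Type*} [NormedAddCommGroup E] [NormedSpace ℝ E]
  [FiniteDimensional ℝ E] [TopologicalSpace G] [ChartedSpace E G] [Group G]
  [LieGroup 𝓘(ℝ, E) ∞ G] {H : HomogeneousGroup E G} (N : HomogeneousNorm H)
  [MeasurableSpace G] {μ : Measure G} {w : G → ℝ}

theorem W_ne_top [T2Space G] (hw_loc : LocallyIntegrable w μ) (t : ℝ) : N.W μ w t ≠ ⊤ := by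
  have h := hw_loc.integrableOn_isCompact (N.isCompact_sublevel t)
  rw [W]
  refine ((lintegral_mono_set fun x hx => ?_).trans_lt h.lintegral_lt_top).ne
  exact (N.mem_ball_one.1 hx).le

variable [BorelSpace G]

theorem W_eq (t : ℝ) : N.W μ w t = weightMeasure μ w {x | N.r x < t} := by
  rw [W, N.ball_one_eq, weightMeasure_apply (measurableSet_lt N.measurable_r measurable_const)]

theorem measurable_W_r : Measurable fun x => N.W μ w (N.r x) :=
  measurable_comp_of_eq_measure_lt N.measurable_r N.W_eq

/-- Identifies the Muckenhoupt kernel integrals of `r ^ a / W` with the integrals in conditions (ii)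
and (iii). -/
theorem setLIntegral_dualDensity (hw : IsWeight μ w) {p : ℝ} (hp : 1 < p) {a b : ℝ}
    (hab : b = a * (p / (p - 1))) {s : Set G} (hs : MeasurableSet s) :
    ∫⁻ x in s, (N.rpow a x * N.W μ w (N.r x) ^ (-1 : ℝ)) ^ (p / (p - 1)) ∂(weightMeasure μ w) =
      ∫⁻ x in s, N.dualDensity μ p b w x ∂μ := by
  have hp' : 0 ≤ p / (p - 1) := div_nonneg (by linarith) (by linarith)
  have hm : Measurable fun x => (N.rpow a x * N.W μ w (N.r x) ^ (-1 : ℝ)) ^ (p / (p - 1)) :=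
    ((N.measurable_rpow a).mul (N.measurable_W_r.pow_const _)).pow_const _
  rw [setLIntegral_weightMeasure hw hm.aemeasurable hs]
  refine lintegral_congr fun x => ?_
  rw [dualDensity, ENNReal.mul_rpow_of_nonneg _ _ hp', rpow, rpow, ← ENNReal.rpow_mul,
    ← ENNReal.rpow_mul, hab, neg_one_mul]

variable [T2Space G] [SecondCountableTopology G] [μ.IsHaarMeasure] (hμ : μ (N.ball 1 1) = 1)

include hμ

theorem W_ne_zero (hw : IsWeight μ w) {t : ℝ} (ht : 0 < t) : N.W μ w t ≠ 0 := by
  intro h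
  rw [W, lintegral_eq_zero_iff' hw.1.ennreal_ofReal.restrict] at h
  have h2 : ∀ᵐ x ∂(μ.restrict (N.ball 1 t)), False := by
    filter_upwards [h] with x hx
    have : w x ≤ 0 := by simpa using hx
    exact absurd (hw.2 x) (not_lt.2 this)
  rw [ae_iff] at h2
  simp only [not_false_eq_true, ofPred_true, Measure.restrict_apply_univ] at h2
  rw [N.measure_ball hμ ht, ENNReal.ofReal_eq_zero] at h2
  exact absurd (Real.rpow_pos_of_pos ht H.Q) (not_lt.2 h2)

theorem weightMeasure_sphere (hQ : 0 < H.Q) (t : ℝ) : weightMeasure μ w {x | N.r x = t} = 0 :=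
  weightMeasure_absolutelyContinuous (N.measure_sphere hμ hQ t)

theorem aemeasurable_of_antitoneOn (hQ : 0 < H.Q) {φ : ℝ → ℝ≥0} (hφ : AntitoneOn φ (Ioi 0)) :
    AEMeasurable (fun x => (φ (N.r x) : ℝ≥0∞)) μ := by
  -- The profile is monotone only on the positive half-line, which carries the distribution of `r`
  -- because the identity is a null set.
  have h1 : AEMeasurable φ ((μ.map N.r).restrict (Ioi 0)) :=
    aemeasurable_restrict_of_antitoneOn measurableSet_Ioi hφ
  have h2 : (μ.map N.r).restrict (Ioi 0) = μ.map N.r := by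
    refine Measure.restrict_eq_self_of_ae_mem ?_
    exact (ae_map_iff N.measurable_r.aemeasurable measurableSet_Ioi).2 (N.ae_r_pos hμ hQ)
  rw [h2] at h1
  exact (h1.comp_measurable N.measurable_r).coe_nnreal_ennreal

/-- The pointwise bound behind the sufficiency of the conditions. -/
theorem exists_rieszPotential_le_of_le_conj {α : ℝ} (hα : 0 < α) (hαQ : α < H.Q) :
    ∃ C : ℝ≥0∞, C ≠ ⊤ ∧ ∀ (ν : Measure G) [SFinite ν] (f : G → ℝ≥0) (h : G → ℝ≥0∞),
      (∀ t, ν {x | N.r x = t} = 0) → N.IsRadiallyDecreasing f → Measurable h →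
      (∀ y, 0 < N.r y → (f y : ℝ≥0∞) ≤ 4 * ∫⁻ z in {z | N.r y < N.r z}, h z ∂ν) →
      ∀ x, 0 < N.r x → N.rieszPotential μ α f x ≤ C *
        (N.rpow (α - H.Q) x * (∫⁻ z in {z | N.r z < N.r x}, h z * N.rpow H.Q z ∂ν) +
          ∫⁻ z in {z | N.r x < N.r z}, h z * N.rpow α z ∂ν) := by
  have hQ : 0 < H.Q := hα.trans hαQ
  have : LocallyCompactSpace G := ChartedSpace.locallyCompactSpace E G
  obtain ⟨C, hC, hI⟩ := N.exists_rieszPotential_le hμ hα hαQ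
  obtain ⟨C₁, hC₁, hint⟩ := N.exists_setLIntegral_rpow_le hμ hα hαQ
  refine ⟨C * (4 + 4 * C₁), by finiteness, fun ν _ f h hν hf hh hfh x hx => ?_⟩
  obtain ⟨φ, hφ, hfφ⟩ := hf
  refine (hI f φ hφ hfφ x hx).trans ?_
  set ρ := N.r x with hρ
  have hlt : ∀ t, MeasurableSet {y | N.r y < t} := fun t =>
    measurableSet_lt N.measurable_r measurable_const
  have hge : ∀ t, MeasurableSet {y | t ≤ N.r y} := fun t =>
    measurableSet_le measurable_const N.measurable_r
  set P := ∫⁻ z in {z | N.r z < ρ}, h z * N.rpow H.Q z ∂ν with hP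
  set R := ∫⁻ z in {z | ρ < N.r z}, h z * N.rpow α z ∂ν with hR
  have hR' : ∫⁻ z in {z | ρ ≤ N.r z}, h z * N.rpow α z ∂ν = R := by
    refine setLIntegral_congr ?_
    have : ∀ᵐ z ∂ν, N.r z ≠ ρ := by rw [ae_iff]; simpa using hν ρ
    filter_upwards [this] with z hz
    exact propext ⟨fun h => lt_of_le_of_ne h (Ne.symm hz), fun h => le_of_lt h⟩
  have hswap : ∀ (A : Set G), MeasurableSet A → ∀ k : G → ℝ≥0∞, Measurable k →
      ∫⁻ y in A, f y * k y ∂μ ≤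
        4 * ∫⁻ z, h z * (∫⁻ y in {y | N.r y < N.r z}, k y ∂(μ.restrict A)) ∂ν := by
    intro A hA k hk
    rw [← setLIntegral_lintegral_lt_swap N.measurable_r hh hk A,
      ← lintegral_const_mul' _ _ (by norm_num)]
    refine setLIntegral_mono_ae' hA ?_
    filter_upwards [N.ae_r_pos hμ hQ] with y hy _
    calc (f y : ℝ≥0∞) * k y ≤ (4 * ∫⁻ z in {z | N.r y < N.r z}, h z ∂ν) * k y := by
          gcongr; exact hfh y hy
      _ = _ := by ring
  have hone : ∀ z, (∫⁻ y in {y | N.r y < N.r z}, 1 ∂(μ.restrict {y | N.r y < ρ})) =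
      μ ({y | N.r y < N.r z} ∩ {y | N.r y < ρ}) := fun z => by
    rw [setLIntegral_one, Measure.restrict_apply (hlt _)]
  have hfirst : N.rpow (α - H.Q) x * (∫⁻ y in {y | N.r y < ρ}, f y ∂μ) ≤
      4 * (N.rpow (α - H.Q) x * P + R) := by
    have h1 := hswap {y | N.r y < ρ} (hlt ρ) (fun _ => 1) measurable_const
    simp only [mul_one, hone] at h1
    -- The inner volume is `min(r(z), ρ) ^ Q`. For `r(z) ≥ ρ` the outer factor gives `ρ ^ (α - Q) ρ
    -- ^ Q = ρ ^ α ≤ r(z) ^ α`, so that part goes into `R`.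
    have h2 : ∫⁻ z, h z * μ ({y | N.r y < N.r z} ∩ {y | N.r y < ρ}) ∂ν ≤
        P + ∫⁻ z in {z | ρ ≤ N.r z}, h z * N.rpow H.Q x ∂ν := by
      rw [← lintegral_add_compl _ (hlt ρ)]
      have hcompl : {y | N.r y < ρ}ᶜ = {z | ρ ≤ N.r z} := by ext z; simp
      rw [hcompl]
      refine add_le_add (lintegral_mono fun z => ?_) (lintegral_mono fun z => ?_)
      · refine mul_le_mul' le_rfl ((measure_mono inter_subset_left).trans ?_)
        rw [N.measure_lt hμ hQ]; exact le_rfl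
      · refine mul_le_mul' le_rfl ((measure_mono inter_subset_right).trans ?_)
        rw [N.measure_lt hμ hQ]; exact le_rfl
    have hx0 : ENNReal.ofReal (N.r x) ≠ 0 := by simpa using hx
    have hxt : N.rpow (α - H.Q) x ≠ ⊤ :=
      ENNReal.rpow_ne_top_of_ne_zero hx0 ENNReal.ofReal_ne_top
    have h3 : N.rpow (α - H.Q) x * ∫⁻ z in {z | ρ ≤ N.r z}, h z * N.rpow H.Q x ∂ν ≤ R := by
      rw [← lintegral_const_mul' _ _ hxt, ← hR']
      refine setLIntegral_mono' (hge ρ) fun z (hz : ρ ≤ N.r z) => ?_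
      calc N.rpow (α - H.Q) x * (h z * N.rpow H.Q x)
          = h z * (N.rpow (α - H.Q) x * N.rpow H.Q x) := by ring
        _ = h z * N.rpow α x := by
            rw [rpow, rpow, rpow, ← ENNReal.rpow_add _ _ hx0 ENNReal.ofReal_ne_top, sub_add_cancel]
        _ ≤ h z * N.rpow α z := by
            rw [rpow, rpow]
            gcongr
    calc N.rpow (α - H.Q) x * (∫⁻ y in {y | N.r y < ρ}, f y ∂μ)
        ≤ N.rpow (α - H.Q) x *
          (4 * (P + ∫⁻ z in {z | ρ ≤ N.r z}, h z * N.rpow H.Q x ∂ν)) := by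
          gcongr
          exact h1.trans (mul_le_mul' le_rfl h2)
      _ = 4 * (N.rpow (α - H.Q) x * P +
          N.rpow (α - H.Q) x * ∫⁻ z in {z | ρ ≤ N.r z}, h z * N.rpow H.Q x ∂ν) := by ring
      _ ≤ _ := by gcongr
  -- After the exchange the inner domain `ρ ≤ r(y) < r(z)` is empty unless `r(z) > ρ`, and the
  -- kernel integrates to at most `C₁ r(z) ^ α`.
  have hsecond : ∫⁻ y in {y | ρ ≤ N.r y}, f y * N.rpow (α - H.Q) y ∂μ ≤ 4 * C₁ * R := by
    have h1 := hswap {y | ρ ≤ N.r y} (hge ρ) _ (N.measurable_rpow (α - H.Q))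
    refine h1.trans ?_
    rw [mul_assoc]
    refine mul_le_mul' le_rfl ?_
    rw [hR, ← lintegral_const_mul' _ _ hC₁,
      ← lintegral_indicator (measurableSet_lt measurable_const N.measurable_r)]
    refine lintegral_mono fun z => ?_
    rw [Measure.restrict_restrict (hlt _)]
    by_cases hz : ρ < N.r z
    · rw [indicator_of_mem (show z ∈ {z | ρ < N.r z} from hz), mul_left_comm]
      refine mul_le_mul' le_rfl ?_
      refine (lintegral_mono_set inter_subset_left).trans ?_
      exact hint _ (hx.trans hz)
    · have : {y | N.r y < N.r z} ∩ {y | ρ ≤ N.r y} = ∅ := by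
        ext y
        simp only [mem_inter_iff, mem_ofPred_eq, mem_empty_iff_false, iff_false, not_and, not_le]
        intro hy
        exact hy.trans_le (not_lt.1 hz)
      rw [this, Measure.restrict_empty, lintegral_zero_measure, mul_zero]
      exact zero_le
  calc C * (N.rpow (α - H.Q) x * (∫⁻ y in {y | N.r y < ρ}, f y ∂μ) +
        ∫⁻ y in {y | ρ ≤ N.r y}, f y * N.rpow (α - H.Q) y ∂μ)
      ≤ C * (4 * (N.rpow (α - H.Q) x * P + R) + 4 * C₁ * R) := by gcongr
    _ ≤ C * (4 * (N.rpow (α - H.Q) x * P + R) + 4 * C₁ * (N.rpow (α - H.Q) x * P + R)) := by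
        gcongr
        exact le_add_self
    _ = _ := by ring

end HomogeneousNorm

/-! ### Sufficiency -/

namespace HomogeneousNorm

open Topology Filter

variable {E G : Type*} [NormedAddCommGroup E] [NormedSpace ℝ E]
  [FiniteDimensional ℝ E] [TopologicalSpace G] [T2Space G] [SecondCountableTopology G]
  [ChartedSpace E G] [Group G]
  [LieGroup 𝓘(ℝ, E) ∞ G] {H : HomogeneousGroup E G} (N : HomogeneousNorm H)
  [MeasurableSpace G] [BorelSpace G] {μ : Measure G} [μ.IsHaarMeasure] (hμ : μ (N.ball 1 1) = 1)
  {α p q : ℝ} (hα : 0 < α) (hαQ : α < H.Q) (hp : 1 < p) (hpq : p ≤ q) {v w : G → ℝ}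
  (hv : IsWeight μ v) (hw : IsWeight μ w) (hw_loc : LocallyIntegrable w μ)

include hμ hα hαQ hp hpq hv hw hw_loc

/-- Replacing `f` by the conjugate average of its average `g` removes monotonicity from the problem:
both resulting operators act on `g` without constraint, and `h1`, `h2` are their Muckenhoupt
conditions. -/
theorem rieszBounded_of_hardy_conditions (hw_top : ∫⁻ x, ENNReal.ofReal (w x) ∂μ = ⊤)
    {B B' : ℝ≥0∞} (hB : B ≠ ⊤) (hB' : B' ≠ ⊤)
    (h1 : ∀ t, 0 < t → (∫⁻ x in N.ball 1 t, N.dualDensity μ p ((p / (p - 1)) * H.Q) w x ∂μ) ^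
            (1 / (p / (p - 1))) *
          (∫⁻ x in (N.ball 1 t)ᶜ, N.rpow ((α - H.Q) * q) x * ENNReal.ofReal (v x) ∂μ) ^
            (1 / q) ≤ B)
    (h2 : ∀ t, 0 < t → (∫⁻ x in N.ball 1 t, ENNReal.ofReal (v x) ∂μ) ^ (1 / q) *
          (∫⁻ x in (N.ball 1 t)ᶜ, N.dualDensity μ p (α * (p / (p - 1))) w x ∂μ) ^
            (1 / (p / (p - 1))) ≤ B') : N.RieszBounded μ α p q w v := by
  have hQ : 0 < H.Q := hα.trans hαQ
  have hp0 : 0 < p := by linarith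
  have hq0 : 0 < q := by linarith
  have hp' : 0 < p / (p - 1) := div_pos hp0 (by linarith)
  have : LocallyCompactSpace G := ChartedSpace.locallyCompactSpace E G
  set ν := weightMeasure μ w with hν
  set σ := weightMeasure μ v with hσ
  have hν0 : ∀ t, ν {x | N.r x = t} = 0 := N.weightMeasure_sphere hμ hQ
  have hσ0 : ∀ t, σ {x | N.r x = t} = 0 := N.weightMeasure_sphere hμ hQ
  have hW : ∀ t, N.W μ w t = ν {x | N.r x < t} := N.W_eq
  have hWt : ∀ t, N.W μ w t ≠ ⊤ := N.W_ne_top hw_loc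
  have hWm : Measurable fun x => N.W μ w (N.r x) := N.measurable_W_r
  have hνtop : ν univ = ⊤ := by
    rw [hν, weightMeasure_apply MeasurableSet.univ, Measure.restrict_univ, hw_top]
  have hνpos : ν {x | N.r x ≤ 0} = 0 := by
    rw [measure_le_eq_measure_lt (hν0 0)]
    convert measure_empty (μ := ν)
    ext x
    simpa using N.nonneg x
  have hball : ∀ t, MeasurableSet (N.ball 1 t) := N.measurableSet_ball_one
  have hcompl : ∀ t, (N.ball 1 t)ᶜ = {x | t ≤ N.r x} := fun t => by
    rw [N.ball_one_eq]; ext x; simp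
  have hempty : ∀ t, t ≤ 0 → {x | N.r x < t} = ∅ := fun t ht => by
    ext x; simpa using ht.trans (N.nonneg x)
  obtain ⟨C₁, hC₁, hI⟩ := N.exists_rieszPotential_le_of_le_conj hμ hα hαQ
  obtain ⟨C₂, hC₂, havg⟩ := exists_lintegral_average_le N.measurable_r hν0 hW hWt hp
  set k₁ : G → ℝ≥0∞ := fun x => N.rpow H.Q x * N.W μ w (N.r x) ^ (-1 : ℝ) with hk₁
  set k₂ : G → ℝ≥0∞ := fun x => N.rpow α x * N.W μ w (N.r x) ^ (-1 : ℝ) with hk₂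
  have hk₁m : Measurable k₁ := (N.measurable_rpow _).mul (hWm.pow_const _)
  have hk₂m : Measurable k₂ := (N.measurable_rpow _).mul (hWm.pow_const _)
  -- The outer factor `r ^ (α - Q)` of the first operator is absorbed into its target measure.
  set σ₁ := σ.withDensity (N.rpow ((α - H.Q) * q)) with hσ₁
  have hcond₁ : ∀ t, σ₁ {x | t ≤ N.r x} ^ (1 / q) *
      (∫⁻ x in {x | N.r x < t}, k₁ x ^ (p / (p - 1)) ∂ν) ^ (1 / (p / (p - 1))) ≤ B := by
    intro t
    rcases le_or_gt t 0 with ht | ht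
    · rw [hempty t ht, Measure.restrict_empty, lintegral_zero_measure,
        ENNReal.zero_rpow_of_pos (by positivity), mul_zero]
      exact zero_le
    · rw [← N.ball_one_eq, ← hcompl, hσ₁, withDensity_apply _ (hball t).compl,
        setLIntegral_weightMeasure hv (N.measurable_rpow _).aemeasurable (hball t).compl,
        N.setLIntegral_dualDensity hw hp (mul_comm (p / (p - 1)) H.Q) (hball t), mul_comm]
      exact h1 t ht
  have hcond₂ : ∀ t, σ {x | N.r x ≤ t} ^ (1 / q) *
      (∫⁻ x in {x | t < N.r x}, k₂ x ^ (p / (p - 1)) ∂ν) ^ (1 / (p / (p - 1))) ≤ B' := by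
    intro t
    rw [measure_le_eq_measure_lt (hσ0 t)]
    rcases le_or_gt t 0 with ht | ht
    · rw [hempty t ht, measure_empty, ENNReal.zero_rpow_of_pos (by positivity), zero_mul]
      exact zero_le
    · refine le_trans (mul_le_mul' ?_ (ENNReal.rpow_le_rpow ?_ (by positivity))) (h2 t ht)
      · rw [← N.ball_one_eq, hσ, weightMeasure_apply (hball t)]
      · rw [← N.setLIntegral_dualDensity hw hp rfl (hball t).compl, hcompl]
        exact lintegral_mono_set fun x (hx : t < N.r x) => hx.le
  refine ⟨(C₁ * (8 * B * C₂ + 8 * B' * C₂)).toNNReal, fun f hf hfin => ?_⟩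
  rw [ENNReal.coe_toNNReal (by finiteness)]
  have hf' := hf
  obtain ⟨φ, hφ, hfφ⟩ := hf
  have hfm : AEMeasurable (fun x => (f x : ℝ≥0∞)) μ := by
    simp_rw [hfφ]; exact N.aemeasurable_of_antitoneOn hμ hQ hφ
  have hfν : AEMeasurable (fun x => (f x : ℝ≥0∞)) ν := hfm.mono_ac weightMeasure_absolutelyContinuous
  have hnorm : weightedNorm μ p w (fun x => f x) = (∫⁻ x, (f x : ℝ≥0∞) ^ p ∂ν) ^ (1 / p) := by
    rw [weightedNorm, lintegral_weightMeasure hw (hfm.pow_const p)]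
  rw [hnorm] at hfin ⊢
  have hfp : ∫⁻ x, (f x : ℝ≥0∞) ^ p ∂ν ≠ ⊤ := fun h => by
    rw [h, ENNReal.top_rpow_of_pos (by positivity)] at hfin
    exact lt_irrefl _ hfin
  set g : G → ℝ≥0∞ := fun x =>
    N.W μ w (N.r x) ^ (-1 : ℝ) * ∫⁻ y in {y | N.r y < N.r x}, (f y : ℝ≥0∞) ∂ν with hg
  have hgm : Measurable g := by
    refine (hWm.pow_const _).mul ?_
    have hmono : Monotone fun t : ℝ => ∫⁻ y in {y | N.r y < t}, (f y : ℝ≥0∞) ∂ν := fun s t hst =>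
      lintegral_mono_set fun y (hy : N.r y < s) => hy.trans_le hst
    exact hmono.measurable.comp N.measurable_r
  have hgf : (∫⁻ x, g x ^ p ∂ν) ^ (1 / p) ≤ C₂ * (∫⁻ x, (f x : ℝ≥0∞) ^ p ∂ν) ^ (1 / p) :=
    havg _ hfν hfp
  have hgp : ∫⁻ x, g x ^ p ∂ν ≠ ⊤ := fun h => by
    rw [h, ENNReal.top_rpow_of_pos (by positivity), top_le_iff] at hgf
    exact ENNReal.mul_ne_top hC₂ hfin.ne hgf
  set h : G → ℝ≥0∞ := fun x => g x * N.W μ w (N.r x) ^ (-1 : ℝ) with hh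
  have hhm : Measurable h := hgm.mul (hWm.pow_const _)
  have hfh : ∀ y, 0 < N.r y → (f y : ℝ≥0∞) ≤ 4 * ∫⁻ z in {z | N.r y < N.r z}, h z ∂ν := by
    intro y hy
    have := decreasing_le_conj_average N.measurable_r hν0 hW hWt hνtop hνpos
      (φ := fun t => (φ t : ℝ≥0∞)) (fun s hs t ht hst => ENNReal.coe_le_coe.2 (hφ hs ht hst)) hy
      (N.W_ne_zero hμ hw hy)
    simp only [← hfφ] at this
    exact this
  set P : G → ℝ≥0∞ := fun x => ∫⁻ z in {z | N.r z < N.r x}, g z * k₁ z ∂ν with hP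
  set R : G → ℝ≥0∞ := fun x => ∫⁻ z in {z | N.r x < N.r z}, g z * k₂ z ∂ν with hR
  have hPm : Measurable P := by
    have hmono : Monotone fun t : ℝ => ∫⁻ z in {z | N.r z < t}, g z * k₁ z ∂ν := fun s t hst =>
      lintegral_mono_set fun y (hy : N.r y < s) => hy.trans_le hst
    exact hmono.measurable.comp N.measurable_r
  have hRm : Measurable R := by
    have hanti : Antitone fun t : ℝ => ∫⁻ z in {z | t < N.r z}, g z * k₂ z ∂ν := fun s t hst =>
      lintegral_mono_set fun y (hy : t < N.r y) => hst.trans_lt hy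
    exact hanti.measurable.comp N.measurable_r
  have hpt : ∀ x, 0 < N.r x →
      N.rieszPotential μ α f x ≤ C₁ * (N.rpow (α - H.Q) x * P x + R x) := by
    intro x hx
    refine (hI ν f h hν0 hf' hhm hfh x hx).trans (le_of_eq ?_)
    simp only [hh, hP, hR, hk₁, hk₂, mul_assoc, mul_comm (N.W μ w _ ^ (-1 : ℝ))]
  have hsum_m : Measurable fun x => N.rpow (α - H.Q) x * P x := (N.measurable_rpow _).mul hPm
  have hP_norm : (∫⁻ x, (N.rpow (α - H.Q) x * P x) ^ q ∂σ) ^ (1 / q) ≤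
      8 * B * (∫⁻ x, g x ^ p ∂ν) ^ (1 / p) := by
    have h := lintegral_hardy (σ := σ₁) N.measurable_r hν0 hp hpq hk₁m.aemeasurable hgm.aemeasurable
      hB hgp hcond₁
    refine le_trans (le_of_eq ?_) h
    rw [hσ₁, lintegral_withDensity_eq_lintegral_mul _ (N.measurable_rpow _) (hPm.pow_const q)]
    congr 1
    refine lintegral_congr fun x => ?_
    rw [Pi.mul_apply, ENNReal.mul_rpow_of_nonneg _ _ hq0.le, rpow, rpow, ← ENNReal.rpow_mul]
  have hR_norm : (∫⁻ x, R x ^ q ∂σ) ^ (1 / q) ≤ 8 * B' * (∫⁻ x, g x ^ p ∂ν) ^ (1 / p) :=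
    lintegral_hardy_conj N.measurable_r hν0 hp hpq hk₂m.aemeasurable hgm.aemeasurable hB' hgp hcond₂
  calc weightedNorm μ q v (N.rieszPotential μ α f)
      ≤ (∫⁻ x, (C₁ * (N.rpow (α - H.Q) x * P x + R x)) ^ q ∂σ) ^ (1 / q) := by
        have hm : Measurable fun x => (C₁ * (N.rpow (α - H.Q) x * P x + R x)) ^ q :=
          ((hsum_m.add hRm).const_mul C₁).pow_const q
        rw [weightedNorm, lintegral_weightMeasure hv hm.aemeasurable]
        refine ENNReal.rpow_le_rpow (lintegral_mono_ae ?_) (by positivity)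
        filter_upwards [N.ae_r_pos hμ hQ] with x hx
        gcongr
        exact hpt x hx
    _ = C₁ * (∫⁻ x, (N.rpow (α - H.Q) x * P x + R x) ^ q ∂σ) ^ (1 / q) := by
        simp_rw [ENNReal.mul_rpow_of_nonneg _ _ hq0.le]
        rw [lintegral_const_mul' _ _ (by finiteness), ENNReal.mul_rpow_of_nonneg _ _ (by positivity),
          ← ENNReal.rpow_mul, mul_one_div_cancel hq0.ne', ENNReal.rpow_one]
    _ ≤ C₁ * (8 * B * (∫⁻ x, g x ^ p ∂ν) ^ (1 / p) + 8 * B' * (∫⁻ x, g x ^ p ∂ν) ^ (1 / p)) := by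
        gcongr
        exact (ENNReal.lintegral_Lp_add_le hsum_m.aemeasurable hRm.aemeasurable
          (by linarith)).trans (add_le_add hP_norm hR_norm)
    _ ≤ C₁ * (8 * B * (C₂ * (∫⁻ x, (f x : ℝ≥0∞) ^ p ∂ν) ^ (1 / p)) +
          8 * B' * (C₂ * (∫⁻ x, (f x : ℝ≥0∞) ^ p ∂ν) ^ (1 / p))) := by gcongr
    _ = C₁ * (8 * B * C₂ + 8 * B' * C₂) * (∫⁻ x, (f x : ℝ≥0∞) ^ p ∂ν) ^ (1 / p) := by ring

end HomogeneousNorm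

/-! ### Necessity -/

theorem ENNReal.rpow_mul_le_of_mul_le_mul_rpow {p : ℝ} (hp : 1 < p) {A V B : ℝ≥0∞} (hA : A ≠ ⊤)
    (h : A * V ≤ B * A ^ (1 / p)) : A ^ (1 / (p / (p - 1))) * V ≤ B := by
  have hp' : 0 < 1 / (p / (p - 1)) := by
    have : 0 < p - 1 := by linarith
    positivity
  rcases eq_or_ne A 0 with h0 | h0
  · rw [h0, ENNReal.zero_rpow_of_pos hp', zero_mul]; exact zero_le
  · have hA1 : A ^ (1 / p) ≠ 0 := (ENNReal.rpow_pos (pos_iff_ne_zero.2 h0) hA).ne'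
    have hA2 : A ^ (1 / p) ≠ ⊤ := ENNReal.rpow_ne_top_of_nonneg (by positivity) hA
    -- Division by `A ^ (1 / p)`, legitimate because `A` is finite and nonzero, leaves the exponent
    -- `1 - 1 / p = 1 / p'`.
    refine (ENNReal.mul_le_mul_iff_left hA1 hA2).1 (le_trans (le_of_eq ?_) h)
    have : A ^ (1 / (p / (p - 1))) * A ^ (1 / p) = A := by
      rw [← ENNReal.rpow_add _ _ h0 hA]
      have : 1 / (p / (p - 1)) + 1 / p = 1 := by field_simp; ring
      rw [this, ENNReal.rpow_one]
    rw [mul_right_comm, this]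

/-- Passes from truncated test integrals, known to be finite, to the full ones. -/
theorem ENNReal.iSup_rpow_mul_le {ι : Type*} {A : ι → ℝ≥0∞} {V B : ℝ≥0∞} {s : ℝ} (hs : 0 < s)
    (hB : B ≠ ⊤) (h : ∀ i, A i ^ s * V ≤ B) : (⨆ i, A i) ^ s * V ≤ B := by
  rcases eq_or_ne V 0 with h0 | h0
  · rw [h0, mul_zero]; exact zero_le
  · rw [← ENNReal.le_div_iff_mul_le (Or.inl h0) (Or.inr hB), ← ENNReal.le_rpow_inv_iff hs]
    refine iSup_le fun i => ?_
    rw [ENNReal.le_rpow_inv_iff hs, ENNReal.le_div_iff_mul_le (Or.inl h0) (Or.inr hB)]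
    exact h i

namespace HomogeneousNorm

open Topology Filter

theorem mul_rpow_lintegral_le_weightedNorm {G : Type*} [MeasurableSpace G] {μ : Measure G}
    {q : ℝ} (hq : 0 < q) {v : G → ℝ} {F b : G → ℝ≥0∞}
    {A C : ℝ≥0∞} (hA : A ≠ ⊤) (hC : C ≠ ⊤) {D : Set G} (hD : MeasurableSet D)
    (h : ∀ᵐ x ∂μ, x ∈ D → b x * A ≤ C * F x) :
    A * (∫⁻ x in D, b x ^ q * ENNReal.ofReal (v x) ∂μ) ^ (1 / q) ≤ C * weightedNorm μ q v F := by
  have key : A ^ q * (∫⁻ x in D, b x ^ q * ENNReal.ofReal (v x) ∂μ) ≤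
      C ^ q * ∫⁻ x, F x ^ q * ENNReal.ofReal (v x) ∂μ := by
    rw [← lintegral_const_mul' _ _ (ENNReal.rpow_ne_top_of_nonneg hq.le hA),
      ← lintegral_const_mul' _ _ (ENNReal.rpow_ne_top_of_nonneg hq.le hC)]
    refine (setLIntegral_mono_ae' hD ?_).trans (setLIntegral_le_lintegral D _)
    filter_upwards [h] with x hx hxD
    rw [← mul_assoc, ← mul_assoc, ← ENNReal.mul_rpow_of_nonneg _ _ hq.le,
      ← ENNReal.mul_rpow_of_nonneg _ _ hq.le, mul_comm A]
    exact mul_le_mul' (ENNReal.rpow_le_rpow (hx hxD) hq.le) le_rfl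
  have := ENNReal.rpow_le_rpow key (show 0 ≤ 1 / q by positivity)
  rw [ENNReal.mul_rpow_of_nonneg _ _ (by positivity), ENNReal.mul_rpow_of_nonneg _ _ (by positivity),
    ← ENNReal.rpow_mul, ← ENNReal.rpow_mul, mul_one_div_cancel hq.ne', ENNReal.rpow_one,
    ENNReal.rpow_one] at this
  exact this

variable {E G : Type*} [NormedAddCommGroup E] [NormedSpace ℝ E]
  [FiniteDimensional ℝ E] [TopologicalSpace G]
  [ChartedSpace E G] [Group G]
  [LieGroup 𝓘(ℝ, E) ∞ G] {H : HomogeneousGroup E G} (N : HomogeneousNorm H)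
  [MeasurableSpace G] [BorelSpace G] {μ : Measure G} {α p q : ℝ} (hα : 0 < α) (hαQ : α < H.Q) {v w : G → ℝ}

include hα hαQ in
/-- A lower bound for the Riesz potential by an integral over a ball. -/
theorem exists_le_rieszPotential : ∃ C : ℝ≥0∞, C ≠ ⊤ ∧ ∀ (f : G → ℝ≥0) (x : G) (t : ℝ),
    0 < N.r x → t ≤ N.r x → N.rpow (α - H.Q) x * (∫⁻ y in {y | N.r y < t}, f y ∂μ) ≤
      C * N.rieszPotential μ α f x := by
  have hQ : 0 < H.Q := hα.trans hαQ
  have hs0 : 0 ≤ H.Q - α := by linarith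
  have hns : α - H.Q = -(H.Q - α) := by ring
  obtain ⟨C, hC, h⟩ := N.exists_le_kernel hs0
  rw [hns]
  refine ⟨2 ^ (H.Q - α) * C, by finiteness, fun f x t hx ht => ?_⟩
  have hxt : N.rpow (-(H.Q - α)) x ≠ ⊤ :=
    ENNReal.rpow_ne_top_of_ne_zero (by simpa using hx) ENNReal.ofReal_ne_top
  rw [rieszPotential, hns, ← lintegral_const_mul' _ _ hxt, ← lintegral_const_mul' _ _ (by finiteness)]
  refine (setLIntegral_mono' (measurableSet_lt N.measurable_r measurable_const)
    fun y (hy : N.r y < t) => ?_).trans (setLIntegral_le_lintegral _ _)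
  -- Here `r(y) < t ≤ r(x)`, so `r(x) + r(y) ≤ 2 r(x)`.
  have h1 : N.rpow (-(H.Q - α)) x ≤ 2 ^ (H.Q - α) * ENNReal.ofReal (N.r x + N.r y) ^ (-(H.Q - α)) := by
    refine ENNReal.rpow_neg_le_mul_rpow_neg hs0 two_ne_zero (by simp) ?_
    rw [show (2 : ℝ≥0∞) = ENNReal.ofReal 2 by simp, ← ENNReal.ofReal_mul (by norm_num)]
    refine ENNReal.ofReal_le_ofReal ?_
    linarith
  calc N.rpow (-(H.Q - α)) x * f y
      ≤ (2 ^ (H.Q - α) * (C * N.rpow (-(H.Q - α)) (x * y⁻¹))) * f y := by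
        gcongr
        exact h1.trans (mul_le_mul' le_rfl (h x y))
    _ = _ := by ring

variable [T2Space G] [SecondCountableTopology G] [μ.IsHaarMeasure] (hμ : μ (N.ball 1 1) = 1)

include hμ

/-- Test functions for the necessity of the Hardy conditions. -/
theorem exists_test_functions (hQ : 0 < H.Q) (hp : 1 < p) (hw : IsWeight μ w)
    (hw_loc : LocallyIntegrable w μ) : ∃ C : ℝ≥0∞, C ≠ ⊤ ∧ ∀ a ε T : ℝ, 0 < ε →
    (∫⁻ x in {x | ε ≤ N.r x ∧ N.r x < T}, N.dualDensity μ p (a * (p / (p - 1))) w x ∂μ) ≠ ⊤ ∧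
    ∃ (h : G → ℝ≥0∞) (f : G → ℝ≥0), Measurable h ∧ N.IsRadiallyDecreasing f ∧
      (∀ x, (f x : ℝ≥0∞) = ∫⁻ z in {z | N.r x < N.r z}, h z ∂(weightMeasure μ w)) ∧
      (∫⁻ x in {x | ε ≤ N.r x ∧ N.r x < T}, N.dualDensity μ p (a * (p / (p - 1))) w x ∂μ) =
        ∫⁻ x in {x | ε ≤ N.r x ∧ N.r x < T}, h x * N.rpow a x ∂(weightMeasure μ w) ∧
      weightedNorm μ p w (fun x => f x) ≤ C *
        (∫⁻ x in {x | ε ≤ N.r x ∧ N.r x < T},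
          N.dualDensity μ p (a * (p / (p - 1))) w x ∂μ) ^ (1 / p) := by
  have hp0 : 0 < p := by linarith
  have hp1 : p - 1 ≠ 0 := by linarith
  set p' := p / (p - 1) with hp'
  have hp'1 : p' - 1 = 1 / (p - 1) := by rw [hp']; field_simp; ring
  have hp'0 : 0 < p' - 1 := by rw [hp'1]; have : 0 < p - 1 := by linarith
                               positivity
  have hpp : (p' - 1) * p = p' := by rw [hp'1, hp']; ring
  set ν := weightMeasure μ w with hν
  have hν0 : ∀ t, ν {x | N.r x = t} = 0 := N.weightMeasure_sphere hμ hQ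
  have hW : ∀ t, N.W μ w t = ν {x | N.r x < t} := N.W_eq
  have hWt : ∀ t, N.W μ w t ≠ ⊤ := N.W_ne_top hw_loc
  have hWm : Measurable fun x => N.W μ w (N.r x) := N.measurable_W_r
  have hWmono : Monotone (N.W μ w) := monotone_of_eq_measure_lt hW
  obtain ⟨C, hC, hconj⟩ := exists_lintegral_conj_average_le N.measurable_r hν0 hW hWt hp
  refine ⟨C, hC, fun a ε T hε => ?_⟩
  -- Staying away from the identity and from infinity keeps `A` and `f` finite.
  set S := {x | ε ≤ N.r x ∧ N.r x < T} with hS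
  have hSm : MeasurableSet S := (measurableSet_le measurable_const N.measurable_r).inter
    (measurableSet_lt N.measurable_r measurable_const)
  have hr0 : ∀ x ∈ S, ENNReal.ofReal (N.r x) ≠ 0 := fun x hx => by
    simpa using hε.trans_le hx.1
  have hWε : N.W μ w ε ≠ 0 := N.W_ne_zero hμ hw hε
  have hbound : ∀ b : ℝ, ∫⁻ x in S, N.rpow b x * N.W μ w (N.r x) ^ (-p') ∂ν ≠ ⊤ := by
    intro b
    obtain ⟨K, hK, hKb⟩ : ∃ K : ℝ≥0∞, K ≠ ⊤ ∧ ∀ x ∈ S, N.rpow b x ≤ K := by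
      rcases le_total 0 b with hb | hb
      · refine ⟨ENNReal.ofReal T ^ b, by finiteness, fun x hx => ?_⟩
        exact ENNReal.rpow_le_rpow (ENNReal.ofReal_le_ofReal hx.2.le) hb
      · refine ⟨ENNReal.ofReal ε ^ b,
          ENNReal.rpow_ne_top_of_ne_zero (by simpa using hε) ENNReal.ofReal_ne_top, fun x hx => ?_⟩
        rw [rpow, ← neg_neg b, ENNReal.rpow_neg, ENNReal.rpow_neg _ (-b)]
        refine ENNReal.inv_le_inv.2 (ENNReal.rpow_le_rpow (ENNReal.ofReal_le_ofReal hx.1) ?_)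
        linarith
    have h1 : ∫⁻ x in S, N.rpow b x * N.W μ w (N.r x) ^ (-p') ∂ν ≤
        ∫⁻ x in S, K * N.W μ w ε ^ (-p') ∂ν := by
      refine setLIntegral_mono' hSm fun x hx => mul_le_mul' (hKb x hx) ?_
      rw [ENNReal.rpow_neg, ENNReal.rpow_neg]
      refine ENNReal.inv_le_inv.2 (ENNReal.rpow_le_rpow (hWmono hx.1) (by linarith))
    have h2 : ν S ≠ ⊤ := by
      refine ne_top_of_le_ne_top (hWt T) ?_
      rw [hW]
      exact measure_mono fun x hx => hx.2
    rw [setLIntegral_const] at h1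
    exact ne_top_of_le_ne_top (ENNReal.mul_ne_top (ENNReal.mul_ne_top hK
      (ENNReal.rpow_ne_top_of_ne_zero hWε (hWt ε))) h2) h1
  set A := ∫⁻ x in S, N.dualDensity μ p (a * p') w x ∂μ with hA
  have hAeq : A = ∫⁻ x in S, N.rpow (a * p') x * N.W μ w (N.r x) ^ (-p') ∂ν := by
    have hm : Measurable fun x => N.rpow (a * p') x * N.W μ w (N.r x) ^ (-p') :=
      (N.measurable_rpow _).mul (hWm.pow_const _)
    rw [hν, setLIntegral_weightMeasure hw hm.aemeasurable hSm]
    rfl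
  have hAt : A ≠ ⊤ := hAeq ▸ hbound _
  refine ⟨hAt, ?_⟩
  -- The extremal in Hölder's inequality for the kernel `r ^ a / W`: since `(p' - 1) p = p'`, both
  -- `g ^ p` and `h r ^ a`, with `h = g / W`, equal `r ^ (a p') W ^ (-p')` on `S`.
  set g : G → ℝ≥0∞ := S.indicator fun x =>
    N.rpow (a * (p' - 1)) x * N.W μ w (N.r x) ^ (1 - p') with hg
  have hgm : Measurable g :=
    ((N.measurable_rpow _).mul (hWm.pow_const _)).indicator hSm
  set h : G → ℝ≥0∞ := fun x => g x * N.W μ w (N.r x) ^ (-1 : ℝ) with hh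
  have hhm : Measurable h := hgm.mul (hWm.pow_const _)
  have hhS : ∀ x ∈ S, h x = N.rpow (a * (p' - 1)) x * N.W μ w (N.r x) ^ (-p') := by
    intro x hx
    have hWx : N.W μ w (N.r x) ≠ 0 := N.W_ne_zero hμ hw (hε.trans_le hx.1)
    simp only [hh, hg]
    rw [indicator_of_mem hx, mul_assoc, ← ENNReal.rpow_add _ _ hWx (hWt _)]
    congr 2
    ring
  have hhSc : ∀ x ∉ S, h x = 0 := fun x hx => by
    simp only [hh, hg]
    rw [indicator_of_notMem hx, zero_mul]
  have hhint : ∫⁻ x, h x ∂ν ≠ ⊤ := by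
    rw [← lintegral_add_compl _ hSm, setLIntegral_congr_fun hSm hhS,
      setLIntegral_congr_fun hSm.compl hhSc, lintegral_zero, add_zero]
    exact hbound _
  have hgp : ∫⁻ x, g x ^ p ∂ν = A := by
    have e1 : ∀ x, g x ^ p = S.indicator (fun x => N.rpow (a * p') x * N.W μ w (N.r x) ^ (-p')) x := by
      intro x
      by_cases hx : x ∈ S
      · simp only [hg]
        rw [indicator_of_mem hx, indicator_of_mem hx, ENNReal.mul_rpow_of_nonneg _ _ hp0.le, rpow,
          rpow, ← ENNReal.rpow_mul, ← ENNReal.rpow_mul, mul_assoc, hpp,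
          show (1 - p') * p = -p' by linarith]
      · simp only [hg]
        rw [indicator_of_notMem hx, indicator_of_notMem hx, ENNReal.zero_rpow_of_pos hp0]
    simp_rw [e1]
    rw [lintegral_indicator hSm, hAeq]
  set φ : ℝ → ℝ≥0 := fun t => (∫⁻ z in {z | t < N.r z}, h z ∂ν).toNNReal with hφ
  have hφt : ∀ t, ∫⁻ z in {z | t < N.r z}, h z ∂ν ≠ ⊤ := fun t =>
    ne_top_of_le_ne_top hhint (setLIntegral_le_lintegral _ _)
  have hφe : ∀ t, (φ t : ℝ≥0∞) = ∫⁻ z in {z | t < N.r z}, h z ∂ν := fun t =>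
    ENNReal.coe_toNNReal (hφt t)
  have hφa : Antitone φ := fun s t hst => by
    rw [← ENNReal.coe_le_coe, hφe, hφe]
    exact lintegral_mono_set fun z (hz : t < N.r z) => hst.trans_lt hz
  refine ⟨h, fun x => φ (N.r x), hhm, ⟨φ, hφa.antitoneOn _, fun x => rfl⟩, fun x => hφe _, ?_, ?_⟩
  · rw [hAeq]
    refine setLIntegral_congr_fun hSm fun x hx => ?_
    rw [hhS x hx, mul_right_comm, rpow, rpow, rpow, ← ENNReal.rpow_add _ _ (hr0 x hx)
      ENNReal.ofReal_ne_top]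
    congr 2
    ring
  · have hm : Measurable fun x => (φ (N.r x) : ℝ≥0∞) ^ p :=
      ((hφa.measurable.comp N.measurable_r).coe_nnreal_ennreal).pow_const p
    rw [weightedNorm, ← lintegral_weightMeasure hw hm.aemeasurable]
    have := hconj g hgm.aemeasurable (by rw [hgp]; exact hAt)
    rw [hgp] at this
    simp_rw [hφe]
    exact this

include hα hαQ

/-- Tested on the indicator of the ball, whose potential inside it is at least a constant times `r ^
(α - Q) |B(e, r)| = r ^ α`. -/
theorem exists_local_bound_of_rieszBounded (hp : 1 < p) (hpq : p ≤ q) (hw : IsWeight μ w)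
    (hw_loc : LocallyIntegrable w μ) (hb : N.RieszBounded μ α p q w v) :
    ∃ B : ℝ≥0∞, B ≠ ⊤ ∧ ∀ t, 0 < t →
      (∫⁻ x in N.ball 1 t, ENNReal.ofReal (w x) ∂μ) ^ (-(1 / p)) *
        (∫⁻ x in N.ball 1 t, N.rpow (α * q) x * ENNReal.ofReal (v x) ∂μ) ^ (1 / q) ≤ B := by
  have hQ : 0 < H.Q := hα.trans hαQ
  have hp0 : 0 < p := by linarith
  have hq0 : 0 < q := by linarith
  obtain ⟨C, hC⟩ := hb
  obtain ⟨C₁, hC₁, hle⟩ := N.exists_le_rieszPotential (μ := μ) hα hαQ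
  refine ⟨C₁ * C, by finiteness, fun t ht => ?_⟩
  set φ : ℝ → ℝ≥0 := fun s => if s < t then 1 else 0 with hφ
  have hφa : Antitone φ := by
    intro s s' hss'
    simp only [hφ]
    split_ifs with h1 h2
    · exact le_rfl
    · exact absurd (hss'.trans_lt h1) h2
    · exact zero_le_one
    · exact le_rfl
  have hWt : N.W μ w t ≠ ⊤ := N.W_ne_top hw_loc t
  have hW0 : N.W μ w t ≠ 0 := N.W_ne_zero hμ hw ht
  have hnorm : weightedNorm μ p w (fun x => φ (N.r x)) = N.W μ w t ^ (1 / p) := by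
    rw [weightedNorm, W, ← lintegral_indicator (N.measurableSet_ball_one t)]
    congr 1
    refine lintegral_congr fun x => ?_
    by_cases hx : N.r x < t
    · rw [indicator_of_mem (N.mem_ball_one.2 hx)]
      simp [hφ, hx]
    · rw [indicator_of_notMem (fun h => hx (N.mem_ball_one.1 h))]
      simp [hφ, hx, hp0]
  have hbd := hC (fun x => φ (N.r x)) ⟨φ, hφa.antitoneOn _, fun x => rfl⟩
    (by rw [hnorm]; exact ENNReal.rpow_lt_top_of_nonneg (by positivity) hWt)
  rw [hnorm] at hbd
  have hlow := mul_rpow_lintegral_le_weightedNorm (μ := μ) (v := v) hq0 (A := 1) (C := C₁) (b := N.rpow α)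
    (F := N.rieszPotential μ α fun x => φ (N.r x)) (by simp) hC₁ (N.measurableSet_ball_one t) (by
      filter_upwards [N.ae_r_pos hμ hQ] with x hx hxt
      rw [mem_ball_one] at hxt
      rw [mul_one]
      refine le_trans (le_of_eq ?_) (hle _ x _ hx le_rfl)
      have : ∫⁻ y in {y | N.r y < N.r x}, (φ (N.r y) : ℝ≥0∞) ∂μ = μ {y | N.r y < N.r x} := by
        rw [← setLIntegral_one]
        refine setLIntegral_congr_fun (measurableSet_lt N.measurable_r measurable_const) ?_
        intro y (hy : N.r y < N.r x)
        simp [hφ, hy.trans hxt]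
      rw [this, N.measure_lt hμ hQ, rpow, rpow, ← ENNReal.rpow_add _ _ (by simpa using hx)
        ENNReal.ofReal_ne_top, sub_add_cancel])
  rw [one_mul] at hlow
  have e1 : ∀ x, N.rpow α x ^ q = N.rpow (α * q) x := fun x => by
    rw [rpow, rpow, ← ENNReal.rpow_mul]
  simp_rw [e1] at hlow
  change N.W μ w t ^ (-(1 / p)) * _ ≤ _
  calc N.W μ w t ^ (-(1 / p)) *
        (∫⁻ x in N.ball 1 t, N.rpow (α * q) x * ENNReal.ofReal (v x) ∂μ) ^ (1 / q)
      ≤ N.W μ w t ^ (-(1 / p)) * (C₁ * (C * N.W μ w t ^ (1 / p))) := by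
        gcongr
        exact hlow.trans (mul_le_mul' le_rfl hbd)
    _ = C₁ * C * (N.W μ w t ^ (-(1 / p)) * N.W μ w t ^ (1 / p)) := by ring
    _ = C₁ * C := by
        rw [← ENNReal.rpow_add _ _ hW0 hWt, neg_add_cancel, ENNReal.rpow_zero, mul_one]

/-- Tested with `a = Q`. By Tonelli `∫_{r < t} f dx` dominates `∫_S h r ^ Q dν = A`, so outside the
ball the potential is at least a constant times `A r ^ (α - Q)`, while the norm of `f` is at most a
constant times `A ^ (1 / p)`. -/
theorem exists_hardy_bound_of_rieszBounded (hp : 1 < p) (hpq : p ≤ q) (hw : IsWeight μ w)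
    (hw_loc : LocallyIntegrable w μ) (hb : N.RieszBounded μ α p q w v) :
    ∃ B : ℝ≥0∞, B ≠ ⊤ ∧ ∀ t, 0 < t →
      (∫⁻ x in N.ball 1 t, N.dualDensity μ p ((p / (p - 1)) * H.Q) w x ∂μ) ^ (1 / (p / (p - 1))) *
        (∫⁻ x in (N.ball 1 t)ᶜ, N.rpow ((α - H.Q) * q) x * ENNReal.ofReal (v x) ∂μ) ^ (1 / q) ≤
          B := by
  have hQ : 0 < H.Q := hα.trans hαQ
  have hp0 : 0 < p := by linarith
  have hq0 : 0 < q := by linarith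
  have hp' : 0 < p / (p - 1) := div_pos hp0 (by linarith)
  have : LocallyCompactSpace G := ChartedSpace.locallyCompactSpace E G
  obtain ⟨C, hC⟩ := hb
  obtain ⟨C₁, hC₁, hle⟩ := N.exists_le_rieszPotential (μ := μ) hα hαQ
  obtain ⟨C₂, hC₂, htest⟩ := N.exists_test_functions hμ hQ hp hw hw_loc
  refine ⟨C₁ * C * C₂, by finiteness, fun t ht => ?_⟩
  rw [mul_comm (p / (p - 1)) H.Q]
  have hstep : ∀ n : ℕ, (∫⁻ x in {x | 1 / ((n : ℝ) + 1) ≤ N.r x ∧ N.r x < t},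
      N.dualDensity μ p (H.Q * (p / (p - 1))) w x ∂μ) ^ (1 / (p / (p - 1))) *
        (∫⁻ x in (N.ball 1 t)ᶜ, N.rpow ((α - H.Q) * q) x * ENNReal.ofReal (v x) ∂μ) ^ (1 / q) ≤
          C₁ * C * C₂ := by
    intro n
    obtain ⟨hAt, h, f, hhm, hf, hfh, hAh, hfn⟩ := htest H.Q (1 / ((n : ℝ) + 1)) t (by positivity)
    set S := {x | 1 / ((n : ℝ) + 1) ≤ N.r x ∧ N.r x < t} with hS
    set A := ∫⁻ x in S, N.dualDensity μ p (H.Q * (p / (p - 1))) w x ∂μ with hA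
    have hlt : ∀ t, MeasurableSet {y | N.r y < t} := fun t =>
      measurableSet_lt N.measurable_r measurable_const
    refine ENNReal.rpow_mul_le_of_mul_le_mul_rpow hp hAt ?_
    have hAf : A ≤ ∫⁻ y in {y | N.r y < t}, f y ∂μ := by
      have h1 := setLIntegral_lintegral_lt_swap (μ := μ) (ν := weightMeasure μ w) N.measurable_r hhm
        (measurable_const (a := (1 : ℝ≥0∞))) {y | N.r y < t}
      simp only [one_mul] at h1
      simp_rw [hfh]
      rw [h1, hAh]
      refine (setLIntegral_mono' ((measurableSet_le measurable_const N.measurable_r).inter (hlt t))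
        fun z hz => ?_).trans (setLIntegral_le_lintegral S _)
      refine mul_le_mul' le_rfl ?_
      rw [setLIntegral_one, Measure.restrict_apply (hlt _), rpow, ← N.measure_lt hμ hQ]
      exact measure_mono fun y (hy : N.r y < N.r z) => ⟨hy, hy.trans hz.2⟩
    have hbd := hC f hf (hfn.trans_lt (by finiteness))
    have hlow := mul_rpow_lintegral_le_weightedNorm (μ := μ) (v := v) hq0 (A := A) (C := C₁)
      (b := N.rpow (α - H.Q)) (F := N.rieszPotential μ α f) hAt hC₁
      (N.measurableSet_ball_one t).compl (Eventually.of_forall fun x hx => by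
        have hx' : t ≤ N.r x := not_lt.1 fun h => hx (N.mem_ball_one.2 h)
        exact (mul_le_mul' le_rfl hAf).trans (hle f x t (ht.trans_le hx') hx'))
    have e1 : ∀ x, N.rpow (α - H.Q) x ^ q = N.rpow ((α - H.Q) * q) x := fun x => by
      rw [rpow, rpow, ← ENNReal.rpow_mul]
    simp_rw [e1] at hlow
    calc _ ≤ C₁ * (C * (C₂ * A ^ (1 / p))) :=
          hlow.trans (mul_le_mul' le_rfl (hbd.trans (mul_le_mul' le_rfl hfn)))
      _ = _ := by ring
  have hsup : ∫⁻ x in N.ball 1 t, N.dualDensity μ p (H.Q * (p / (p - 1))) w x ∂μ =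
      ⨆ n : ℕ, ∫⁻ x in {x | 1 / ((n : ℝ) + 1) ≤ N.r x ∧ N.r x < t},
        N.dualDensity μ p (H.Q * (p / (p - 1))) w x ∂μ := by
    have hmono : Monotone fun n : ℕ => {x | 1 / ((n : ℝ) + 1) ≤ N.r x ∧ N.r x < t} :=
      fun m n hmn x hx => ⟨(Nat.one_div_le_one_div hmn).trans hx.1, hx.2⟩
    rw [← setLIntegral_iUnion_of_directed _ hmono.directed_le]
    refine setLIntegral_congr ?_
    -- The truncations exhaust the ball up to the identity, a null set.
    filter_upwards [N.ae_r_pos hμ hQ] with x hx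
    refine propext ⟨fun h => ?_, fun h => ?_⟩
    · obtain ⟨n, hn⟩ := exists_nat_one_div_lt hx
      exact mem_iUnion.2 ⟨n, hn.le, N.mem_ball_one.1 h⟩
    · obtain ⟨n, hn⟩ := mem_iUnion.1 h
      exact N.mem_ball_one.2 hn.2
  rw [hsup]
  exact ENNReal.iSup_rpow_mul_le (by positivity) (by finiteness) hstep

/-- Tested with `a = α` outside the ball, where Tonelli shows that the potential is at least a
constant times `A` throughout the ball. -/
theorem exists_conj_hardy_bound_of_rieszBounded (hp : 1 < p) (hpq : p ≤ q) (hw : IsWeight μ w)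
    (hw_loc : LocallyIntegrable w μ) (hb : N.RieszBounded μ α p q w v) :
    ∃ B : ℝ≥0∞, B ≠ ⊤ ∧ ∀ t, 0 < t →
      (∫⁻ x in N.ball 1 t, ENNReal.ofReal (v x) ∂μ) ^ (1 / q) *
        (∫⁻ x in (N.ball 1 t)ᶜ, N.dualDensity μ p (α * (p / (p - 1))) w x ∂μ) ^
          (1 / (p / (p - 1))) ≤ B := by
  have hQ : 0 < H.Q := hα.trans hαQ
  have hp0 : 0 < p := by linarith
  have hq0 : 0 < q := by linarith
  have hp' : 0 < p / (p - 1) := div_pos hp0 (by linarith)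
  have : LocallyCompactSpace G := ChartedSpace.locallyCompactSpace E G
  have hs0 : 0 ≤ H.Q - α := by linarith
  have hns : α - H.Q = -(H.Q - α) := by ring
  obtain ⟨C, hC⟩ := hb
  obtain ⟨C₁, hC₁, hker⟩ := N.exists_le_kernel hs0
  obtain ⟨C₂, hC₂, htest⟩ := N.exists_test_functions hμ hQ hp hw hw_loc
  refine ⟨2 ^ (H.Q - α) * C₁ * C * C₂, by finiteness, fun t ht => ?_⟩
  rw [mul_comm]
  have hlt : ∀ t, MeasurableSet {y | N.r y < t} := fun t =>
    measurableSet_lt N.measurable_r measurable_const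
  have hstep : ∀ n : ℕ, (∫⁻ x in {x | t ≤ N.r x ∧ N.r x < n},
      N.dualDensity μ p (α * (p / (p - 1))) w x ∂μ) ^ (1 / (p / (p - 1))) *
        (∫⁻ x in N.ball 1 t, ENNReal.ofReal (v x) ∂μ) ^ (1 / q) ≤
          2 ^ (H.Q - α) * C₁ * C * C₂ := by
    intro n
    obtain ⟨hAt, h, f, hhm, hf, hfh, hAh, hfn⟩ := htest α t n ht
    set S := {x | t ≤ N.r x ∧ N.r x < n} with hS
    set A := ∫⁻ x in S, N.dualDensity μ p (α * (p / (p - 1))) w x ∂μ with hA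
    refine ENNReal.rpow_mul_le_of_mul_le_mul_rpow hp hAt ?_
    -- A lower bound, up to a constant, for the Riesz kernel, uniform over `x` in the ball of radius
    -- `t`. For `r(y) < r(z)` and `t ≤ r(z)` it is in turn at least a constant times `r(z) ^ (α -
    -- Q)`.
    set κ : G → ℝ≥0∞ := fun y => ENNReal.ofReal (t + N.r y) ^ (-(H.Q - α)) with hκ
    have hκm : Measurable κ :=
      (measurable_const.add N.measurable_r).ennreal_ofReal.pow_const _
    have hAf : A ≤ 2 ^ (H.Q - α) * ∫⁻ y, f y * κ y ∂μ := by
      have h1 := setLIntegral_lintegral_lt_swap (μ := μ) (ν := weightMeasure μ w) N.measurable_r hhm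
        hκm univ
      rw [Measure.restrict_univ] at h1
      simp_rw [hfh, mul_comm _ (κ _)]
      rw [h1, hAh, ← lintegral_const_mul' _ _ (by finiteness)]
      refine (setLIntegral_mono' ((measurableSet_le measurable_const N.measurable_r).inter (hlt _))
        fun z hz => ?_).trans (setLIntegral_le_lintegral S _)
      have hz0 : 0 < N.r z := ht.trans_le hz.1
      rw [mul_left_comm]
      refine mul_le_mul' le_rfl ?_
      have h2 : N.rpow (-(H.Q - α)) z * N.rpow H.Q z = N.rpow α z := by
        rw [rpow, rpow, rpow, ← ENNReal.rpow_add _ _ (by simpa using hz0) ENNReal.ofReal_ne_top]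
        congr 1
        ring
      have h3 : ∀ y, N.r y < N.r z → N.rpow (-(H.Q - α)) z ≤ 2 ^ (H.Q - α) * κ y := by
        intro y hy
        refine ENNReal.rpow_neg_le_mul_rpow_neg hs0 two_ne_zero (by simp) ?_
        rw [show (2 : ℝ≥0∞) = ENNReal.ofReal 2 by simp, ← ENNReal.ofReal_mul (by norm_num)]
        refine ENNReal.ofReal_le_ofReal ?_
        have : t ≤ N.r z := hz.1
        linarith
      rw [← lintegral_const_mul' _ _ (by finiteness), ← h2,
        show N.rpow H.Q z = μ {y | N.r y < N.r z} from (N.measure_lt hμ hQ _).symm,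
        ← setLIntegral_const]
      exact setLIntegral_mono' (hlt _) fun y hy => h3 y hy
    have hbd := hC f hf (hfn.trans_lt (by finiteness))
    have hlow := mul_rpow_lintegral_le_weightedNorm (μ := μ) (v := v) hq0 (A := A)
      (C := 2 ^ (H.Q - α) * C₁) (b := fun _ => 1) (F := N.rieszPotential μ α f) hAt (by finiteness)
      (N.measurableSet_ball_one t) (Eventually.of_forall fun x hx => by
        rw [mem_ball_one] at hx
        rw [one_mul, mul_assoc]
        refine hAf.trans (mul_le_mul' le_rfl ?_)
        rw [rieszPotential, hns, ← lintegral_const_mul' _ _ hC₁]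
        refine lintegral_mono fun y => ?_
        rw [mul_left_comm]
        refine mul_le_mul' le_rfl (le_trans ?_ (hker x y))
        simp only [hκ]
        rw [ENNReal.rpow_neg, ENNReal.rpow_neg]
        refine ENNReal.inv_le_inv.2 (ENNReal.rpow_le_rpow (ENNReal.ofReal_le_ofReal ?_) hs0)
        linarith)
    simp only [ENNReal.one_rpow, one_mul] at hlow
    calc _ ≤ 2 ^ (H.Q - α) * C₁ * (C * (C₂ * A ^ (1 / p))) :=
          hlow.trans (mul_le_mul' le_rfl (hbd.trans (mul_le_mul' le_rfl hfn)))
      _ = _ := by ring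
  have hsup : ∫⁻ x in (N.ball 1 t)ᶜ, N.dualDensity μ p (α * (p / (p - 1))) w x ∂μ =
      ⨆ n : ℕ, ∫⁻ x in {x | t ≤ N.r x ∧ N.r x < n},
        N.dualDensity μ p (α * (p / (p - 1))) w x ∂μ := by
    have hmono : Monotone fun n : ℕ => {x | t ≤ N.r x ∧ N.r x < n} :=
      fun m n hmn x hx => ⟨hx.1, hx.2.trans_le (by exact_mod_cast hmn)⟩
    rw [← setLIntegral_iUnion_of_directed _ hmono.directed_le]
    congr 2
    ext x
    rw [mem_compl_iff, mem_ball_one, not_lt, mem_iUnion]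
    refine ⟨fun h => ?_, fun ⟨n, hn⟩ => hn.1⟩
    obtain ⟨n, hn⟩ := exists_nat_gt (N.r x)
    exact ⟨n, h, hn⟩
  rw [hsup]
  exact ENNReal.iSup_rpow_mul_le (by positivity) (by finiteness) hstep

end HomogeneousNorm

end

theorem mainTheorem1 {E G : Type*} [NormedAddCommGroup E] [NormedSpace ℝ E]
    [FiniteDimensional ℝ E] [TopologicalSpace G] [T2Space G] [SecondCountableTopology G]
    [ChartedSpace E G] [Group G] [LieGroup 𝓘(ℝ, E) ∞ G] [MeasurableSpace G] [BorelSpace G]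
    (H : HomogeneousGroup E G) (N : HomogeneousNorm H)
    (μ : Measure G) [μ.IsHaarMeasure] (hμ : μ (N.ball 1 1) = 1)
    (α p q : ℝ) (hα : 0 < α) (hαQ : α < H.Q) (hp : 1 < p) (hpq : p ≤ q)
    (v w : G → ℝ) (hv : IsWeight μ v) (hw : IsWeight μ w)
    (hw_loc : LocallyIntegrable w μ)
    (hDC : N.DCDual μ α p w ∨ N.DC μ v)
    (hw_top : ∫⁻ x, ENNReal.ofReal (w x) ∂μ = ⊤) :
    N.RieszBounded μ α p q w v ↔
      (⨆ (t : ℝ) (_ : 0 < t),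
        (∫⁻ x in N.ball 1 t, ENNReal.ofReal (w x) ∂μ) ^ (-(1 / p)) *
          (∫⁻ x in N.ball 1 t, N.rpow (α * q) x * ENNReal.ofReal (v x) ∂μ) ^ (1 / q)) < ⊤ ∧
      (⨆ (t : ℝ) (_ : 0 < t),
        (∫⁻ x in N.ball 1 t, N.dualDensity μ p ((p / (p - 1)) * H.Q) w x ∂μ) ^
            (1 / (p / (p - 1))) *
          (∫⁻ x in (N.ball 1 t)ᶜ, N.rpow ((α - H.Q) * q) x * ENNReal.ofReal (v x) ∂μ) ^
            (1 / q)) < ⊤ ∧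
      (⨆ (t : ℝ) (_ : 0 < t),
        (∫⁻ x in N.ball 1 t, ENNReal.ofReal (v x) ∂μ) ^ (1 / q) *
          (∫⁻ x in (N.ball 1 t)ᶜ, N.dualDensity μ p (α * (p / (p - 1))) w x ∂μ) ^
            (1 / (p / (p - 1)))) < ⊤ := by
  constructor
  · intro hb
    obtain ⟨B₁, hB₁, h₁⟩ := N.exists_local_bound_of_rieszBounded hα hαQ hμ hp hpq hw hw_loc hb
    obtain ⟨B₂, hB₂, h₂⟩ := N.exists_hardy_bound_of_rieszBounded hα hαQ hμ hp hpq hw hw_loc hb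
    obtain ⟨B₃, hB₃, h₃⟩ := N.exists_conj_hardy_bound_of_rieszBounded hα hαQ hμ hp hpq hw hw_loc hb
    exact ⟨(iSup₂_le h₁).trans_lt hB₁.lt_top, (iSup₂_le h₂).trans_lt hB₂.lt_top,
      (iSup₂_le h₃).trans_lt hB₃.lt_top⟩
  · rintro ⟨-, h₂, h₃⟩
    exact N.rieszBounded_of_hardy_conditions hμ hα hαQ hp hpq hv hw hw_loc hw_top h₂.ne h₃.ne
      (fun t ht => le_iSup₂_of_le t ht le_rfl) (fun t ht => le_iSup₂_of_le t ht le_rfl)
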